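/- Work on a unit-cost word RAM with zero-initialised memory, the operations addition, truncated subtraction, multiplication, integer division and remainder, comparisons, and indirect addressing. A straight line program (SLP) of size $n\ge 1$ over an alphabet $\Sigma$ is a sequence of assignments $X_1=\mathit{expr}_1,\dots,X_n=\mathit{expr}_n$, where each $\mathit{expr}_i$ is either a letter $a\in\Sigma$ or $X_\ell X_r$ with $\ell,r<i$; it represents the string $T$ derived from $X_n$. For a string $P$ let $\mathrm{Occ}(T,P)$ be the set of positions at which $P$ occurs in $T$. Theorem. There is a single RAM program with the following property. For every $c\in\mathbb N$ there is a constant $C$ such that for all integers $q>0$ and $\sigma$ and every SLP of size $n$ over the integer alphabet $\Sigma=\{0,\dots,\sigma-1\}$ with $\sigma\le c\,(qn)^c$ (in particular, for every fixed finite alphabet), representing a string $T$, the program, given $q$ and the SLP, halts after at most $C\,qn$ steps, uses at most $C\,qn$ memory cells, and handles only numbers smaller than $(|T|+qn+\sigma)^C$ (that is, words of $O(\log(|T|+qn+\sigma))$ bits), and outputs all $q$-gram frequencies of $T$ in the following form: a string $z$ and a list of pairs $(i,f)$ such that each pair stands for the length-$q$ substring $P$ of $z$ starting at position $i$, every $P\in\Sigma^q$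 with $\mathrm{Occ}(T,P)\ne\emptyset$ is listed exactly once, with $f=|\mathrm{Occ}(T,P)|$, and no other string is listed. -/

import Mathlib

/-! ## Strings and occurrences -/

/-- `occ T P` is the set of (0-based) positions at which the string `P` occurs in the string `T`.
Its cardinality is the occurrence frequency of `P` in `T`. -/
def occ {α : Type*} [DecidableEq α] (T P : List α) : Finset ℕ :=
  (Finset.range T.length).filter (fun k => P <+: T.drop k)

/-! ## Straight line programs -/

/-- The possible right-hand sides of the `i`-th assignment (0-based): a letter, or a
concatenation of two variables with smaller indices. -/
inductive SLPExpr (α : Type*) (i : ℕ) where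
  | letter (a : α)
  | pair (l r : Fin i)

/-- A straight line program: a nonempty sequence of `size` assignments. -/
structure SLP (α : Type*) where
  size : ℕ
  size_pos : 0 < size
  expr : (i : Fin size) → SLPExpr α i

namespace SLP

/-- The string derived from the `i`-th variable. -/
def val {α : Type*} (S : SLP α) (i : Fin S.size) : List α :=
  match S.expr i with
  | .letter a => [a]
  | .pair l r =>
      S.val ⟨l, l.isLt.trans i.isLt⟩ ++ S.val ⟨r, r.isLt.trans i.isLt⟩
termination_by (i : ℕ)

/-- The string represented by the program: the one derived from its last variable. -/
def string {α : Type*} (S : SLP α) : List α :=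
  S.val ⟨S.size - 1, Nat.sub_lt S.size_pos Nat.one_pos⟩

end SLP

/-! ## A word RAM with a step count

A program has access to finitely many registers (those it mentions) and to a random access memory.
Programs are written in structured form; every elementary instruction and every evaluation of a
test takes one step. -/

namespace RAM

/-- Arithmetic of the machine on natural numbers: `sub` is truncated, `div` and `mod` are the
integer quotient and remainder. -/
inductive BinOp where
  | add | sub | mul | div | mod

def BinOp.eval : BinOp → ℕ → ℕ → ℕ
  | .add, a, b => a + b
  | .sub, a, b => a - b
  | .mul, a, b => a * b
  | .div, a, b => a / b
  | .mod, a, b => a % b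

/-- Comparison of the contents of two registers. -/
inductive Test where
  | lt (x y : ℕ)
  | eq (x y : ℕ)

structure State where
  reg : ℕ → ℕ
  mem : ℕ → ℕ

def Test.Holds (s : State) : Test → Prop
  | .lt x y => s.reg x < s.reg y
  | .eq x y => s.reg x = s.reg y

inductive Prog where
  /-- no operation -/
  | skip
  /-- register `x` receives the constant `k` -/
  | const (x k : ℕ)
  /-- register `x` receives the result of `o` on registers `y` and `z` -/
  | arith (o : BinOp) (x y z : ℕ)
  /-- register `x` receives the content of the memory cell whose address is in register `a` -/
  | load (x a : ℕ)
  /-- the memory cell whose address is in register `a` receives the content of register `y` -/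
  | store (a y : ℕ)
  | seq (p r : Prog)
  | ite (b : Test) (p r : Prog)
  | loop (b : Test) (p : Prog)

def State.setReg (s : State) (x v : ℕ) : State :=
  { s with reg := Function.update s.reg x v }

def State.setMem (s : State) (a v : ℕ) : State :=
  { s with mem := Function.update s.mem a v }

/-- `Exec M W p s t s'`: on a machine with `M` memory cells (addresses `0, …, M - 1`) whose words
hold the numbers smaller than `W`, the program `p` started in state `s` halts after exactly `t`
steps in state `s'`. An address outside the memory or a number that does not fit into a word
makes the machine fault, that is, there is then no `t` and `s'` with `Exec M W p s t s'`. -/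
inductive Exec (M W : ℕ) : Prog → State → ℕ → State → Prop where
  | skip (s : State) : Exec M W .skip s 1 s
  | const (s : State) (x k : ℕ) (hk : k < W) :
      Exec M W (.const x k) s 1 (s.setReg x k)
  | arith (s : State) (o : BinOp) (x y z : ℕ) (hv : o.eval (s.reg y) (s.reg z) < W) :
      Exec M W (.arith o x y z) s 1 (s.setReg x (o.eval (s.reg y) (s.reg z)))
  | load (s : State) (x a : ℕ) (ha : s.reg a < M) :
      Exec M W (.load x a) s 1 (s.setReg x (s.mem (s.reg a)))
  | store (s : State) (a y : ℕ) (ha : s.reg a < M) :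
      Exec M W (.store a y) s 1 (s.setMem (s.reg a) (s.reg y))
  | seq (p r : Prog) (s₀ s₁ s₂ : State) (t₁ t₂ : ℕ)
      (h₁ : Exec M W p s₀ t₁ s₁) (h₂ : Exec M W r s₁ t₂ s₂) :
      Exec M W (.seq p r) s₀ (t₁ + t₂) s₂
  | ite_true (b : Test) (p r : Prog) (s s' : State) (t : ℕ)
      (hb : b.Holds s) (h : Exec M W p s t s') :
      Exec M W (.ite b p r) s (1 + t) s'
  | ite_false (b : Test) (p r : Prog) (s s' : State) (t : ℕ)
      (hb : ¬ b.Holds s) (h : Exec M W r s t s') :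
      Exec M W (.ite b p r) s (1 + t) s'
  | loop_false (b : Test) (p : Prog) (s : State) (hb : ¬ b.Holds s) :
      Exec M W (.loop b p) s 1 s
  | loop_true (b : Test) (p : Prog) (s₀ s₁ s₂ : State) (t₁ t₂ : ℕ)
      (hb : b.Holds s₀) (h₁ : Exec M W p s₀ t₁ s₁) (h₂ : Exec M W (.loop b p) s₁ t₂ s₂) :
      Exec M W (.loop b p) s₀ (1 + t₁ + t₂) s₂

/-- Initial state: the input stands at the beginning of the memory, all else is zero. -/
def State.ofInput (input : List ℕ) : State where
  reg := fun _ => 0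
  mem := fun a => input.getD a 0

/-- The contents of the `len` memory cells from address `a` on. -/
def State.block (s : State) (a len : ℕ) : List ℕ :=
  (List.range len).map (fun k => s.mem (a + k))

/-- The `len` pairs that are stored in the `2 * len` memory cells from address `a` on. -/
def State.pairs (s : State) (a len : ℕ) : List (ℕ × ℕ) :=
  (List.range len).map (fun k => (s.mem (a + 2 * k), s.mem (a + 2 * k + 1)))

end RAM

/-! ## The computational problem -/

/-- The three words that encode one assignment of a program over the alphabet `{0, …, σ - 1}`. -/
def SLPExpr.encode {σ i : ℕ} : SLPExpr (Fin σ) i → List ℕ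
  | .letter a => [0, a, 0]
  | .pair l r => [1, l, r]

/-- The input for the machine: `q`, the number of assignments, and the assignments in order. -/
def SLP.encode {σ : ℕ} (S : SLP (Fin σ)) (q : ℕ) : List ℕ :=
  q :: S.size :: (List.finRange S.size).flatMap (fun i => (S.expr i).encode)

/-- A string `z` and a list `L` of pairs represent the `q`-gram frequencies of `T`: a pair `(i, f)`
stands for the `q`-gram of `z` at position `i`, with frequency `f`; every `q`-gram that occurs
in `T` is listed exactly once, with its frequency in `T`, and nothing else is listed. -/
def RepresentsFreqs (q : ℕ) (T z : List ℕ) (L : List (ℕ × ℕ)) : Prop :=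
  (L.map (fun e => (z.drop e.1).take q)).Nodup ∧
  ∀ (P : List ℕ) (f : ℕ),
    (P, f) ∈ L.map (fun e => ((z.drop e.1).take q, e.2)) ↔
      P.length = q ∧ (occ T P).Nonempty ∧ f = (occ T P).card

/-- The final state `s` of a machine with `M` memory cells reports the `q`-gram frequencies of `T`:
registers 0 and 1 hold the address and length of a string `z` in memory, registers 2 and 3 hold
the address and length of a list of pairs in memory, and these represent the frequencies. -/
def RAM.State.ReportsFreqs (M : ℕ) (s : RAM.State) (q : ℕ) (T : List ℕ) : Prop :=
  s.reg 0 + s.reg 1 ≤ M ∧ s.reg 2 + 2 * s.reg 3 ≤ M ∧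
  RepresentsFreqs q T (s.block (s.reg 0) (s.reg 1)) (s.pairs (s.reg 2) (s.reg 3))

/-!
Every occurrence of a string `P` of length `q` in a string derived from `X_ℓ X_r` lies in one of the
two factors or in the window that consists of the last `q - 1` letters of the first factor and the
first `q - 1` letters of the second (`card_occ_append`). Unfolding this over the derivation tree, the
frequency of `P` in `T` is the sum over the variables of the number of times the variable occurs in
the tree, times the number of occurrences of `P` in its window (`countVars_spec`,
`Input.additive_card_occ`). The windows have length less than `2 * q`; they are written into one
string `Z` of length `N = 2 * q * n`, in which each position carries a weight (`windows_spec`). It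
remains to collect, in time `O(N)`, the positions of `Z` with equal `q`-grams, to add up their weights
and to report one position of each class (`report_spec`, `representsFreqs_leaders`).

For this purpose the `q`-grams receive names, numbers that are equal if and only if the `q`-grams are.
No sorting is needed: pairs of small numbers are named in linear time by linked lists and a
zero-initialised table (`pairName_spec`). Letters are first named digit by digit in base `N + 1`, in
boundedly many rounds because `σ` is polynomial in `q * n` (`nameLetters_spec`). Grams are then named by
a recursion similar to that of the linear time construction of suffix arrays (`nameGrams_spec`): the
triples of letters at the positions `≢ 0` modulo three form a string of two thirds of the length, and
names of its grams of length `q' = (q - 2) / 3` are names of the grams of length `3 * q'` at these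
positions. Adding at most six letters gives, for `d = 0, 1, 2`, names of the grams of length `q` at the
positions `i` with `i + d ≢ 0` (`extend_spec`, `gramEq_iff_sampled`). Any two residue classes are
comparable by one of these three namings, which permits to merge them (`merged_eq_iff`).

The algorithm is written in a small language with named variables and arrays of equal length, for
which `HT` provides total correctness with time bounds. The compiler into machine programs loses only
a constant factor in time, and a constant exponent in the size of the numbers
(`Cmd.compile_exec`).
-/

set_option linter.constructorNameAsVariable false

namespace QGram
open RAM

/-! ### A language with named variables and arrays -/

/-- The variables of the program. The variable with index `k` in this list is kept in register `k`;
the machine reports its result in the first four registers. -/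
inductive Var where
  | out0 | N | out2 | cnt | q | n | V | i | j | x | y | p | cur
  | off | len | qq | q' | m | k | six | u | t | l | r | ll | lr | o | st | en | w
  | mx | pw | g | f | bnd
  deriving DecidableEq

/-- The arrays of the program. The one with index `k` in this list becomes the `k`-th memory block
behind the input. -/
inductive Arr where
  | Z | OUT | acc | key | head | next | rep | name | ZZ | G | E0 | E1 | E2 | T1 | T2
  | OFF | LEN | QQ | OCC | PL | PRE | SUF | WT | FR
  deriving DecidableEq

/-- A state of the language: the values of the variables, the contents of the arrays, and the words
of the input, which cannot be changed. -/
structure HState where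
  v : Var → ℕ
  a : Arr → ℕ → ℕ
  inp : ℕ → ℕ

namespace HState

def setVar (s : HState) (x : Var) (k : ℕ) : HState := { s with v := Function.update s.v x k }

def setArr (s : HState) (b : Arr) (i k : ℕ) : HState :=
  { s with a := Function.update s.a b (Function.update (s.a b) i k) }

/-- All numbers in the state are smaller than `B`, and the arrays vanish beyond their length `S`. -/
structure WF (B S : ℕ) (s : HState) : Prop where
  v_lt : ∀ x, s.v x < B
  a_lt : ∀ b i, s.a b i < B
  a_out : ∀ b i, S ≤ i → s.a b i = 0
  inp_lt : ∀ i, s.inp i < B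

end HState

/-- Arithmetic expressions in variables, array entries (`get`) and words of the input (`inp`). -/
inductive Expr where
  | lit (k : ℕ)
  | var (x : Var)
  | bin (o : BinOp) (e f : Expr)
  | get (b : Arr) (e : Expr)
  | inp (e : Expr)

namespace Expr

instance : Add Expr := ⟨bin .add⟩
instance : Sub Expr := ⟨bin .sub⟩
instance : Mul Expr := ⟨bin .mul⟩
instance : Div Expr := ⟨bin .div⟩
instance : Mod Expr := ⟨bin .mod⟩
instance (k : ℕ) : OfNat Expr k := ⟨lit k⟩

def eval (s : HState) : Expr → ℕ
  | lit k => k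
  | var x => s.v x
  | bin o e f => o.eval (e.eval s) (f.eval s)
  | get b e => s.a b (e.eval s)
  | inp e => s.inp (e.eval s)

variable (s : HState) (e f : Expr)
@[simp] theorem eval_lit (k : ℕ) : (lit k).eval s = k := rfl
@[simp] theorem eval_ofNat (k : ℕ) :
    (no_index (OfNat.ofNat k : Expr)).eval s = (OfNat.ofNat k : ℕ) := rfl
@[simp] theorem eval_var (x : Var) : (var x).eval s = s.v x := rfl
@[simp] theorem eval_get (b : Arr) : (get b e).eval s = s.a b (e.eval s) := rfl
@[simp] theorem eval_inp : (inp e).eval s = s.inp (e.eval s) := rfl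
@[simp] theorem eval_add : (e + f).eval s = e.eval s + f.eval s := rfl
@[simp] theorem eval_sub : (e - f).eval s = e.eval s - f.eval s := rfl
@[simp] theorem eval_mul : (e * f).eval s = e.eval s * f.eval s := rfl
@[simp] theorem eval_div : (e / f).eval s = e.eval s / f.eval s := rfl
@[simp] theorem eval_mod : (e % f).eval s = e.eval s % f.eval s := rfl

/-- A bound for the cost of evaluating an expression, and for the bit length of all intermediate
results, measured in words. -/
def size : Expr → ℕ
  | lit k => k + 1
  | var _ => 1
  | bin _ e f => e.size + f.size + 1
  | get _ e => e.size + 1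
  | inp e => e.size + 1

end Expr

/-- Comparisons, the conditions of branches and loops. -/
inductive Cond where
  | lt (e f : Expr)
  | eq (e f : Expr)

namespace Cond

def Holds (s : HState) : Cond → Prop
  | lt e f => e.eval s < f.eval s
  | eq e f => e.eval s = f.eval s

@[simp] theorem holds_lt (s : HState) (e f : Expr) : (lt e f).Holds s ↔ e.eval s < f.eval s := Iff.rfl
@[simp] theorem holds_eq (s : HState) (e f : Expr) : (eq e f).Holds s ↔ e.eval s = f.eval s := Iff.rfl

instance (s : HState) : (b : Cond) → Decidable (b.Holds s)
  | lt e f => Nat.decLt (e.eval s) (f.eval s)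
  | eq e f => Nat.decEq (e.eval s) (f.eval s)

def size : Cond → ℕ
  | lt e f => e.size + f.size
  | eq e f => e.size + f.size

end Cond

/-- Commands; `put b i e` stores the value of `e` in the entry `i` of the array `b`. -/
inductive Cmd where
  | skip
  | assign (x : Var) (e : Expr)
  | put (b : Arr) (i e : Expr)
  | seq (c d : Cmd)
  | ite (b : Cond) (c d : Cmd)
  | loop (b : Cond) (c : Cmd)

infixr:60 " ;; " => Cmd.seq

namespace Cmd

/-- The variables that a command may change. -/
def vars : Cmd → List Var
  | skip => []
  | assign x _ => [x]
  | put _ _ _ => []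
  | seq c d => c.vars ++ d.vars
  | ite _ c d => c.vars ++ d.vars
  | .loop _ c => c.vars

/-- The arrays that a command may change. -/
def arrs : Cmd → List Arr
  | skip => []
  | assign _ _ => []
  | put b _ _ => [b]
  | seq c d => c.arrs ++ d.arrs
  | ite _ c d => c.arrs ++ d.arrs
  | .loop _ c => c.arrs

/-- The largest size of an expression, or of a pair of expressions that are evaluated together. -/
def size : Cmd → ℕ
  | skip => 1
  | assign _ e => e.size
  | put _ i e => i.size + e.size
  | seq c d => max c.size d.size
  | ite b c d => max b.size (max c.size d.size)
  | .loop b c => max b.size c.size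

/-- Runs `c` for `x = 0, …, y - 1`. -/
def forTo (x y : Var) (c : Cmd) : Cmd :=
  assign x 0 ;; .loop (.lt (.var x) (.var y)) (c ;; assign x (.var x + 1))

end Cmd

/-- The command halts after exactly `t` steps in state `s'`, and stores only numbers smaller than
`B`, at indices smaller than `S`. Every assignment and every test counts as one step. -/
inductive HExec (B S : ℕ) : Cmd → HState → ℕ → HState → Prop where
  | skip (s) : HExec B S .skip s 1 s
  | assign (s x e) (h : e.eval s < B) : HExec B S (.assign x e) s 1 (s.setVar x (e.eval s))
  | put (s b i e) (hi : i.eval s < S) (h : e.eval s < B) :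
      HExec B S (.put b i e) s 1 (s.setArr b (i.eval s) (e.eval s))
  | seq (c d s₀ s₁ s₂ t₁ t₂) (h₁ : HExec B S c s₀ t₁ s₁) (h₂ : HExec B S d s₁ t₂ s₂) :
      HExec B S (.seq c d) s₀ (t₁ + t₂) s₂
  | ite_true (b c d s s' t) (hb : b.Holds s) (h : HExec B S c s t s') :
      HExec B S (.ite b c d) s (1 + t) s'
  | ite_false (b c d s s' t) (hb : ¬ b.Holds s) (h : HExec B S d s t s') :
      HExec B S (.ite b c d) s (1 + t) s'
  | loop_false (b c s) (hb : ¬ b.Holds s) : HExec B S (.loop b c) s 1 s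
  | loop_true (b c s₀ s₁ s₂ t₁ t₂) (hb : b.Holds s₀) (h₁ : HExec B S c s₀ t₁ s₁)
      (h₂ : HExec B S (.loop b c) s₁ t₂ s₂) : HExec B S (.loop b c) s₀ (1 + t₁ + t₂) s₂

/-! ### Compilation -/

/-- The register that holds the variable. -/
def Var.reg (x : Var) : ℕ := x.ctorIdx
/-- The number of the memory block that holds the array. -/
def Arr.num (b : Arr) : ℕ := b.ctorIdx

theorem Var.reg_lt (x : Var) : x.reg < 100 := by cases x <;> decide
theorem Var.reg_inj {x y : Var} (h : x.reg = y.reg) : x = y := by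
  have := congrArg Var.ofNat h
  simpa [Var.reg, Var.ofNat_ctorIdx] using this
theorem Arr.num_lt (x : Arr) : x.num < 24 := by cases x <;> decide
theorem Arr.num_inj {x y : Arr} (h : x.num = y.num) : x = y := by
  have := congrArg Arr.ofNat h
  simpa [Arr.num, Arr.ofNat_ctorIdx] using this

/-- Evaluates the expression into register `d`, with the registers above `d` as a stack. Register
100 holds the address of the first array, which is the length of the input, and register 101 the
length of every array. Reading beyond an array or the input gives `0`. -/
def Expr.compile : Expr → ℕ → Prog
  | lit k, d => .const d k
  | var x, d => .seq (.const d 0) (.arith .add d x.reg d)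
  | bin o e f, d => .seq (e.compile d) (.seq (f.compile (d + 1)) (.arith o d d (d + 1)))
  | get b e, d => .seq (e.compile d) (.ite (.lt d 101)
      (.seq (.const (d + 1) b.num) (.seq (.arith .mul (d + 1) (d + 1) 101)
        (.seq (.arith .add d d (d + 1)) (.seq (.arith .add d d 100) (.load d d)))))
      (.const d 0))
  | inp e, d => .seq (e.compile d) (.ite (.lt d 100) (.load d d) (.const d 0))

/-- Evaluates the two sides of a comparison into the registers 102 and 103. -/
def Cond.prep : Cond → Prog
  | lt e f => .seq (e.compile 102) (f.compile 103)
  | eq e f => .seq (e.compile 102) (f.compile 103)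

/-- The test to be performed after `Cond.prep`. -/
def Cond.test : Cond → Test
  | lt _ _ => .lt 102 103
  | eq _ _ => .eq 102 103

/-- Translates a command into a machine program; the operands of a loop condition are evaluated
before the loop and again after each iteration. -/
def Cmd.compile : Cmd → Prog
  | skip => .skip
  | assign x e => .seq (e.compile 102) (.seq (.const 103 0) (.arith .add x.reg 102 103))
  | put b i e => .seq (i.compile 102) (.seq (e.compile 103) (.seq (.const 104 b.num)
      (.seq (.arith .mul 104 104 101) (.seq (.arith .add 102 102 104)
        (.seq (.arith .add 102 102 100) (.store 102 103))))))
  | seq c d => .seq c.compile d.compile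
  | ite b c d => .seq b.prep (.ite b.test c.compile d.compile)
  | .loop b c => .seq b.prep (.loop b.test (.seq c.compile b.prep))

/-- The RAM state `r` represents the state `s` of the language, in a machine with `M` cells. -/
structure Rel (M B S base : ℕ) (s : HState) (r : State) : Prop where
  wf : s.WF B S
  reg : ∀ x : Var, r.reg x.reg = s.v x
  reg_base : r.reg 100 = base
  reg_stride : r.reg 101 = S
  mem : ∀ b : Arr, ∀ i < S, r.mem (base + b.num * S + i) = s.a b i
  inp : ∀ i < base, r.mem i = s.inp i
  inp_out : ∀ i, base ≤ i → s.inp i = 0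
  fits : base + 24 * S ≤ M

theorem Rel.congr {M B S base : ℕ} {s : HState} {r r' : State} (h : Rel M B S base s r)
    (hr : ∀ x < 102, r'.reg x = r.reg x) (hm : r'.mem = r.mem) : Rel M B S base s r' where
  wf := h.wf
  reg x := by rw [hr _ (x.reg_lt.trans (by norm_num)), h.reg]
  reg_base := by rw [hr _ (by norm_num), h.reg_base]
  reg_stride := by rw [hr _ (by norm_num), h.reg_stride]
  mem := by rw [hm]; exact h.mem
  inp := by rw [hm]; exact h.inp
  inp_out := h.inp_out
  fits := h.fits

theorem num_mul_add_lt {b : Arr} {S i : ℕ} (hi : i < S) : b.num * S + i < 24 * S := by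
  have := b.num_lt
  nlinarith

/-- Every operation at most multiplies the numbers of its operands, up to a factor `2 ≤ B`. -/
theorem Expr.eval_lt {B S : ℕ} {s : HState} (h : s.WF B S) (hB : 2 ≤ B) (e : Expr) :
    e.eval s < B ^ e.size := by
  have one : ∀ k, k < B ^ (k + 1) := fun k =>
    (Nat.lt_two_pow_self.trans (Nat.pow_lt_pow_right (by norm_num) (Nat.lt_succ_self k))).trans_le
      (Nat.pow_le_pow_left hB _)
  have up : ∀ {k n : ℕ}, k < B → k < B ^ (n + 1) := fun {k n} hk =>
    hk.trans_le (Nat.le_self_pow (Nat.succ_ne_zero n) B)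
  induction e with
  | lit k => exact one k
  | var x => exact up (n := 0) (h.v_lt x)
  | get b e => exact up (h.a_lt _ _)
  | inp e => exact up (h.inp_lt _)
  | bin o e f he hf =>
    change o.eval (e.eval s) (f.eval s) < B ^ (e.size + f.size + 1)
    generalize e.eval s = x at *
    generalize f.eval s = y at *
    have hx : 1 ≤ B ^ e.size := Nat.one_le_pow _ _ (by omega)
    have hy : 1 ≤ B ^ f.size := Nat.one_le_pow _ _ (by omega)
    have hxy : B ^ (e.size + f.size + 1) = B ^ e.size * B ^ f.size * B := by ring
    rw [hxy]
    generalize B ^ e.size = p at *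
    generalize B ^ f.size = r at *
    have h1 : p ≤ p * r := Nat.le_mul_of_pos_right _ hy
    have h2 : r ≤ p * r := Nat.le_mul_of_pos_left _ hx
    have h3 : p * r * 2 ≤ p * r * B := Nat.mul_le_mul_left _ hB
    have h4 : x * y ≤ p * r := Nat.mul_le_mul he.le hf.le
    have h5 : x / y ≤ x := Nat.div_le_self _ _
    have h6 : x % y ≤ x := Nat.mod_le _ _
    have h7 : 1 ≤ p * r := Nat.mul_pos hx hy
    cases o <;> simp only [BinOp.eval] <;> omega

section simulation
variable {M W B S base : ℕ}

theorem Expr.compile_exec (hB : 2 ≤ B) (hMW : M < W) (e : Expr) :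
    ∀ (d : ℕ) (s : HState) (r : State), 102 ≤ d → Rel M B S base s r → B ^ e.size ≤ W →
    ∃ t r', Exec M W (e.compile d) r t r' ∧ t ≤ 8 * e.size ∧ r'.reg d = e.eval s ∧
      (∀ x < d, r'.reg x = r.reg x) ∧ r'.mem = r.mem := by
  induction e with
  | lit k =>
    intro d s r hd hR hW
    refine ⟨1, _, .const _ _ _ ?_, ?_, ?_, ?_, rfl⟩
    · exact (Expr.eval_lt hR.wf hB (.lit k)).trans_le hW
    · simp only [size]; omega
    · simp [State.setReg]
    · intro x hx; simp [State.setReg, Function.update_of_ne hx.ne]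
  | var x =>
    intro d s r hd hR hW
    have hx := x.reg_lt
    have hv : ((r.setReg d 0).reg x.reg) + (r.setReg d 0).reg d = s.v x := by
      rw [← hR.reg x]
      simp [State.setReg, Function.update_of_ne (show x.reg ≠ d by omega)]
    have hWx := (Expr.eval_lt hR.wf hB (.var x)).trans_le hW
    simp only [eval_var] at hWx
    refine ⟨1 + 1, _, .seq _ _ _ _ _ _ _ (.const _ _ _ (by omega)) (.arith _ _ _ _ _ ?_), ?_, ?_, ?_, rfl⟩
    · simpa only [BinOp.eval, hv] using hWx
    · simp only [size]; omega
    · simp only [BinOp.eval, hv]; simp [State.setReg]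
    · intro y hy; simp [State.setReg, Function.update_of_ne hy.ne]
  | bin o e f he hf =>
    intro d s r hd hR hW
    have hB1 : 1 ≤ B := by omega
    obtain ⟨t₁, r₁, h₁, ht₁, hd₁, hr₁, hm₁⟩ := he d s r hd hR
      ((Nat.pow_le_pow_right hB1 (by simp only [size]; omega)).trans hW)
    have hR₁ : Rel M B S base s r₁ := hR.congr (fun x hx => hr₁ x (by omega)) hm₁
    obtain ⟨t₂, r₂, h₂, ht₂, hd₂, hr₂, hm₂⟩ := hf (d + 1) s r₁ (by omega) hR₁
      ((Nat.pow_le_pow_right hB1 (by simp only [size]; omega)).trans hW)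
    have hv : o.eval (r₂.reg d) (r₂.reg (d + 1)) = (Expr.bin o e f).eval s := by
      rw [hd₂, hr₂ d (by omega), hd₁]; rfl
    refine ⟨_, _, .seq _ _ _ _ _ _ _ h₁ (.seq _ _ _ _ _ _ _ h₂ (.arith _ _ _ _ _ ?_)), ?_, ?_, ?_, ?_⟩
    · rw [hv]; exact (Expr.eval_lt hR.wf hB _).trans_le hW
    · simp only [size]; omega
    · rw [hv]; simp [State.setReg]
    · intro x hx
      simp only [State.setReg, Function.update_of_ne hx.ne]
      rw [hr₂ x (by omega), hr₁ x hx]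
    · simp only [State.setReg]; rw [hm₂, hm₁]
  | get b e he =>
    intro d s r hd hR hW
    have hB1 : 1 ≤ B := by omega
    obtain ⟨t₁, r₁, h₁, ht₁, hd₁, hr₁, hm₁⟩ := he d s r hd hR
      ((Nat.pow_le_pow_right hB1 (by simp only [size]; omega)).trans hW)
    have hR₁ : Rel M B S base s r₁ := hR.congr (fun x hx => hr₁ x (by omega)) hm₁
    have h100 : 100 ≠ d := by omega
    have h101 : 101 ≠ d := by omega
    have h100' : 100 ≠ d + 1 := by omega
    have h101' : 101 ≠ d + 1 := by omega
    by_cases hS : e.eval s < S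
    · have hlt := num_mul_add_lt (b := b) hS
      have hf := hR.fits
      have hb := b.num_lt
      have hmem := hR₁.mem b _ hS
      have hbm : b.num ≤ b.num * S := Nat.le_mul_of_pos_right _ (by omega)
      refine ⟨_, _, .seq _ _ _ _ _ _ _ h₁ (.ite_true _ _ _ _ _ _ ?_
        (.seq _ _ _ _ _ _ _ (.const _ _ _ ?_) (.seq _ _ _ _ _ _ _ (.arith _ _ _ _ _ ?_)
          (.seq _ _ _ _ _ _ _ (.arith _ _ _ _ _ ?_) (.seq _ _ _ _ _ _ _ (.arith _ _ _ _ _ ?_)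
            (.load _ _ _ ?_)))))), ?_, ?_, ?_, ?_⟩
      · simp only [Test.Holds]; rw [hd₁, hR₁.reg_stride]; exact hS
      · omega
      · simp [State.setReg, BinOp.eval, h101', hR₁.reg_stride]; omega
      · simp [State.setReg, BinOp.eval, h101', hR₁.reg_stride, hd₁]; omega
      · simp [State.setReg, BinOp.eval, h101', hR₁.reg_stride, hd₁, h100, h100', hR₁.reg_base]; omega
      · simp [State.setReg, BinOp.eval, h101', hR₁.reg_stride, hd₁, h100, h100', hR₁.reg_base]; omega
      · simp only [size]; omega
      · simp [State.setReg, BinOp.eval, h101', hR₁.reg_stride, hd₁, h100, h100', hR₁.reg_base]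
        rw [← hmem]; congr 1; ring
      · intro x hx
        have h1 : x ≠ d := by omega
        have h2 : x ≠ d + 1 := by omega
        simp [State.setReg, h1, h2, hr₁ x hx]
      · simp [State.setReg, hm₁]
    · refine ⟨_, _, .seq _ _ _ _ _ _ _ h₁ (.ite_false _ _ _ _ _ _ ?_ (.const _ _ _ (by omega))),
        ?_, ?_, ?_, ?_⟩
      · simp only [Test.Holds]; rw [hd₁, hR₁.reg_stride]; exact hS
      · simp only [size]; omega
      · simp [State.setReg, hR.wf.a_out b _ (not_lt.1 hS)]
      · intro x hx; simp [State.setReg, Function.update_of_ne hx.ne, hr₁ x hx]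
      · simp [State.setReg, hm₁]
  | inp e he =>
    intro d s r hd hR hW
    have hB1 : 1 ≤ B := by omega
    obtain ⟨t₁, r₁, h₁, ht₁, hd₁, hr₁, hm₁⟩ := he d s r hd hR
      ((Nat.pow_le_pow_right hB1 (by simp only [size]; omega)).trans hW)
    have hR₁ : Rel M B S base s r₁ := hR.congr (fun x hx => hr₁ x (by omega)) hm₁
    have hf := hR.fits
    by_cases hS : e.eval s < base
    · refine ⟨_, _, .seq _ _ _ _ _ _ _ h₁ (.ite_true _ _ _ _ _ _ ?_ (.load _ _ _ ?_)),
        ?_, ?_, ?_, ?_⟩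
      · simp only [Test.Holds]; rw [hd₁, hR₁.reg_base]; exact hS
      · rw [hd₁]; omega
      · simp only [size]; omega
      · simp [State.setReg, hd₁, hR₁.inp _ hS]
      · intro x hx; simp [State.setReg, Function.update_of_ne hx.ne, hr₁ x hx]
      · simp [State.setReg, hm₁]
    · refine ⟨_, _, .seq _ _ _ _ _ _ _ h₁ (.ite_false _ _ _ _ _ _ ?_ (.const _ _ _ (by omega))),
        ?_, ?_, ?_, ?_⟩
      · simp only [Test.Holds]; rw [hd₁, hR₁.reg_base]; exact hS
      · simp only [size]; omega
      · simp [State.setReg, hR.inp_out _ (not_lt.1 hS)]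
      · intro x hx; simp [State.setReg, Function.update_of_ne hx.ne, hr₁ x hx]
      · simp [State.setReg, hm₁]

theorem Cond.prep_exec (hB : 2 ≤ B) (hMW : M < W) (b : Cond) (s : HState) (r : State)
    (hR : Rel M B S base s r) (hW : B ^ b.size ≤ W) :
    ∃ t r', Exec M W b.prep r t r' ∧ t ≤ 8 * b.size ∧ Rel M B S base s r' ∧
      (b.test.Holds r' ↔ b.Holds s) := by
  have hB1 : 1 ≤ B := by omega
  have key : ∀ e f : Expr, B ^ (e.size + f.size) ≤ W →
      ∃ t r', Exec M W (.seq (e.compile 102) (f.compile 103)) r t r' ∧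
        t ≤ 8 * (e.size + f.size) ∧ Rel M B S base s r' ∧
        r'.reg 102 = e.eval s ∧ r'.reg 103 = f.eval s := by
    intro e f hW
    obtain ⟨t₁, r₁, h₁, ht₁, hd₁, hr₁, hm₁⟩ := e.compile_exec hB hMW 102 s r le_rfl hR
      ((Nat.pow_le_pow_right hB1 (by omega)).trans hW)
    have hR₁ : Rel M B S base s r₁ := hR.congr (fun x hx => hr₁ x (by omega)) hm₁
    obtain ⟨t₂, r₂, h₂, ht₂, hd₂, hr₂, hm₂⟩ := f.compile_exec hB hMW 103 s r₁ (by omega) hR₁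
      ((Nat.pow_le_pow_right hB1 (by omega)).trans hW)
    exact ⟨_, _, .seq _ _ _ _ _ _ _ h₁ h₂, by omega,
      hR₁.congr (fun x hx => hr₂ x (by omega)) hm₂, by rw [hr₂ _ (by omega), hd₁], hd₂⟩
  cases b with
  | lt e f =>
    obtain ⟨t, r', h, ht, hR', h1, h2⟩ := key e f hW
    exact ⟨t, r', h, ht, hR', by simp [Cond.test, Test.Holds, h1, h2]⟩
  | eq e f =>
    obtain ⟨t, r', h, ht, hR', h1, h2⟩ := key e f hW
    exact ⟨t, r', h, ht, hR', by simp [Cond.test, Test.Holds, h1, h2]⟩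

theorem Rel.setVar {s : HState} {r r' : State} (h : Rel M B S base s r) (x : Var) (k : ℕ)
    (hk : k < B) (hr : r'.reg x.reg = k) (hr' : ∀ y < 102, y ≠ x.reg → r'.reg y = r.reg y)
    (hm : r'.mem = r.mem) : Rel M B S base (s.setVar x k) r' where
  wf := by
    refine ⟨fun y => ?_, h.wf.a_lt, h.wf.a_out, h.wf.inp_lt⟩
    by_cases hy : y = x
    · subst hy; simpa [HState.setVar] using hk
    · simpa [HState.setVar, hy] using h.wf.v_lt y
  reg y := by
    by_cases hy : y = x
    · subst hy; simpa [HState.setVar] using hr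
    · simp only [HState.setVar, Function.update_of_ne hy]
      rw [← h.reg, hr' _ (y.reg_lt.trans (by norm_num)) (fun e => hy (Var.reg_inj e))]
  reg_base := by rw [hr' _ (by norm_num) (by have := x.reg_lt; omega), h.reg_base]
  reg_stride := by rw [hr' _ (by norm_num) (by have := x.reg_lt; omega), h.reg_stride]
  mem := by rw [hm]; exact h.mem
  inp := by rw [hm]; exact h.inp
  inp_out := h.inp_out
  fits := h.fits

theorem address_inj {b c : Arr} {i j : ℕ} (hi : i < S) (hj : j < S)
    (h : base + b.num * S + i = base + c.num * S + j) : b = c ∧ i = j := by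
  have hS : 0 < S := by omega
  have h' : i + S * b.num = j + S * c.num := by nlinarith
  have h1 := congrArg (· % S) h'
  have h2 := congrArg (· / S) h'
  simp only [Nat.add_mul_mod_self_left, Nat.mod_eq_of_lt hi, Nat.mod_eq_of_lt hj,
    Nat.add_mul_div_left _ _ hS, Nat.div_eq_of_lt hi, Nat.div_eq_of_lt hj, zero_add] at h1 h2
  exact ⟨Arr.num_inj h2, h1⟩

theorem HState.WF.setArr {s : HState} (h : s.WF B S) {b : Arr} {i k : ℕ} (hi : i < S)
    (hk : k < B) : (s.setArr b i k).WF B S where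
  v_lt := h.v_lt
  inp_lt := h.inp_lt
  a_lt c j := by
    simp only [HState.setArr]
    by_cases hc : c = b
    · subst hc
      rw [Function.update_self]
      by_cases hj : j = i
      · subst hj; simpa using hk
      · rw [Function.update_of_ne hj]; exact h.a_lt _ _
    · rw [Function.update_of_ne hc]; exact h.a_lt _ _
  a_out c j hj := by
    simp only [HState.setArr]
    by_cases hc : c = b
    · subst hc
      rw [Function.update_self, Function.update_of_ne (by omega)]; exact h.a_out _ _ hj
    · rw [Function.update_of_ne hc]; exact h.a_out _ _ hj

theorem HState.WF.setVar {s : HState} (h : s.WF B S) {x : Var} {k : ℕ}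
    (hk : k < B) : (s.setVar x k).WF B S := by
  refine ⟨fun y => ?_, h.a_lt, h.a_out, h.inp_lt⟩
  by_cases hy : y = x
  · subst hy; simpa [HState.setVar] using hk
  · simpa [HState.setVar, hy] using h.v_lt y

theorem Rel.setArr {s : HState} {r r' : State} (h : Rel M B S base s r) (b : Arr) (i k : ℕ)
    (hi : i < S) (hk : k < B) (hr : ∀ y < 102, r'.reg y = r.reg y)
    (hm : r'.mem = Function.update r.mem (base + b.num * S + i) k) :
    Rel M B S base (s.setArr b i k) r' where
  wf := h.wf.setArr hi hk
  reg y := by rw [hr _ (y.reg_lt.trans (by norm_num)), h.reg]; rfl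
  reg_base := by rw [hr _ (by norm_num), h.reg_base]
  reg_stride := by rw [hr _ (by norm_num), h.reg_stride]
  mem c j hj := by
    rw [hm]
    simp only [HState.setArr]
    by_cases he : base + c.num * S + j = base + b.num * S + i
    · obtain ⟨rfl, rfl⟩ := address_inj hj hi he
      simp
    · rw [Function.update_of_ne he, h.mem c j hj]
      by_cases hc : c = b
      · subst hc
        rw [Function.update_self, Function.update_of_ne (by rintro rfl; exact he rfl)]
      · rw [Function.update_of_ne hc]
  inp j hj := by rw [hm, Function.update_of_ne (by omega)]; exact h.inp j hj
  inp_out := h.inp_out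
  fits := h.fits

/-- The compiled command simulates the command with a constant factor in time. Words that hold the
numbers below `B ^ z` suffice for all intermediate results, as `z` bounds the size of the
expressions. -/
theorem Cmd.compile_exec (hB : 2 ≤ B) (hMW : M < W) {c : Cmd} {s s' : HState} {t : ℕ}
    (h : HExec B S c s t s') {z : ℕ} (hz : c.size ≤ z) (hW : B ^ z ≤ W) :
    ∀ r : State, Rel M B S base s r →
    ∃ t' r', Exec M W c.compile r t' r' ∧ t' ≤ (8 * z + 10) * t ∧ Rel M B S base s' r' := by
  have hB1 : 1 ≤ B := by omega
  have up : ∀ {k}, k ≤ z → B ^ k ≤ W := fun hk => (Nat.pow_le_pow_right hB1 hk).trans hW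
  induction h with
  | skip s => exact fun r hR => ⟨1, r, .skip _, by omega, hR⟩
  | assign s x e hv =>
    intro r hR
    simp only [Cmd.size] at hz
    obtain ⟨t₁, r₁, h₁, ht₁, hd₁, hr₁, hm₁⟩ := e.compile_exec hB hMW 102 s r le_rfl hR (up hz)
    have hx := x.reg_lt
    refine ⟨_, _, .seq _ _ _ _ _ _ _ h₁ (.seq _ _ _ _ _ _ _ (.const _ _ _ (by omega))
      (.arith _ _ _ _ _ ?_)), ?_, ?_⟩
    · simp only [BinOp.eval, State.setReg]
      simpa [hd₁] using (Expr.eval_lt hR.wf hB e).trans_le (up hz)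
    · omega
    · refine hR.setVar x _ hv ?_ ?_ ?_
      · simp [State.setReg, BinOp.eval, hd₁]
      · intro y hy hyx
        have : y ≠ 103 := by omega
        simp [State.setReg, hyx, this, hr₁ y hy]
      · simp [State.setReg, hm₁]
  | put s b i e hi hv =>
    intro r hR
    simp only [Cmd.size] at hz
    obtain ⟨t₁, r₁, h₁, ht₁, hd₁, hr₁, hm₁⟩ :=
      i.compile_exec hB hMW 102 s r le_rfl hR (up (by omega))
    have hR₁ : Rel M B S base s r₁ := hR.congr (fun x hx => hr₁ x (by omega)) hm₁
    obtain ⟨t₂, r₂, h₂, ht₂, hd₂, hr₂, hm₂⟩ :=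
      e.compile_exec hB hMW 103 s r₁ (by omega) hR₁ (up (by omega))
    have hR₂ : Rel M B S base s r₂ := hR₁.congr (fun x hx => hr₂ x (by omega)) hm₂
    have h102 : r₂.reg 102 = i.eval s := by rw [hr₂ _ (by omega), hd₁]
    have hlt := num_mul_add_lt (b := b) hi
    have hf := hR.fits
    have hb := b.num_lt
    have hbm : b.num ≤ b.num * S := Nat.le_mul_of_pos_right _ (by omega)
    refine ⟨_, _, .seq _ _ _ _ _ _ _ h₁ (.seq _ _ _ _ _ _ _ h₂
        (.seq _ _ _ _ _ _ _ (.const _ _ _ ?_) (.seq _ _ _ _ _ _ _ (.arith _ _ _ _ _ ?_)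
          (.seq _ _ _ _ _ _ _ (.arith _ _ _ _ _ ?_) (.seq _ _ _ _ _ _ _ (.arith _ _ _ _ _ ?_)
            (.store _ _ _ ?_)))))), ?_, ?_⟩
    · omega
    · simp [State.setReg, BinOp.eval, hR₂.reg_stride]; omega
    · simp [State.setReg, BinOp.eval, hR₂.reg_stride, h102]; omega
    · simp [State.setReg, BinOp.eval, hR₂.reg_stride, h102, hR₂.reg_base]; omega
    · simp [State.setReg, BinOp.eval, hR₂.reg_stride, h102, hR₂.reg_base]; omega
    · omega
    · refine hR₂.setArr b _ _ hi hv ?_ ?_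
      · intro y hy
        have h1 : y ≠ 102 := by omega
        have h2 : y ≠ 104 := by omega
        simp [State.setReg, State.setMem, h1, h2]
      · simp only [State.setReg, State.setMem, BinOp.eval]
        simp [hR₂.reg_stride, h102, hR₂.reg_base, hd₂]
        congr 1; ring
  | seq c d s₀ s₁ s₂ t₁ t₂ _ _ ih₁ ih₂ =>
    intro r hR
    simp only [Cmd.size] at hz
    obtain ⟨a₁, r₁, h₁, ha₁, hR₁⟩ := ih₁ ((le_max_left _ _).trans hz) r hR
    obtain ⟨a₂, r₂, h₂, ha₂, hR₂⟩ := ih₂ ((le_max_right _ _).trans hz) r₁ hR₁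
    exact ⟨_, _, .seq _ _ _ _ _ _ _ h₁ h₂, by rw [mul_add]; omega, hR₂⟩
  | ite_true b c d s s' t hb _ ih =>
    intro r hR
    simp only [Cmd.size] at hz
    obtain ⟨a₀, r₀, h₀, ha₀, hR₀, ht₀⟩ :=
      b.prep_exec hB hMW s r hR (up ((le_max_left _ _).trans hz))
    obtain ⟨a₁, r₁, h₁, ha₁, hR₁⟩ :=
      ih ((le_max_left _ _).trans ((le_max_right _ _).trans hz)) r₀ hR₀
    have := (le_max_left _ _).trans hz
    exact ⟨_, _, .seq _ _ _ _ _ _ _ h₀ (.ite_true _ _ _ _ _ _ (ht₀.2 hb) h₁),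
      by rw [mul_add]; omega, hR₁⟩
  | ite_false b c d s s' t hb _ ih =>
    intro r hR
    simp only [Cmd.size] at hz
    obtain ⟨a₀, r₀, h₀, ha₀, hR₀, ht₀⟩ :=
      b.prep_exec hB hMW s r hR (up ((le_max_left _ _).trans hz))
    obtain ⟨a₁, r₁, h₁, ha₁, hR₁⟩ :=
      ih ((le_max_right _ _).trans ((le_max_right _ _).trans hz)) r₀ hR₀
    have := (le_max_left _ _).trans hz
    exact ⟨_, _, .seq _ _ _ _ _ _ _ h₀ (.ite_false _ _ _ _ _ _ (fun h => hb (ht₀.1 h)) h₁),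
      by rw [mul_add]; omega, hR₁⟩
  | loop_false b c s hb =>
    intro r hR
    simp only [Cmd.size] at hz
    obtain ⟨a₀, r₀, h₀, ha₀, hR₀, ht₀⟩ :=
      b.prep_exec hB hMW s r hR (up ((le_max_left _ _).trans hz))
    have := (le_max_left _ _).trans hz
    exact ⟨_, _, .seq _ _ _ _ _ _ _ h₀ (.loop_false _ _ _ (fun h => hb (ht₀.1 h))), by omega, hR₀⟩
  | loop_true b c s₀ s₁ s₂ t₁ t₂ hb _ _ ih₁ ih₂ =>
    intro r hR
    have hz' := hz
    simp only [Cmd.size] at hz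
    obtain ⟨a₀, r₀, h₀, ha₀, hR₀, ht₀⟩ :=
      b.prep_exec hB hMW s₀ r hR (up ((le_max_left _ _).trans hz))
    obtain ⟨a₁, r₁, h₁, ha₁, hR₁⟩ := ih₁ ((le_max_right _ _).trans hz) r₀ hR₀
    obtain ⟨a₂, r₂, h₂, ha₂, hR₂⟩ := ih₂ hz' r₁ hR₁
    have := (le_max_left _ _).trans hz
    cases h₂ with
    | seq _ _ _ r₃ _ a₃ a₄ h₃ h₄ =>
      refine ⟨_, _, .seq _ _ _ _ _ _ _ h₀ (.loop_true _ _ _ _ _ _ _ (ht₀.2 hb)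
        (.seq _ _ _ _ _ _ _ h₁ h₃) h₄), ?_, hR₂⟩
      rw [mul_add, mul_add]; omega

end simulation

/-! ### Rules for proving specifications with time bounds -/

namespace HState
variable (s : HState)
@[simp] theorem setVar_v (x y : Var) (k : ℕ) :
    (s.setVar x k).v y = if y = x then k else s.v y := by
  simp [setVar, Function.update_apply]
@[simp] theorem setVar_a (x : Var) (k : ℕ) : (s.setVar x k).a = s.a := rfl
@[simp] theorem setVar_inp (x : Var) (k : ℕ) : (s.setVar x k).inp = s.inp := rfl
@[simp] theorem setArr_v (b : Arr) (i k : ℕ) : (s.setArr b i k).v = s.v := rfl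
@[simp] theorem setArr_inp (b : Arr) (i k : ℕ) : (s.setArr b i k).inp = s.inp := rfl
@[simp] theorem setArr_a (b c : Arr) (i k : ℕ) :
    (s.setArr b i k).a c = if c = b then Function.update (s.a b) i k else s.a c := by
  simp only [setArr, Function.update_apply]
end HState

/-- The states `s` and `s'` differ at most in the given variables and arrays. -/
structure Frame (vs : List Var) (bs : List Arr) (s s' : HState) : Prop where
  v : ∀ x, x ∉ vs → s'.v x = s.v x
  a : ∀ b, b ∉ bs → s'.a b = s.a b
  inp : s'.inp = s.inp

namespace Frame
variable {vs ws : List Var} {bs cs : List Arr} {s s₁ s₂ : HState}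

theorem refl (s) : Frame vs bs s s := ⟨fun _ _ => rfl, fun _ _ => rfl, rfl⟩

theorem trans (h : Frame vs bs s s₁) (h' : Frame vs bs s₁ s₂) : Frame vs bs s s₂ :=
  ⟨fun x hx => (h'.v x hx).trans (h.v x hx), fun b hb => (h'.a b hb).trans (h.a b hb),
    h'.inp.trans h.inp⟩

theorem mono (h : Frame vs bs s s₁) (hv : vs ⊆ ws) (hb : bs ⊆ cs) : Frame ws cs s s₁ :=
  ⟨fun x hx => h.v x (fun h => hx (hv h)), fun b hx => h.a b (fun h => hx (hb h)), h.inp⟩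

end Frame

variable {B S : ℕ}

theorem HExec.frame {c : Cmd} {s s' : HState} {t : ℕ} (h : HExec B S c s t s') :
    Frame c.vars c.arrs s s' := by
  induction h with
  | skip s => exact .refl s
  | assign s x e h => exact ⟨fun y hy => by simp_all [Cmd.vars], fun _ _ => rfl, rfl⟩
  | put s b i e hi h => exact ⟨fun _ _ => rfl, fun c hc => by simp_all [Cmd.arrs], rfl⟩
  | seq c d s₀ s₁ s₂ t₁ t₂ h₁ h₂ ih₁ ih₂ =>
    exact (ih₁.mono (List.subset_append_left _ _) (List.subset_append_left _ _)).trans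
      (ih₂.mono (List.subset_append_right _ _) (List.subset_append_right _ _))
  | ite_true b c d s s' t hb h ih =>
    exact ih.mono (List.subset_append_left _ _) (List.subset_append_left _ _)
  | ite_false b c d s s' t hb h ih =>
    exact ih.mono (List.subset_append_right _ _) (List.subset_append_right _ _)
  | loop_false b c s hb => exact .refl s
  | loop_true b c s₀ s₁ s₂ t₁ t₂ hb h₁ h₂ ih₁ ih₂ => exact ih₁.trans ih₂

theorem HExec.wf {c : Cmd} {s s' : HState} {t : ℕ} (h : HExec B S c s t s') :
    s.WF B S → s'.WF B S := by
  induction h with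
  | skip s => exact id
  | assign s x e h => exact fun hs => hs.setVar h
  | put s b i e hi h => exact fun hs => hs.setArr hi h
  | seq c d s₀ s₁ s₂ t₁ t₂ h₁ h₂ ih₁ ih₂ => exact fun hs => ih₂ (ih₁ hs)
  | ite_true b c d s s' t hb h ih => exact ih
  | ite_false b c d s s' t hb h ih => exact ih
  | loop_false b c s hb => exact id
  | loop_true b c s₀ s₁ s₂ t₁ t₂ hb h₁ h₂ ih₁ ih₂ => exact fun hs => ih₂ (ih₁ hs)

/-- Started in `s`, the command `c` halts after at most `T` steps in a state that satisfies `Q`. -/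
def HT (B S : ℕ) (c : Cmd) (s : HState) (T : ℕ) (Q : HState → Prop) : Prop :=
  s.WF B S → ∃ t s', HExec B S c s t s' ∧ t ≤ T ∧ Q s'

namespace HT
variable {c d : Cmd} {s : HState} {T T₁ T₂ : ℕ} {Q R : HState → Prop}

theorem conseq (h : HT B S c s T₁ R) (hT : T₁ ≤ T)
    (hQ : ∀ s', s'.WF B S → Frame c.vars c.arrs s s' → R s' → Q s') : HT B S c s T Q := fun hs => by
  obtain ⟨t, s', he, ht, hR⟩ := h hs
  exact ⟨t, s', he, ht.trans hT, hQ s' (he.wf hs) he.frame hR⟩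

theorem of_wf (h : s.WF B S → HT B S c s T Q) : HT B S c s T Q := fun hs => h hs hs

theorem seq (T₁ T₂ : ℕ) (h₁ : HT B S c s T₁ R)
    (h₂ : ∀ s', s'.WF B S → Frame c.vars c.arrs s s' → R s' → HT B S d s' T₂ Q)
    (hT : T₁ + T₂ ≤ T) : HT B S (c ;; d) s T Q := fun hs => by
  obtain ⟨t, s', he, ht, hR⟩ := h₁ hs
  obtain ⟨t', s'', he', ht', hR'⟩ := h₂ s' (he.wf hs) he.frame hR (he.wf hs)
  exact ⟨_, _, .seq _ _ _ _ _ _ _ he he', by omega, hR'⟩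

theorem assoc {e : Cmd} (h : HT B S ((c ;; d) ;; e) s T Q) : HT B S (c ;; d ;; e) s T Q := fun hs => by
  obtain ⟨t, s', he, ht, hR⟩ := h hs
  cases he with
  | seq _ _ _ _ _ _ _ h₁ h₂ =>
    cases h₁ with
    | seq _ _ _ _ _ _ _ h₃ h₄ =>
      exact ⟨_, _, .seq _ _ _ _ _ _ _ h₃ (.seq _ _ _ _ _ _ _ h₄ h₂), by omega, hR⟩

theorem ite {b : Cond} (hc : b.Holds s → HT B S c s T₁ Q) (hd : ¬ b.Holds s → HT B S d s T₁ Q)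
    (hT : T₁ + 1 ≤ T) : HT B S (.ite b c d) s T Q := fun hs => by
  by_cases hb : b.Holds s
  · obtain ⟨t, s', he, ht, hR⟩ := hc hb hs
    exact ⟨_, _, .ite_true _ _ _ _ _ _ hb he, by omega, hR⟩
  · obtain ⟨t, s', he, ht, hR⟩ := hd hb hs
    exact ⟨_, _, .ite_false _ _ _ _ _ _ hb he, by omega, hR⟩

/-- Rule for loops: the potential `Φ` pays for the body and the test of each iteration. -/
theorem loop {b : Cond} (I : HState → Prop) (Φ : HState → ℕ) (h0 : I s)
    (hbody : ∀ s₁, s₁.WF B S → Frame c.vars c.arrs s s₁ → I s₁ → b.Holds s₁ →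
      ∃ T₁, HT B S c s₁ T₁ (fun s₂ => I s₂ ∧ 1 + T₁ + Φ s₂ ≤ Φ s₁))
    (hT : Φ s + 1 ≤ T)
    (hQ : ∀ s₁, s₁.WF B S → Frame c.vars c.arrs s s₁ → I s₁ → ¬ b.Holds s₁ → Q s₁) :
    HT B S (.loop b c) s T Q := fun hs => by
  suffices H : ∀ n s₁, Φ s₁ = n → s₁.WF B S → Frame c.vars c.arrs s s₁ → I s₁ →
      ∃ t s', HExec B S (.loop b c) s₁ t s' ∧ t ≤ Φ s₁ + 1 ∧ Q s' by
    obtain ⟨t, s', h1, h2, h3⟩ := H _ s rfl hs (.refl s) h0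
    exact ⟨t, s', h1, h2.trans hT, h3⟩
  intro n
  induction n using Nat.strong_induction_on with
  | _ n ih =>
    intro s₁ hn hw hF hI
    by_cases hb : b.Holds s₁
    · obtain ⟨T₁, h⟩ := hbody s₁ hw hF hI hb
      obtain ⟨t, s₂, he, ht, hI₂, hΦ⟩ := h hw
      obtain ⟨t', s₃, he', ht', hQ'⟩ :=
        ih (Φ s₂) (by omega) s₂ rfl (he.wf hw) (hF.trans he.frame) hI₂
      exact ⟨_, _, .loop_true _ _ _ _ _ _ _ hb he he', by omega, hQ'⟩
    · exact ⟨_, _, .loop_false _ _ _ hb, by omega, hQ s₁ hw hF hI hb⟩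

end HT

namespace Cmd

/-- The state after a loop-free command; loops have a dummy value. -/
def run : Cmd → HState → HState
  | skip, s => s
  | assign x e, s => s.setVar x (e.eval s)
  | put b i e, s => s.setArr b (i.eval s) (e.eval s)
  | seq c d, s => d.run (c.run s)
  | ite b c d, s => if b.Holds s then c.run s else d.run s
  | .loop _ _, s => s

/-- The command is loop-free and stores only numbers below `B`, at indices below `S`. -/
def Safe (B S : ℕ) : Cmd → HState → Prop
  | skip, _ => True
  | assign _ e, s => e.eval s < B
  | put _ i e, s => i.eval s < S ∧ e.eval s < B
  | seq c d, s => c.Safe B S s ∧ d.Safe B S (c.run s)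
  | ite b c d, s => (b.Holds s → c.Safe B S s) ∧ (¬ b.Holds s → d.Safe B S s)
  | .loop _ _, _ => False

/-- A bound for the number of steps of a loop-free command. -/
def cost : Cmd → ℕ
  | skip => 1
  | assign _ _ => 1
  | put _ _ _ => 1
  | seq c d => c.cost + d.cost
  | ite _ c d => max c.cost d.cost + 1
  | .loop _ _ => 0

end Cmd

/-- A loop-free command is specified by symbolic evaluation. -/
theorem HT.straight {c : Cmd} {s : HState} {T : ℕ} {Q : HState → Prop}
    (hs : s.WF B S → c.Safe B S s) (hT : c.cost ≤ T) (hQ : s.WF B S → Q (c.run s)) :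
    HT B S c s T Q := fun hw => by
  suffices H : ∀ (c : Cmd) s, c.Safe B S s → ∃ t ≤ c.cost, HExec B S c s t (c.run s) by
    obtain ⟨t, ht, he⟩ := H c s (hs hw)
    exact ⟨t, _, he, ht.trans hT, hQ hw⟩
  clear hs hT hQ hw
  intro c
  induction c with
  | skip => exact fun s h => ⟨1, le_rfl, .skip s⟩
  | assign x e => exact fun s h => ⟨1, le_rfl, .assign s x e h⟩
  | put b i e => exact fun s h => ⟨1, le_rfl, .put s b i e h.1 h.2⟩
  | seq c d hc hd =>
    intro s h
    obtain ⟨t, ht, he⟩ := hc s h.1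
    obtain ⟨t', ht', he'⟩ := hd _ h.2
    exact ⟨t + t', by simp only [Cmd.cost]; omega, .seq _ _ _ _ _ _ _ he he'⟩
  | ite b c d hc hd =>
    intro s h
    by_cases hb : b.Holds s
    · obtain ⟨t, ht, he⟩ := hc s (h.1 hb)
      refine ⟨1 + t, by simp only [Cmd.cost]; omega, ?_⟩
      simp only [Cmd.run, if_pos hb]
      exact .ite_true _ _ _ _ _ _ hb he
    · obtain ⟨t, ht, he⟩ := hd s (h.2 hb)
      refine ⟨1 + t, by simp only [Cmd.cost]; omega, ?_⟩
      simp only [Cmd.run, if_neg hb]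
      exact .ite_false _ _ _ _ _ _ hb he
  | loop b c => exact fun s h => h.elim

/-- Rule for a counting loop; the `k`-th iteration takes at most `T k` steps. -/
theorem HT.forTo' {x y : Var} {c : Cmd} {s : HState} {Q : HState → Prop} {T₀ : ℕ}
    (I : ℕ → HState → Prop) (n : ℕ) (T : ℕ → ℕ)
    (hxy : x ≠ y) (hx : x ∉ c.vars) (hy : y ∉ c.vars) (hn : s.v y = n)
    (hI : ∀ k s₁ m, I k s₁ → I k (s₁.setVar x m)) (h0 : I 0 s)
    (hbody : ∀ k < n, ∀ s₁, s₁.WF B S → Frame (x :: c.vars) c.arrs s s₁ → s₁.v x = k → I k s₁ →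
      HT B S c s₁ (T k) (I (k + 1)))
    (hT : (∑ k ∈ Finset.range n, (T k + 2)) + 2 ≤ T₀)
    (hQ : ∀ s₁, s₁.WF B S → Frame (x :: c.vars) c.arrs s s₁ → I n s₁ → Q s₁) :
    HT B S (.forTo x y c) s T₀ Q := by
  refine HT.of_wf fun hw => ?_
  have hnB : n < B := hn ▸ hw.v_lt y
  have hc1 : ∀ z, z ∈ c.vars → z ∈ x :: c.vars := fun z hz => List.mem_cons_of_mem _ hz
  have hadd : (c ;; Cmd.assign x (.var x + 1)).vars ⊆ x :: c.vars := by
    intro z hz; simp only [Cmd.vars, List.mem_append, List.mem_cons, List.not_mem_nil] at hz ⊢; tauto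
  have hadd' : (c ;; Cmd.assign x (.var x + 1)).arrs ⊆ c.arrs := by
    intro z hz; simpa [Cmd.arrs] using hz
  have hF0 : Frame (x :: c.vars) c.arrs s (s.setVar x 0) :=
    ⟨fun z hz => by rw [List.mem_cons, not_or] at hz; simp [hz.1], fun _ _ => rfl, rfl⟩
  refine HT.seq 1 (∑ k ∈ Finset.range n, (T k + 2) + 1) (R := fun s₁ => s₁ = s.setVar x 0) (.straight ?_ le_rfl ?_) ?_
    (by omega)
  · intro _; simp only [Cmd.Safe, Expr.eval_ofNat]; omega
  · intro _; rfl
  intro s₀ hw₀ _ e₀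
  subst e₀
  refine HT.loop (fun s₁ => ∃ k ≤ n, s₁.v x = k ∧ I k s₁)
    (fun s₁ => ∑ k ∈ Finset.Ico (s₁.v x) n, (T k + 2)) ⟨0, Nat.zero_le _, by simp, hI _ _ _ h0⟩ ?_ ?_ ?_
  · rintro s₁ hw₁ hF₁ ⟨k, hk, hxk, hIk⟩ hb
    have hF : Frame (x :: c.vars) c.arrs s s₁ := hF0.trans (hF₁.mono hadd hadd')
    have hyn : s₁.v y = n := by rw [hF.v y (by simp [hxy.symm, hy]), hn]
    have hkn : k < n := by simpa [hxk, hyn] using hb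
    refine ⟨T k + 1, HT.seq (T k) 1 (hbody k hkn s₁ hw₁ hF hxk hIk) ?_ le_rfl⟩
    intro s₂ hw₂ hF₂ hI₂
    have hx₂ : s₂.v x = k := by rw [hF₂.v x hx, hxk]
    refine .straight ?_ le_rfl ?_
    · intro _; simp only [Cmd.Safe, Expr.eval_add, Expr.eval_var, Expr.eval_ofNat, hx₂]; omega
    · intro _
      simp only [Cmd.run, Expr.eval_add, Expr.eval_var, Expr.eval_ofNat, hx₂]
      refine ⟨⟨k + 1, hkn, by simp, hI _ _ _ hI₂⟩, ?_⟩
      simp only [HState.setVar_v, if_true, hxk]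
      rw [Finset.sum_eq_sum_Ico_succ_bot hkn]
      omega
  · simp
  · rintro s₁ hw₁ hF₁ ⟨k, hk, hxk, hIk⟩ hb
    have hF : Frame (x :: c.vars) c.arrs s s₁ := hF0.trans (hF₁.mono hadd hadd')
    have hyn : s₁.v y = n := by rw [hF.v y (by simp [hxy.symm, hy]), hn]
    have hkn : ¬ k < n := by simpa [hxk, hyn] using hb
    obtain rfl : k = n := by omega
    exact hQ s₁ hw₁ hF hIk

/-- Rule for a counting loop whose iterations take at most `T` steps. -/
theorem HT.forTo {x y : Var} {c : Cmd} {s : HState} {Q : HState → Prop} {T₀ : ℕ}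
    (I : ℕ → HState → Prop) (n : ℕ) (T : ℕ)
    (hxy : x ≠ y) (hx : x ∉ c.vars) (hy : y ∉ c.vars) (hn : s.v y = n)
    (hI : ∀ k s₁ m, I k s₁ → I k (s₁.setVar x m)) (h0 : I 0 s)
    (hbody : ∀ k < n, ∀ s₁, s₁.WF B S → Frame (x :: c.vars) c.arrs s s₁ → s₁.v x = k → I k s₁ →
      HT B S c s₁ T (I (k + 1)))
    (hT : n * (T + 2) + 2 ≤ T₀)
    (hQ : ∀ s₁, s₁.WF B S → Frame (x :: c.vars) c.arrs s s₁ → I n s₁ → Q s₁) :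
    HT B S (.forTo x y c) s T₀ Q :=
  HT.forTo' I n (fun _ => T) hxy hx hy hn hI h0 hbody (by simpa using hT) hQ

/-- Filling an initial segment of an array. -/
theorem HT.fill {x y : Var} {b : Arr} {e : Expr} {s : HState} {T₀ : ℕ} {Q : HState → Prop}
    (n : ℕ) (f : ℕ → ℕ)
    (hxy : x ≠ y) (hn : s.v y = n)
    (he : ∀ k < n, ∀ s₁, s₁.WF B S → Frame [x] [b] s s₁ → s₁.v x = k →
      (∀ i < k, s₁.a b i = f i) → (∀ i, k ≤ i → s₁.a b i = s.a b i) →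
      e.eval s₁ = f k ∧ f k < B) (hnS : n ≤ S) (hT : n * 3 + 2 ≤ T₀)
    (hQ : ∀ s₁, s₁.WF B S → Frame [x] [b] s s₁ → (∀ i < n, s₁.a b i = f i) →
      (∀ i, n ≤ i → s₁.a b i = s.a b i) → Q s₁) :
    HT B S (.forTo x y (.put b (.var x) e)) s T₀ Q := by
  refine HT.forTo (fun k s₁ => (∀ i < k, s₁.a b i = f i) ∧ ∀ i, k ≤ i → s₁.a b i = s.a b i) n 1
    hxy (by simp [Cmd.vars]) (by simp [Cmd.vars]) hn (fun _ _ _ h => h) ⟨by simp, by simp⟩ ?_ hT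
    (fun s₁ hw hF h => hQ s₁ hw hF h.1 h.2)
  rintro k hk s₁ hw hF hx ⟨h1, h2⟩
  obtain ⟨h3, h4⟩ := he k hk s₁ hw hF hx h1 h2
  refine .straight (fun _ => ?_) le_rfl (fun _ => ?_)
  · simp only [Cmd.Safe, Expr.eval_var, hx, h3]; exact ⟨by omega, h4⟩
  · simp only [Cmd.run, Expr.eval_var, hx, h3, HState.setArr_a, if_true]
    constructor
    · intro i hi
      rcases Nat.lt_succ_iff_lt_or_eq.1 hi with h | rfl
      · rw [Function.update_of_ne h.ne, h1 i h]
      · simp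
    · intro i hi
      rw [Function.update_of_ne (by omega), h2 i (by omega)]

/-! ### Naming pairs -/

/-- One plus the largest `j < k` with `f j = b`, and zero if there is none. -/
def lastOcc (f : ℕ → ℕ) (b : ℕ) : ℕ → ℕ
  | 0 => 0
  | k + 1 => if f k = b then k + 1 else lastOcc f b k

theorem lastOcc_le (f : ℕ → ℕ) (b k : ℕ) : lastOcc f b k ≤ k := by
  induction k with
  | zero => exact le_rfl
  | succ k ih => simp only [lastOcc]; split <;> omega

theorem lastOcc_spec (f : ℕ → ℕ) (b k : ℕ) (h : 0 < lastOcc f b k) :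
    f (lastOcc f b k - 1) = b := by
  induction k with
  | zero => simp [lastOcc] at h
  | succ k ih =>
    simp only [lastOcc] at h ⊢
    split
    · simpa
    · rename_i h'; rw [if_neg h'] at h; exact ih h

theorem lastOcc_max (f : ℕ → ℕ) (b k j : ℕ) (h : lastOcc f b k ≤ j) (hj : j < k) : f j ≠ b := by
  induction k with
  | zero => omega
  | succ k ih =>
    simp only [lastOcc] at h
    split at h
    · omega
    · rcases Nat.lt_succ_iff_lt_or_eq.1 hj with h' | rfl
      · exact ih h h'
      · assumption

/-- The partial naming of the pairs `(f j, g j)`, `D j`: `out j` is a representative of the class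
of `j`, and `rep b` is one plus some processed position with second component `b`, if there is
one. -/
structure Grp (f g : ℕ → ℕ) (V : ℕ) (D : ℕ → Prop) (out rep : ℕ → ℕ) : Prop where
  lt : ∀ j, D j → j < V
  out_mem : ∀ j, D j → D (out j)
  out_iff : ∀ i j, D i → D j → (out i = out j ↔ f i = f j ∧ g i = g j)
  rep_some : ∀ b, 0 < rep b → D (rep b - 1) ∧ g (rep b - 1) = b
  rep_none : ∀ b, rep b = 0 → ∀ j, D j → g j ≠ b

theorem Grp.congr {f g : ℕ → ℕ} {V : ℕ} {D D' : ℕ → Prop} {out rep : ℕ → ℕ}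
    (h : Grp f g V D out rep) (hD : ∀ j, D j ↔ D' j) : Grp f g V D' out rep := by
  obtain rfl : D = D' := funext fun j => propext (hD j)
  exact h

/-- One step of the naming, which processes the position `j`. By `hl`, every processed position with
the same first component as `j` belongs to the list being searched, so that the table, when it
points to a position outside this list, cannot hide an equal pair. -/
theorem Grp.step {f g : ℕ → ℕ} {V : ℕ} {D : ℕ → Prop} {out rep : ℕ → ℕ} {j : ℕ}
    (h : Grp f g V D out rep) (hj : j < V) (hD : ¬ D j)
    (hl : ∀ i, D i → f i = f j → f (rep (g i) - 1) = f j) :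
    Grp f g V (fun i => D i ∨ i = j)
      (Function.update out j
        (if 0 < rep (g j) ∧ f (rep (g j) - 1) = f j then out (rep (g j) - 1) else j))
      (Function.update rep (g j) (j + 1)) := by
  have hne : ∀ i, D i → i ≠ j := fun i hi e => hD (e ▸ hi)
  have key : ∀ i, D i → ((if 0 < rep (g j) ∧ f (rep (g j) - 1) = f j then out (rep (g j) - 1)
      else j) = out i ↔ f j = f i ∧ g j = g i) := by
    intro i hi
    split
    · rename_i hc
      obtain ⟨h1, h2⟩ := h.rep_some _ hc.1
      rw [h.out_iff _ _ h1 hi, hc.2, h2]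
    · rename_i hc
      constructor
      · exact fun e => absurd e.symm (hne _ (h.out_mem i hi))
      · rintro ⟨e1, e2⟩
        refine absurd ⟨?_, ?_⟩ hc
        · by_contra h0
          exact h.rep_none (g j) (by omega) i hi e2.symm
        · rw [e2]; exact hl i hi e1.symm
  refine ⟨?_, ?_, ?_, ?_, ?_⟩
  · rintro i (hi | rfl)
    · exact h.lt i hi
    · exact hj
  · rintro i (hi | rfl)
    · rw [Function.update_of_ne (hne i hi)]; exact .inl (h.out_mem i hi)
    · rw [Function.update_self]
      split
      · rename_i hc
        exact .inl (h.out_mem _ (h.rep_some _ hc.1).1)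
      · exact .inr rfl
  · rintro i i' (hi | rfl) (hi' | rfl)
    · rw [Function.update_of_ne (hne i hi), Function.update_of_ne (hne i' hi')]
      exact h.out_iff i i' hi hi'
    · rw [Function.update_of_ne (hne i hi), Function.update_self, eq_comm, key i hi]
      tauto
    · rw [Function.update_of_ne (hne i' hi'), Function.update_self, key i' hi']
    · simp
  · intro b hb
    by_cases e : b = g j
    · subst e; simp
    · rw [Function.update_of_ne e] at hb ⊢
      exact ⟨.inl (h.rep_some b hb).1, (h.rep_some b hb).2⟩
  · intro b hb
    by_cases e : b = g j
    · subst e; simp at hb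
    · rw [Function.update_of_ne e] at hb
      rintro i (hi | rfl)
      · exact h.rep_none b hb i hi
      · exact fun h => e h.symm

open Cmd QGram.Expr in
/-- Replaces `acc i`, `i < V`, by a name of the pair `(acc i, key i)`. The positions are distributed
over linked lists by the first component; the lists are then searched one after the other, with a
table of the positions that were seen with a given second component. -/
def pairName : Cmd :=
  forTo .i .V (
    assign .x (get .acc (var .i)) ;;
    put .next (var .i) (get .head (var .x)) ;;
    put .head (var .x) (var .i + 1)) ;;
  forTo .i .V (
    assign .x (get .acc (var .i)) ;;
    assign .cur (get .head (var .x)) ;;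
    put .head (var .x) 0 ;;
    .loop (.lt 0 (var .cur)) (
      assign .j (var .cur - 1) ;;
      assign .y (get .key (var .j)) ;;
      assign .p (get .rep (var .y)) ;;
      .ite (.lt 0 (var .p))
        (.ite (.eq (get .acc (var .p - 1)) (var .x))
          (put .name (var .j) (get .name (var .p - 1)))
          (put .name (var .j) (var .j)))
        (put .name (var .j) (var .j)) ;;
      put .rep (var .y) (var .j + 1) ;;
      assign .cur (get .next (var .j)))) ;;
  forTo .i .V (
    put .rep (get .key (var .i)) 0 ;;
    put .acc (var .i) (get .name (var .i)))

/-- The lists, each visited from its first element only, have total length at most `V`. -/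
theorem sum_first_card (f : ℕ → ℕ) (V : ℕ) :
    ∑ k ∈ Finset.range V, (if ∃ i < k, f i = f k then 0
      else ((Finset.range V).filter (fun j => f j = f k)).card) ≤ V := by
  have h1 : ∀ k ∈ Finset.range V, (if ∃ i < k, f i = f k then 0
      else ((Finset.range V).filter (fun j => f j = f k)).card) =
      ∑ j ∈ Finset.range V, if f j = f k ∧ ¬ ∃ i < k, f i = f k then 1 else 0 := by
    intro k _
    split
    · rename_i h; simp [h]
    · rename_i h; simp [h]
  rw [Finset.sum_congr rfl h1, Finset.sum_comm]
  calc _ ≤ ∑ j ∈ Finset.range V, 1 := ?_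
    _ = V := by simp
  refine Finset.sum_le_sum fun j _ => ?_
  rw [← Finset.card_filter, Finset.card_le_one]
  intro a ha b hb
  simp only [Finset.mem_filter, not_exists, not_and] at ha hb
  rcases lt_trichotomy a b with h | h | h
  · exact absurd (ha.2.1.symm.trans hb.2.1) (hb.2.2 a h)
  · exact h
  · exact absurd (hb.2.1.symm.trans ha.2.1) (ha.2.2 b h)

/-- The search tables are empty. -/
structure Clean (s : HState) : Prop where
  head : ∀ i, s.a .head i = 0
  rep : ∀ i, s.a .rep i = 0
  T1 : ∀ i, s.a .T1 i = 0
  T2 : ∀ i, s.a .T2 i = 0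

/-- Pairs are named in linear time; the names are smaller than `V`, and the tables are left empty for
the next use. -/
theorem pairName_spec {s : HState} {V T : ℕ} (f g : ℕ → ℕ) (hV : s.v .V = V) (hVS : V ≤ S)
    (hc : Clean s) (hf : ∀ i < V, s.a .acc i = f i) (hg : ∀ i < V, s.a .key i = g i)
    (hfS : ∀ i < V, f i < S) (hgS : ∀ i < V, g i < S) (hT : 24 * V + 6 ≤ T) :
    HT B S pairName s T (fun s' => Clean s' ∧ (∀ i < V, s'.a .acc i < V) ∧
      ∀ i < V, ∀ j < V, (s'.a .acc i = s'.a .acc j ↔ f i = f j ∧ g i = g j)) := by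
  refine HT.of_wf fun hw => ?_
  have hVB : V < B := hV ▸ hw.v_lt .V
  -- the linked lists: `head b` and `next i` are one plus the last earlier
  -- position in the list, or zero
  refine HT.seq (V * 5 + 2) (19 * V + 4) (R := fun s₁ =>
    (∀ b, s₁.a .head b = lastOcc f b V) ∧ ∀ i < V, s₁.a .next i = lastOcc f (f i) i)
    (HT.forTo (fun k s₁ => (∀ b, s₁.a .head b = lastOcc f b k) ∧
      ∀ i < k, s₁.a .next i = lastOcc f (f i) i) V 3 (by decide) (by decide) (by decide) hV
      (fun _ _ _ h => h) ⟨hc.head, by simp⟩ ?_ le_rfl (fun _ _ _ h => h)) ?_ (by omega)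
  · rintro k hk s₁ hw₁ hF hik ⟨h1, h2⟩
    have hacc : s₁.a .acc k = f k := by rw [hF.a .acc (by decide), hf k hk]
    have hfk := hfS k hk
    refine .straight (fun _ => ?_) le_rfl (fun _ => ?_)
    · simp [Cmd.Safe, Cmd.run, hik, hacc]
      exact ⟨hacc ▸ hw₁.a_lt _ _, ⟨by omega, hw₁.a_lt _ _⟩, hfk, by omega⟩
    · simp only [Cmd.run, Expr.eval_get, Expr.eval_var, hik, hacc]
      simp [hik, h1]
      constructor
      · intro b
        simp only [lastOcc, Function.update_apply, eq_comm (a := b)]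
        split
        · rfl
        · exact h1 b
      · intro i hi
        rcases lt_or_eq_of_le hi with h | rfl
        · rw [Function.update_of_ne h.ne, h2 i h]
        · simp
  rintro s₁ hw₁ hF₁ ⟨hh₁, hn₁⟩
  have hacc₁ : ∀ i < V, s₁.a .acc i = f i := fun i hi => by rw [hF₁.a .acc (by decide), hf i hi]
  have hkey₁ : ∀ i < V, s₁.a .key i = g i := fun i hi => by rw [hF₁.a .key (by decide), hg i hi]
  -- the search processes the list of `f k` when `k` is its smallest element; the list is then
  -- removed, so that the total time is bounded by the lengths of all lists
  refine HT.seq (15 * V + 2) (4 * V + 2) (R := fun s₂ =>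
    (∀ b, s₂.a .head b = 0) ∧ Grp f g V (fun j => j < V) (s₂.a .name) (s₂.a .rep))
    (HT.forTo' (fun k s₂ =>
      (∀ b, s₂.a .head b = if ∃ i < k, f i = b then 0 else lastOcc f b V) ∧
      Grp f g V (fun j => j < V ∧ ∃ i < k, f i = f j) (s₂.a .name) (s₂.a .rep)) V
      (fun k => 4 + 9 * (if ∃ i < k, f i = f k then 0
        else ((Finset.range V).filter (fun j => f j = f k)).card))
      (by decide) (by decide) (by decide) ((hF₁.v .V (by decide)).trans hV)
      (fun _ _ _ h => h) ⟨?_, ?_⟩ ?_ ?_ ?_) ?_ (by omega)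
  · simp [hh₁]
  · have hr : ∀ b, s₁.a .rep b = 0 := fun b => by rw [hF₁.a .rep (by decide), hc.rep]
    refine ⟨?_, ?_, ?_, ?_, ?_⟩ <;> simp [hr]
  · rintro k hk s₂ hw₂ hF₂ hik ⟨hh, hG⟩
    have hacc₂ : ∀ i < V, s₂.a .acc i = f i := fun i hi => by
      rw [hF₂.a .acc (by decide), hacc₁ i hi]
    have hnext₂ : ∀ i < V, s₂.a .next i = lastOcc f (f i) i := fun i hi => by
      rw [hF₂.a .next (by decide), hn₁ i hi]
    have hkey₂ : ∀ i < V, s₂.a .key i = g i := fun i hi => by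
      rw [hF₂.a .key (by decide), hkey₁ i hi]
    have hfk := hfS k hk
    apply HT.assoc
    apply HT.assoc
    refine HT.seq 3 (1 + 9 * (if ∃ i < k, f i = f k then 0
        else ((Finset.range V).filter (fun j => f j = f k)).card))
      (R := fun s₃ => s₃.v .x = f k ∧ s₃.v .cur = s₂.a .head (f k) ∧
        (∀ b, s₃.a .head b = if b = f k then 0 else s₂.a .head b) ∧
        s₃.a .name = s₂.a .name ∧ s₃.a .rep = s₂.a .rep)
      (.straight (fun _ => ?_) le_rfl fun _ => ?_) ?_ (by omega)
    · simp [Cmd.Safe, Cmd.run, hik, hacc₂ k hk]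
      exact ⟨⟨hacc₂ k hk ▸ hw₂.a_lt _ _, hw₂.a_lt _ _⟩, hfk, by omega⟩
    · simp [Cmd.run, hik, hacc₂ k hk]
      intro b
      rw [Function.update_apply]
    rintro s₃ hw₃ hF₃ ⟨hx₃, hcur₃, hh₃, hname₃, hrep₃⟩
    have hacc₃ : ∀ i < V, s₃.a .acc i = f i := fun i hi => by
      rw [hF₃.a .acc (by decide), hacc₂ i hi]
    have hnext₃ : ∀ i < V, s₃.a .next i = lastOcc f (f i) i := fun i hi => by
      rw [hF₃.a .next (by decide), hnext₂ i hi]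
    have hkey₃ : ∀ i < V, s₃.a .key i = g i := fun i hi => by
      rw [hF₃.a .key (by decide), hkey₂ i hi]
    -- the list of `f k` is processed downwards: with `cur` ahead, the positions `≥ cur` are done
    let D : ℕ → ℕ → Prop := fun cur j => j < V ∧ ((∃ i < k, f i = f j) ∨ (f j = f k ∧ cur ≤ j))
    refine HT.loop (fun s₄ => s₄.v .cur ≤ V ∧
        (0 < s₄.v .cur → f (s₄.v .cur - 1) = f k ∧ ∀ i < k, f i ≠ f k) ∧
        Grp f g V (D (s₄.v .cur)) (s₄.a .name) (s₄.a .rep) ∧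
        ((∀ i < k, f i ≠ f k) →
          ∀ j, D (s₄.v .cur) j → f j = f k → f (s₄.a .rep (g j) - 1) = f k))
      (fun s₄ => 9 * ((Finset.range (s₄.v .cur)).filter (fun j => f j = f k)).card)
      ?_ ?_ ?_ ?_
    · rw [hname₃, hrep₃]
      have hcl : s₃.v .cur ≤ V := by
        rw [hcur₃, hh]; split
        · omega
        · exact lastOcc_le _ _ _
      have hpos : 0 < s₃.v .cur → f (s₃.v .cur - 1) = f k ∧ ∀ i < k, f i ≠ f k := by
        rw [hcur₃, hh]; split
        · simp
        · rename_i hne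
          exact fun h0 => ⟨lastOcc_spec _ _ _ h0, fun i hi e => hne ⟨i, hi, e⟩⟩
      have hD : ∀ j, (j < V ∧ ∃ i < k, f i = f j) ↔ D (s₃.v .cur) j := by
        intro j
        refine and_congr_right fun hj => ⟨.inl, ?_⟩
        rintro (h | ⟨h1, h2⟩)
        · exact h
        · rw [hcur₃, hh] at h2
          split at h2
          · rename_i he
            rwa [h1]
          · exact absurd h1 (lastOcc_max _ _ _ _ h2 hj)
      refine ⟨hcl, hpos, hG.congr hD, ?_⟩
      intro hne j hj hjk
      obtain ⟨-, i, hi, e⟩ := (hD j).2 hj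
      exact absurd (e.trans hjk) (hne i hi)
    · rintro s₄ hw₄ hF₄ ⟨hcl, hpos, hG₄, hl⟩ hb
      have h0 : 0 < s₄.v .cur := hb
      obtain ⟨hfj, hne⟩ := hpos h0
      obtain ⟨j, hj⟩ : ∃ j, s₄.v .cur = j + 1 := ⟨_, (Nat.succ_pred_eq_of_pos h0).symm⟩
      rw [hj] at hcl hfj hG₄ hl
      simp only [Nat.add_sub_cancel] at hfj
      have hjV : j < V := by omega
      have hacc₄ : ∀ i < V, s₄.a .acc i = f i := fun i hi => by
        rw [hF₄.a .acc (by decide), hacc₃ i hi]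
      have hnext₄ : s₄.a .next j = lastOcc f (f k) j := by
        rw [hF₄.a .next (by decide), hnext₃ j hjV, hfj]
      have hkey₄ : s₄.a .key j = g j := by
        rw [hF₄.a .key (by decide), hkey₃ j hjV]
      have hx₄ : s₄.v .x = f k := by rw [hF₄.v .x (by decide), hx₃]
      have hgj := hgS j hjV
      have hDj : ¬ D (j + 1) j := by
        rintro ⟨-, ⟨i, hi, e⟩ | ⟨-, h⟩⟩
        · exact hne i hi (e.trans hfj)
        · omega
      have hstep := hG₄.step hjV hDj (fun i hi e => by
        rw [hfj]; exact hl hne i hi (e.trans hfj))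
      have hD' : ∀ i, (D (j + 1) i ∨ i = j) ↔ D (lastOcc f (f k) j) i := by
        intro i
        have hle := lastOcc_le f (f k) j
        constructor
        · rintro (⟨h1, h2 | ⟨h2, h3⟩⟩ | rfl)
          · exact ⟨h1, .inl h2⟩
          · exact ⟨h1, .inr ⟨h2, by omega⟩⟩
          · exact ⟨hjV, .inr ⟨hfj, hle⟩⟩
        · rintro ⟨h1, h2 | ⟨h2, h3⟩⟩
          · exact .inl ⟨h1, .inl h2⟩
          · rcases lt_trichotomy i j with h | h | h
            · exact absurd h2 (lastOcc_max _ _ _ _ h3 h)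
            · exact .inr h
            · exact .inl ⟨h1, .inr ⟨h2, h⟩⟩
      have hcard : ((Finset.range (lastOcc f (f k) j)).filter (fun j => f j = f k)).card + 1 ≤
          ((Finset.range (j + 1)).filter (fun j => f j = f k)).card := by
        rw [Finset.range_add_one, Finset.filter_insert, if_pos hfj,
          Finset.card_insert_of_notMem (by simp)]
        gcongr
        exact lastOcc_le _ _ _
      have hdp : ∀ i, D (j + 1) i → i < V := fun i hi => hi.1
      refine ⟨8, .straight (fun _ => ?_) le_rfl fun _ => ?_⟩
      · simp [Cmd.Safe, Cmd.run, hj, hkey₄, hx₄]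
        have hjB : j < B := by omega
        have hgB : g j < B := hkey₄ ▸ hw₄.a_lt _ _
        split_ifs <;>
          simp [hjB, hgB, hgj, hw₄.a_lt, show j < S by omega, show j + 1 < B by omega]
      · have hrun : ∀ i, s₄.a .rep (g j) = i → 0 < i → s₄.a .acc (i - 1) = f (i - 1) :=
          fun i hi h0 => hacc₄ _ (by
            have := (hG₄.rep_some (g j) (by omega)).1.1
            rwa [hi] at this)
        have hname : (if 0 < s₄.a .rep (g j) ∧ f (s₄.a .rep (g j) - 1) = f k
            then s₄.a .name (s₄.a .rep (g j) - 1) else j) =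
            if 0 < s₄.a .rep (g j) then (if s₄.a .acc (s₄.a .rep (g j) - 1) = f k
            then s₄.a .name (s₄.a .rep (g j) - 1) else j) else j := by
          by_cases h0 : 0 < s₄.a .rep (g j)
          · rw [hrun _ rfl h0]; simp [h0]
          · simp [h0]
        rw [hfj, hname] at hstep
        refine ⟨⟨?_, ?_, ?_⟩, ?_⟩
        · have : (lastOcc f (f k) j) ≤ V := (lastOcc_le _ _ _).trans (by omega)
          simp [Cmd.run, hj, hkey₄, hx₄]
          split_ifs <;> simp [hnext₄, this]
        · have : 0 < lastOcc f (f k) j → f (lastOcc f (f k) j - 1) = f k ∧ ∀ i < k, f i ≠ f k :=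
            fun h => ⟨lastOcc_spec _ _ _ h, hne⟩
          simp [Cmd.run, hj, hkey₄, hx₄]
          split_ifs <;> simpa [hnext₄] using this
        · have hres := hstep.congr hD'
          have hres' : (∀ i < k, f i ≠ f k) →
              ∀ i, D (lastOcc f (f k) j) i → f i = f k →
              f (Function.update (s₄.a .rep) (g j) (j + 1) (g i) - 1) = f k := by
            intro _ i hi hik
            by_cases e : g i = g j
            · rw [e]; simpa using hfj
            · rw [Function.update_of_ne e]
              rcases (hD' i).2 hi with h | rfl
              · exact hl hne i h hik
              · exact absurd rfl e
          simp only [Cmd.run, Expr.eval_get, Expr.eval_var, Expr.eval_sub, Expr.eval_ofNat,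
            Expr.eval_add, Cond.holds_lt, Cond.holds_eq]
          simp [hj, hkey₄, hx₄]
          split_ifs <;> simp_all
        · simp [Cmd.run, hj, hkey₄, hx₄]
          split_ifs <;> simp [hnext₄] <;> omega
    · rw [hcur₃, hh]
      split
      · simp
      · have : ((Finset.range (lastOcc f (f k) V)).filter (fun j => f j = f k)).card ≤
            ((Finset.range V).filter (fun j => f j = f k)).card := by
          gcongr
          exact lastOcc_le _ _ _
        omega
    · rintro s₄ hw₄ hF₄ ⟨hcl, hpos, hG₄, hl⟩ hb
      have h0 : s₄.v .cur = 0 := by simpa using hb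
      refine ⟨fun b => ?_, hG₄.congr fun j => ?_⟩
      · rw [hF₄.a .head (by decide), hh₃, hh]
        by_cases e : b = f k
        · rw [if_pos e, if_pos ⟨k, by omega, e.symm⟩]
        · have : (∃ i < k, f i = b) ↔ ∃ i < k + 1, f i = b := by
            constructor
            · rintro ⟨i, hi, h⟩; exact ⟨i, by omega, h⟩
            · rintro ⟨i, hi, h⟩
              rcases Nat.lt_succ_iff_lt_or_eq.1 hi with h' | rfl
              · exact ⟨i, h', h⟩
              · exact absurd h.symm e
          rw [if_neg e]
          simp only [this]
      · refine and_congr_right fun hj => ?_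
        rw [h0]
        constructor
        · rintro (⟨i, hi, h⟩ | ⟨h, -⟩)
          · exact ⟨i, by omega, h⟩
          · exact ⟨k, by omega, h.symm⟩
        · rintro ⟨i, hi, h⟩
          rcases Nat.lt_succ_iff_lt_or_eq.1 hi with h' | rfl
          · exact .inl ⟨i, h', h⟩
          · exact .inr ⟨h.symm, Nat.zero_le _⟩
  · have := sum_first_card f V
    have e : ∑ k ∈ Finset.range V, (4 + 9 * (if ∃ i < k, f i = f k then 0
        else ((Finset.range V).filter (fun j => f j = f k)).card) + 2) =
        6 * V + 9 * ∑ k ∈ Finset.range V, (if ∃ i < k, f i = f k then 0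
        else ((Finset.range V).filter (fun j => f j = f k)).card) := by
      rw [Finset.mul_sum, Finset.sum_add_distrib, Finset.sum_add_distrib]; simp; ring
    rw [e]; omega
  · rintro s₂ hw₂ hF₂ ⟨hh, hG⟩
    refine ⟨fun b => ?_, hG.congr fun j => ⟨fun h => h.1, fun h => ⟨h, j, h, rfl⟩⟩⟩
    rw [hh]
    split
    · rfl
    · rename_i hne
      by_contra h0
      have h0' := Nat.pos_of_ne_zero h0
      have := lastOcc_le f b V
      exact hne ⟨_, by omega, lastOcc_spec _ _ _ h0'⟩
  rintro s₂ hw₂ hF₂ ⟨hh₂, hG⟩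
  have hkey₂ : ∀ i < V, s₂.a .key i = g i := fun i hi => by
    rw [hF₂.a .key (by decide), hkey₁ i hi]
  refine HT.forTo (fun k s₃ => (∀ b, s₃.a .rep b = if ∃ i < k, g i = b then 0 else s₂.a .rep b) ∧
      ∀ i < k, s₃.a .acc i = s₂.a .name i) V 2
      (by decide) (by decide) (by decide)
      ((hF₂.v .V (by decide)).trans ((hF₁.v .V (by decide)).trans hV))
      (fun _ _ _ h => h) ⟨by simp, by simp⟩ ?_ (by omega) ?_
  · rintro k hk s₃ hw₃ hF₃ hik ⟨h1, h2⟩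
    have hkey₃ : s₃.a .key k = g k := by rw [hF₃.a .key (by decide), hkey₂ k hk]
    have hname₃ : s₃.a .name = s₂.a .name := hF₃.a .name (by decide)
    refine .straight (fun _ => ?_) le_rfl fun _ => ?_
    · simp [Cmd.Safe, Cmd.run, hik, hkey₃, hw₃.a_lt, hgS k hk, show k < S by omega]
      omega
    · simp [Cmd.run, hik, hkey₃, hname₃]
      constructor
      · intro b
        rw [Function.update_apply]
        by_cases e : b = g k
        · rw [if_pos e, if_pos ⟨k, by omega, e.symm⟩]
        · have : (∃ i < k, g i = b) ↔ ∃ i ≤ k, g i = b := by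
            constructor
            · rintro ⟨i, hi, h⟩; exact ⟨i, by omega, h⟩
            · rintro ⟨i, hi, h⟩
              rcases lt_or_eq_of_le hi with h' | rfl
              · exact ⟨i, h', h⟩
              · exact absurd h.symm e
          rw [if_neg e, h1]
          simp only [this]
      · intro i hi
        rcases lt_or_eq_of_le hi with h | rfl
        · rw [Function.update_of_ne h.ne, h2 i h]
        · simp
  · rintro s₃ hw₃ hF₃ ⟨h1, h2⟩
    refine ⟨⟨fun b => ?_, fun b => ?_, fun b => ?_, fun b => ?_⟩, fun i hi => ?_, fun i hi j hj => ?_⟩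
    · rw [hF₃.a .head (by decide), hh₂]
    · rw [h1]
      split
      · rfl
      · rename_i hne
        by_contra h0
        obtain ⟨h3, h4⟩ := hG.rep_some b (Nat.pos_of_ne_zero h0)
        exact hne ⟨_, h3, h4⟩
    · rw [hF₃.a .T1 (by decide), hF₂.a .T1 (by decide), hF₁.a .T1 (by decide), hc.T1]
    · rw [hF₃.a .T2 (by decide), hF₂.a .T2 (by decide), hF₁.a .T2 (by decide), hc.T2]
    · rw [h2 i hi]; exact hG.out_mem i hi
    · rw [h2 i hi, h2 j hj]; exact hG.out_iff i j hi hj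

/-! ### From sampled grams to all grams -/

/-- The words of length `q` at the positions `i` and `j` of `z` are equal. -/
def GramEq (z : ℕ → ℕ) (q i j : ℕ) : Prop := ∀ t < q, z (i + t) = z (j + t)

theorem GramEq.symm {z : ℕ → ℕ} {q i j : ℕ} (h : GramEq z q i j) : GramEq z q j i :=
  fun t ht => (h t ht).symm

theorem GramEq.trans {z : ℕ → ℕ} {q i j k : ℕ} (h : GramEq z q i j) (h' : GramEq z q j k) :
    GramEq z q i k :=
  fun t ht => (h t ht).trans (h' t ht)

/-- The value of `g` at the `p`-th position of the string, `p % 3 ≠ 0`: the string of triples lists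
first the positions `1, 4, 7, …` and then, from index `m` on, the positions `2, 5, 8, …`. -/
def sampled (g : ℕ → ℕ) (m p : ℕ) : ℕ :=
  if p % 3 = 1 then g (p / 3) else if p % 3 = 2 then g (m + p / 3) else 0

/-- The offsets of the letters by which a gram of length `3 * q'` is extended. -/
def extra (q' u : ℕ) : ℕ := if u < 2 then u else 3 * q' + (u - 2)

/-- A gram of length `q` at `i` is determined by the gram of length `3 * q'` that starts `d` letters
later, provided this one is sampled, by its first two letters, and by its letters from index `3 * q'`
on, of which there are at most four. For `q' = 0` these letters are the whole gram. -/
theorem gramEq_iff_sampled {z g : ℕ → ℕ} {len q q' m d i j : ℕ} (hd : d ≤ 2)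
    (hq : q ≤ 3 * q' + 4) (hq' : 0 < q' → 3 * q' + 2 ≤ q)
    (hg : 0 < q' → ∀ p r, p % 3 ≠ 0 → r % 3 ≠ 0 → p + 3 * q' ≤ len → r + 3 * q' ≤ len →
      (sampled g m p = sampled g m r ↔ GramEq z (3 * q') p r))
    (hi : i + q ≤ len) (hj : j + q ≤ len) (hi3 : (i + d) % 3 ≠ 0) (hj3 : (j + d) % 3 ≠ 0) :
    ((if 0 < q' then sampled g m (i + d) else 0) = (if 0 < q' then sampled g m (j + d) else 0) ∧
      ∀ u < 6, extra q' u < q → z (i + extra q' u) = z (j + extra q' u)) ↔ GramEq z q i j := by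
  constructor
  · rintro ⟨h1, h2⟩ t ht
    by_cases ht2 : t < 2
    · have := h2 t (by omega)
      simp only [extra, if_pos ht2] at this
      exact this ht
    by_cases ht3 : 3 * q' ≤ t
    · have := h2 (t - 3 * q' + 2) (by omega)
      have e : extra q' (t - 3 * q' + 2) = t := by
        simp only [extra]; rw [if_neg (by omega)]; omega
      rw [e] at this
      exact this ht
    · have h0 : 0 < q' := by omega
      have h3 := hq' h0
      rw [if_pos h0, if_pos h0, hg h0 _ _ hi3 hj3 (by omega) (by omega)] at h1
      have := h1 (t - d) (by omega)
      rwa [show i + d + (t - d) = i + t by omega, show j + d + (t - d) = j + t by omega] at this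
  · intro h
    refine ⟨?_, fun u _ hu => h _ hu⟩
    by_cases h0 : 0 < q'
    · have h3 := hq' h0
      rw [if_pos h0, if_pos h0, hg h0 _ _ hi3 hj3 (by omega) (by omega)]
      intro t ht
      have := h (d + t) (by omega)
      rwa [← add_assoc, ← add_assoc] at this
    · rw [if_neg h0, if_neg h0]

/-- The table `T` maps the names `e j` of the positions `j < k` with `j % 3 = r` to their names
`e₀ j`, plus one. -/
structure Table (T e e₀ : ℕ → ℕ) (k r : ℕ) : Prop where
  none : ∀ b, T b = 0 → ∀ j < k, j % 3 = r → e j ≠ b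
  some : ∀ b, 0 < T b → ∃ j < k, j % 3 = r ∧ e j = b ∧ T b = e₀ j + 1

theorem Table.zero {T e e₀ : ℕ → ℕ} {r : ℕ} (h : ∀ b, T b = 0) : Table T e e₀ 0 r :=
  ⟨by simp, fun b hb => by simp [h] at hb⟩

theorem Table.skip {T e e₀ : ℕ → ℕ} {k r : ℕ} (h : Table T e e₀ k r) (hk : k % 3 ≠ r) :
    Table T e e₀ (k + 1) r := by
  constructor
  · intro b hb j hj hjr
    rcases Nat.lt_succ_iff_lt_or_eq.1 hj with h' | rfl
    · exact h.none b hb j h' hjr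
    · exact absurd hjr hk
  · intro b hb
    obtain ⟨j, hj, h'⟩ := h.some b hb
    exact ⟨j, by omega, h'⟩

theorem Table.put {T e e₀ : ℕ → ℕ} {k r : ℕ} (h : Table T e e₀ k r) (hk : k % 3 = r) :
    Table (Function.update T (e k) (e₀ k + 1)) e e₀ (k + 1) r := by
  constructor
  · intro b hb j hj hjr
    by_cases hbe : b = e k
    · subst hbe; simp at hb
    · rw [Function.update_of_ne hbe] at hb
      rcases Nat.lt_succ_iff_lt_or_eq.1 hj with h' | rfl
      · exact h.none b hb j h' hjr
      · exact fun h => hbe h.symm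
  · intro b hb
    by_cases hbe : b = e k
    · subst hbe; exact ⟨k, by omega, hk, rfl, by simp⟩
    · rw [Function.update_of_ne hbe] at hb ⊢
      obtain ⟨j, hj, h'⟩ := h.some b hb
      exact ⟨j, by omega, h'⟩

theorem Table.clear {T e e₀ : ℕ → ℕ} {k r : ℕ} (h : Table T e e₀ k r) (b : ℕ)
    (hb : ∀ j < k, e j ≠ b) : T b = 0 := by
  by_contra h0
  obtain ⟨j, hj, -, h', -⟩ := h.some b (Nat.pos_of_ne_zero h0)
  exact hb j hj h'

/-- The name of position `i`, from names of the positions `≢ 0` in `e₀`, of the positions `≢ 2` in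
`e₁`, of the positions `≢ 1` in `e₂`, and tables. -/
def merged (V : ℕ) (e₀ e₁ e₂ T₁ T₂ : ℕ → ℕ) (i : ℕ) : ℕ :=
  if i % 3 = 0 then
    if 0 < T₁ (e₁ i) then T₁ (e₁ i) - 1
    else if 0 < T₂ (e₂ i) then T₂ (e₂ i) - 1 else V + e₁ i
  else e₀ i

/-- For any two positions there is a `d` such that neither of them is `≡ -d` modulo three, and the
grams at these positions are compared by the names `e_d`. A position `≡ 0` takes over the name in
`e₀` of a position `≢ 0` with the same gram, if the tables show one; otherwise its gram is new and
obtains a name `≥ V`. -/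
theorem merged_eq_iff {z : ℕ → ℕ} {q V : ℕ} {e₀ e₁ e₂ T₁ T₂ : ℕ → ℕ}
    (h0 : ∀ i < V, e₀ i < V)
    (he₀ : ∀ i < V, ∀ j < V, (i + 0) % 3 ≠ 0 → (j + 0) % 3 ≠ 0 → (e₀ i = e₀ j ↔ GramEq z q i j))
    (he₁ : ∀ i < V, ∀ j < V, (i + 1) % 3 ≠ 0 → (j + 1) % 3 ≠ 0 → (e₁ i = e₁ j ↔ GramEq z q i j))
    (he₂ : ∀ i < V, ∀ j < V, (i + 2) % 3 ≠ 0 → (j + 2) % 3 ≠ 0 → (e₂ i = e₂ j ↔ GramEq z q i j))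
    (hT₁ : Table T₁ e₁ e₀ V 1) (hT₂ : Table T₂ e₂ e₀ V 2) (i : ℕ) (hi : i < V) (j : ℕ)
    (hj : j < V) :
    merged V e₀ e₁ e₂ T₁ T₂ i = merged V e₀ e₁ e₂ T₁ T₂ j ↔ GramEq z q i j := by
  have key : ∀ i < V,
      (∃ k < V, k % 3 ≠ 0 ∧ GramEq z q i k ∧ merged V e₀ e₁ e₂ T₁ T₂ i = e₀ k) ∨
      (i % 3 = 0 ∧ (∀ k < V, k % 3 ≠ 0 → ¬ GramEq z q i k) ∧
        merged V e₀ e₁ e₂ T₁ T₂ i = V + e₁ i) := by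
    intro i hi
    unfold merged
    split_ifs with h3 h1 h2
    · obtain ⟨k, hk, hk3, e, h⟩ := hT₁.some _ h1
      exact .inl ⟨k, hk, by omega, (he₁ i hi k hk (by omega) (by omega)).1 e.symm, by omega⟩
    · obtain ⟨k, hk, hk3, e, h⟩ := hT₂.some _ h2
      exact .inl ⟨k, hk, by omega, (he₂ i hi k hk (by omega) (by omega)).1 e.symm, by omega⟩
    · refine .inr ⟨h3, fun k hk hk3 hg => ?_, rfl⟩
      rcases (by omega : k % 3 = 1 ∨ k % 3 = 2) with h | h
      · exact hT₁.none _ (by omega) k hk h ((he₁ i hi k hk (by omega) (by omega)).2 hg).symm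
      · exact hT₂.none _ (by omega) k hk h ((he₂ i hi k hk (by omega) (by omega)).2 hg).symm
    · exact .inl ⟨i, hi, h3, fun _ _ => rfl, rfl⟩
  rcases key i hi with ⟨k, hk, hk3, hg, e⟩ | ⟨hi3, hn, e⟩ <;>
    rcases key j hj with ⟨l, hl, hl3, hg', e'⟩ | ⟨hj3, hn', e'⟩ <;> rw [e, e']
  · rw [he₀ k hk l hl (by simpa) (by simpa)]
    exact ⟨fun h => (hg.trans h).trans hg'.symm, fun h => (hg.symm.trans h).trans hg'⟩
  · have := h0 k hk
    exact ⟨fun h => by omega, fun h => absurd (h.symm.trans hg) (hn' k hk hk3)⟩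
  · have := h0 l hl
    exact ⟨fun h => by omega, fun h => absurd (h.trans hg') (hn l hl hl3)⟩
  · rw [← he₁ i hi j hj (by omega) (by omega)]
    omega

open Cmd QGram.Expr in
/-- Names in `acc` the grams of length `qq` from names in `G` of the sampled grams of length `3 * q'`
that start `d` letters later. -/
def extend (d : ℕ) : Cmd :=
  forTo .i .V (
    assign .x (var .i + lit d) ;;
    .ite (.lt 0 (var .q'))
      (.ite (.eq (var .x % 3) 1) (put .acc (var .i) (get .G (var .x / 3)))
        (.ite (.eq (var .x % 3) 2) (put .acc (var .i) (get .G (var .m + var .x / 3)))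
          (put .acc (var .i) 0)))
      (put .acc (var .i) 0)) ;;
  assign .six 6 ;;
  forTo .u .six (
    .ite (.lt (var .u) 2) (assign .t (var .u)) (assign .t (3 * var .q' + (var .u - 2))) ;;
    .ite (.lt (var .t) (var .qq))
      (forTo .i .V (put .key (var .i) (get .ZZ (var .off + var .i + var .t))) ;; pairName)
      .skip)

theorem extend_spec {s : HState} {d V off qq q' m : ℕ} (hBS : 16 * S + 64 ≤ B) (hV : s.v .V = V)
    (hoff : s.v .off = off) (hqq : s.v .qq = qq) (hq' : s.v .q' = q') (hm : s.v .m = m)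
    (hVS : V ≤ S) (hd : d ≤ 2) (hq0 : 0 < qq) (hqS : q' ≤ S)
    (hc : Clean s) (hZ : ∀ i, s.a .ZZ i < S) (hG : ∀ i, s.a .G i < S) :
    HT B S (extend d) s (200 * V + 100) (fun s' => Clean s' ∧ (∀ i < V, s'.a .acc i < V) ∧
      ∀ i < V, ∀ j < V, (s'.a .acc i = s'.a .acc j ↔
        (if 0 < q' then sampled (s.a .G) m (i + d) else 0) =
          (if 0 < q' then sampled (s.a .G) m (j + d) else 0) ∧
        ∀ u < 6, extra q' u < qq →
          s.a .ZZ (off + (i + extra q' u)) = s.a .ZZ (off + (j + extra q' u)))) := by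
  refine HT.of_wf fun hw => ?_
  set H : ℕ → ℕ := fun i => if 0 < q' then sampled (s.a .G) m (i + d) else 0 with hH
  have hHS : ∀ i < V, H i < S := by
    intro i hi
    simp only [hH, sampled]
    split_ifs <;> first | exact hG _ | omega
  refine HT.seq (V * 7 + 2) (190 * V + 95) (R := fun s₁ => ∀ i < V, s₁.a .acc i = H i)
    (HT.forTo (fun k s₁ => ∀ i < k, s₁.a .acc i = H i) V 5 (by simp) (by simp [Cmd.vars])
      (by simp [Cmd.vars]) hV (fun _ _ _ h => h) (by simp) ?_ le_rfl (fun _ _ _ h => h)) ?_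
      (by omega)
  · intro k hk s₁ hw₁ hF hik h1
    have hG₁ : s₁.a .G = s.a .G := hF.a .G (by simp [Cmd.arrs])
    have hq₁ : s₁.v .q' = q' := by rw [hF.v .q' (by simp [Cmd.vars]), hq']
    have hm₁ : s₁.v .m = m := by rw [hF.v .m (by simp [Cmd.vars]), hm]
    have hstep : ∀ w, w = H k →
        ∀ i < k + 1, Function.update (s₁.a .acc) k w i = H i := by
      rintro w rfl i hi
      rcases Nat.lt_succ_iff_lt_or_eq.1 hi with h | rfl
      · rw [Function.update_of_ne h.ne, h1 i h]
      · simp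
    refine .straight (fun _ => ?_) le_rfl (fun _ => ?_)
    · have hkB : k < S := by omega
      have hGB : ∀ i, s.a .G i < B := hw.a_lt _
      simp [Cmd.Safe, Cmd.run, hik, hG₁, hq₁, hm₁, hkB, hGB]
      omega
    · simp [Cmd.run, hik, hq₁, hm₁, hG₁]
      intro i hi
      split_ifs <;> simp <;> exact hstep _ (by simp [sampled, *]) i (by omega)
  intro s₁ hw₁ hF₁ hacc₁
  have hc₁ : Clean s₁ := ⟨fun i => by rw [hF₁.a .head (by simp [Cmd.arrs, Cmd.forTo]), hc.head],
    fun i => by rw [hF₁.a .rep (by simp [Cmd.arrs, Cmd.forTo]), hc.rep],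
    fun i => by rw [hF₁.a .T1 (by simp [Cmd.arrs, Cmd.forTo]), hc.T1],
    fun i => by rw [hF₁.a .T2 (by simp [Cmd.arrs, Cmd.forTo]), hc.T2]⟩
  have hsix : HT B S (.assign .six 6) s₁ 1 (fun s₂ => s₂ = s₁.setVar .six 6) :=
    .straight (fun _ => by simp [Cmd.Safe]; omega) le_rfl (fun _ => by simp [Cmd.run])
  refine HT.seq 1 (180 * V + 92) hsix ?_ (by omega)
  rintro s₂ hw₂ - rfl
  have hZ₂ : (s₁.setVar .six 6).a .ZZ = s.a .ZZ := by
    simp [hF₁.a .ZZ (by simp [Cmd.arrs, Cmd.forTo])]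
  have hv : ∀ x, x ≠ .x → x ≠ .i → x ≠ .six → (s₁.setVar .six 6).v x = s.v x := fun x h1 h2 h3 => by
    rw [HState.setVar_v, if_neg h3, hF₁.v x (by simp [Cmd.vars, Cmd.forTo, h1, h2])]
  set s₂ := s₁.setVar .six 6 with hs₂
  refine HT.forTo (fun k s₃ => Clean s₃ ∧ (∀ i < V, s₃.a .acc i < S) ∧
      (0 < k → ∀ i < V, s₃.a .acc i < V) ∧
      ∀ i < V, ∀ j < V, (s₃.a .acc i = s₃.a .acc j ↔ H i = H j ∧ ∀ u < k, extra q' u < qq →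
          s.a .ZZ (off + (i + extra q' u)) = s.a .ZZ (off + (j + extra q' u))))
    6 (28 * V + 12) (by decide) (by decide) (by decide) (by simp [hs₂])
    (fun _ _ _ h => ⟨⟨h.1.1, h.1.2, h.1.3, h.1.4⟩, h.2⟩) ?_ ?_ (by omega) ?_
  · refine ⟨⟨hc₁.1, hc₁.2, hc₁.3, hc₁.4⟩, fun i hi => ?_, by simp, fun i hi j hj => ?_⟩
    · simp [hs₂, hacc₁ i hi, hHS i hi]
    · simp [hs₂, hacc₁ i hi, hacc₁ j hj]
  · rintro k hk s₃ hw₃ hF₃ huk ⟨hc₃, hS₃, hV₃, hiff⟩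
    have hq₃ : s₃.v .q' = q' := by rw [hF₃.v .q' (by decide), hv .q' (by decide) (by decide) (by decide), hq']
    have hqq₃ : s₃.v .qq = qq := by rw [hF₃.v .qq (by decide), hv .qq (by decide) (by decide) (by decide), hqq]
    have hV₃' : s₃.v .V = V := by rw [hF₃.v .V (by decide), hv .V (by decide) (by decide) (by decide), hV]
    have hoff₃ : s₃.v .off = off := by rw [hF₃.v .off (by decide), hv .off (by decide) (by decide) (by decide), hoff]
    have hZ₃ : s₃.a .ZZ = s.a .ZZ := by rw [hF₃.a .ZZ (by decide), hZ₂]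
    refine HT.seq 2 (28 * V + 10) (R := fun s₄ => s₄ = s₃.setVar .t (extra q' k))
      (.straight (fun _ => ?_) le_rfl (fun _ => ?_)) ?_ (by omega)
    · simp [Cmd.Safe, huk, hq₃]; omega
    · simp only [Cmd.run, extra, Cond.holds_lt, Expr.eval_var, huk, Expr.eval_ofNat]
      split_ifs <;> simp [hq₃, huk]
    rintro s₄ hw₄ - rfl
    refine HT.ite (T₁ := 28 * V + 8) (fun hb => ?_) (fun hb => ?_) (by omega)
    · simp [hqq₃] at hb
      refine HT.seq (3 * V + 2) (24 * V + 6)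
        (R := fun s₅ => ∀ i < V, s₅.a .key i = s.a .ZZ (off + (i + extra q' k)))
        (HT.fill V (fun i => s.a .ZZ (off + (i + extra q' k))) (by decide) (by simp [hV₃']) ?_ hVS
          (by omega) (fun _ _ _ h _ => h)) ?_ (by omega)
      · intro i hi s₅ hw₅ hF₅ hii _ _
        refine ⟨?_, (hZ _).trans (by omega)⟩
        simp [hF₅.a .ZZ (by decide), hF₅.v .off (by decide), hF₅.v .t (by decide), hii, hZ₃,
          hoff₃, add_assoc]
      · intro s₅ hw₅ hF₅ hkey
        have ha : ∀ b, b ≠ .key → s₅.a b = s₃.a b := fun b hb => by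
          rw [hF₅.a b (by simp [Cmd.arrs, Cmd.forTo, hb])]; rfl
        refine (pairName_spec (s₃.a .acc) (fun i => s.a .ZZ (off + (i + extra q' k)))
          (by simp [hF₅.v .V (by decide), hV₃']) hVS ⟨?_, ?_, ?_, ?_⟩
          (fun i _ => by rw [ha .acc (by decide)]) hkey hS₃ (fun _ _ => hZ _) le_rfl).conseq le_rfl ?_
        · rw [ha _ (by decide)]; exact hc₃.head
        · rw [ha _ (by decide)]; exact hc₃.rep
        · rw [ha _ (by decide)]; exact hc₃.T1
        · rw [ha _ (by decide)]; exact hc₃.T2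
        · rintro s₆ hw₆ hF₆ ⟨hc₆, hV₆, hi₆⟩
          refine ⟨hc₆, fun i hi => (hV₆ i hi).trans_le hVS, fun _ => hV₆, fun i hi j hj => ?_⟩
          rw [hi₆ i hi j hj, hiff i hi j hj, and_assoc]
          refine and_congr_right fun _ => ⟨?_, ?_⟩
          · rintro ⟨h1, h2⟩ u hu
            rcases Nat.lt_succ_iff_lt_or_eq.1 hu with h | rfl
            · exact h1 u h
            · exact fun _ => h2
          · exact fun h => ⟨fun u hu => h u (by omega), h k (by omega) hb⟩
    · simp [hqq₃] at hb
      refine .straight (fun _ => trivial) (by simp [Cmd.cost]) fun _ => ?_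
      simp only [Cmd.run]
      refine ⟨⟨hc₃.1, hc₃.2, hc₃.3, hc₃.4⟩, hS₃, fun _ => ?_, fun i hi j hj => ?_⟩
      · -- the first letter belongs to the gram, so that at least one pair naming has taken place
        have : k ≠ 0 := by rintro rfl; simp [extra] at hb; omega
        exact hV₃ (by omega)
      · simp only [HState.setVar_a]
        rw [hiff i hi j hj]
        refine and_congr_right fun _ => ⟨?_, fun h u hu => h u (by omega)⟩
        intro h1 u hu
        rcases Nat.lt_succ_iff_lt_or_eq.1 hu with h | rfl
        · exact h1 u h
        · exact fun h => by omega
  · rintro s₃ hw₃ hF₃ ⟨hc₃, -, hV₃, hiff⟩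
    exact ⟨hc₃, hV₃ (by omega), hiff⟩

/-- What `extend d` modifies does not depend on `d`, so that it can be decided for a concrete one. -/
theorem extend_vars (d : ℕ) : (extend d).vars = (extend 0).vars := rfl
theorem extend_arrs (d : ℕ) : (extend d).arrs = (extend 0).arrs := rfl

/-! ### One level of the recursion -/

open Cmd QGram.Expr in
/-- Copies the names in `acc` to the array `b`. -/
def copyAcc (b : Arr) : Cmd := forTo .i .V (put b (var .i) (get .acc (var .i)))

theorem copyAcc_spec {s : HState} {V : ℕ} {b : Arr} (hb : b ≠ .acc) (hV : s.v .V = V)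
    (hVS : V ≤ S) :
    HT B S (copyAcc b) s (3 * V + 2) (fun s' => ∀ i < V, s'.a b i = s.a .acc i) :=
  HT.of_wf fun hw => HT.fill V (s.a .acc) (by decide) hV
    (fun k hk s₁ hw₁ hF hik _ _ => by simp [hik, hF.a .acc (by simp [hb.symm]), hw.a_lt]) hVS
    (by omega) (fun _ _ _ h _ => h)

theorem Clean.of_frame {vs bs} {s s' : HState} (h : Clean s) (hF : Frame vs bs s s')
    (h1 : .head ∉ bs) (h2 : .rep ∉ bs) (h3 : .T1 ∉ bs) (h4 : .T2 ∉ bs) : Clean s' :=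
  ⟨by rw [hF.a _ h1]; exact h.head, by rw [hF.a _ h2]; exact h.rep, by rw [hF.a _ h3]; exact h.T1,
    by rw [hF.a _ h4]; exact h.T2⟩

open Cmd QGram.Expr in
/-- Names the grams of length `qq` of the string of length `len` at `off` in `ZZ`, from names of the
sampled grams of length `3 * q'`. -/
def process : Cmd :=
  (assign .V (var .len + 1 - var .qq) ;;
  extend 0 ;; copyAcc .E0 ;; extend 1 ;; copyAcc .E1 ;; extend 2 ;; copyAcc .E2) ;;
  forTo .i .V (
    .ite (.eq (var .i % 3) 1) (put .T1 (get .E1 (var .i)) (get .E0 (var .i) + 1))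
      (.ite (.eq (var .i % 3) 2) (put .T2 (get .E2 (var .i)) (get .E0 (var .i) + 1)) .skip)) ;;
  forTo .i .V (
    .ite (.eq (var .i % 3) 0)
      (assign .x (get .T1 (get .E1 (var .i))) ;;
      .ite (.lt 0 (var .x)) (put .G (var .i) (var .x - 1))
        (assign .x (get .T2 (get .E2 (var .i))) ;;
        .ite (.lt 0 (var .x)) (put .G (var .i) (var .x - 1))
          (put .G (var .i) (var .V + get .E1 (var .i)))))
      (put .G (var .i) (get .E0 (var .i)))) ;;
  forTo .i .V (
    put .T1 (get .E1 (var .i)) 0 ;;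
    put .T2 (get .E2 (var .i)) 0)

/-- From correct names of the sampled grams of length `3 * q'` the command computes correct names of
all grams of length `qq`. -/
theorem process_spec {s : HState} {len off qq q' m : ℕ} (hBS : 16 * S + 64 ≤ B)
    (hlen : s.v .len = len) (hoff : s.v .off = off) (hqq : s.v .qq = qq) (hq' : s.v .q' = q')
    (hm : s.v .m = m) (hlS : 2 * len ≤ S) (hq0 : 0 < qq) (hqS : qq ≤ S)
    (hc : Clean s) (hZ : ∀ i, s.a .ZZ i < S) (hG : ∀ i, s.a .G i < S)
    (hq4 : qq ≤ 3 * q' + 4) (hq2 : 0 < q' → 3 * q' + 2 ≤ qq)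
    (hg : 0 < q' → ∀ p r, p % 3 ≠ 0 → r % 3 ≠ 0 → p + 3 * q' ≤ len → r + 3 * q' ≤ len →
      (sampled (s.a .G) m p = sampled (s.a .G) m r ↔
        GramEq (fun i => s.a .ZZ (off + i)) (3 * q') p r)) :
    HT B S process s (640 * len + 400) (fun s' => Clean s' ∧ (∀ i, s'.a .G i < S) ∧
      ∀ i j, i + qq ≤ len → j + qq ≤ len →
        (s'.a .G i = s'.a .G j ↔ GramEq (fun i => s.a .ZZ (off + i)) qq i j)) := by
  obtain ⟨V, hV⟩ : ∃ V, V = len + 1 - qq := ⟨_, rfl⟩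
  have hVS : 2 * V ≤ S := by omega
  have hVS' : V ≤ S := by omega
  have hq'S : q' ≤ S := by
    rcases Nat.eq_zero_or_pos q' with h | h
    · omega
    · have := hq2 h; omega
  have hpos : ∀ i, i < V ↔ i + qq ≤ len := fun i => by omega
  -- names of the grams, valid on two of the three residue classes
  let Good : ℕ → (ℕ → ℕ) → Prop := fun d e => (∀ i < V, e i < V) ∧
    ∀ i < V, ∀ j < V, (i + d) % 3 ≠ 0 → (j + d) % 3 ≠ 0 →
      (e i = e j ↔ GramEq (fun i => s.a .ZZ (off + i)) qq i j)
  -- an extension, in any state that agrees with the initial one as far as needed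
  have hext : ∀ (d : ℕ) (b : Arr) (s₁ : HState), b ≠ .acc → b ≠ .head → b ≠ .rep → b ≠ .T1 →
      b ≠ .T2 → d ≤ 2 → s₁.v .V = V →
      (∀ x, x = .off ∨ x = .qq ∨ x = .q' ∨ x = .m → s₁.v x = s.v x) →
      s₁.a .ZZ = s.a .ZZ → s₁.a .G = s.a .G → Clean s₁ →
      HT B S (extend d ;; copyAcc b) s₁ (203 * V + 102) (fun s₂ => Clean s₂ ∧ Good d (s₂.a b)) := by
    intro d b s₁ hb1 hb2 hb3 hb4 hb5 hd hV₁ hv hz hG₁ hc₁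
    refine HT.seq _ _ (extend_spec hBS hV₁ ((hv _ (by simp)).trans hoff)
      ((hv _ (by simp)).trans hqq) ((hv _ (by simp)).trans hq') ((hv _ (by simp)).trans hm)
      hVS' hd hq0 hq'S hc₁ (by rwa [hz]) (by rwa [hG₁])) ?_ (show _ + (3 * V + 2) ≤ _ by omega)
    rintro s₂ hw₂ hF₂ ⟨hc₂, hV₂, hiff⟩
    rw [extend_vars, extend_arrs] at hF₂
    refine (copyAcc_spec hb1 ((hF₂.v .V (by decide)).trans hV₁) hVS').conseq le_rfl ?_
    intro s₃ hw₃ hF₃ h₃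
    refine ⟨hc₂.of_frame hF₃ (by simp [copyAcc, Cmd.arrs, Cmd.forTo, hb2.symm])
      (by simp [copyAcc, Cmd.arrs, Cmd.forTo, hb3.symm])
      (by simp [copyAcc, Cmd.arrs, Cmd.forTo, hb4.symm])
      (by simp [copyAcc, Cmd.arrs, Cmd.forTo, hb5.symm]), fun i hi => ?_,
      fun i hi j hj hi3 hj3 => ?_⟩
    · rw [h₃ i hi]; exact hV₂ i hi
    · rw [h₃ i hi, h₃ j hj, hiff i hi j hj, hz, hG₁]
      exact gramEq_iff_sampled (z := fun i => s.a .ZZ (off + i)) hd hq4 hq2 hg ((hpos i).1 hi)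
        ((hpos j).1 hj) hi3 hj3
  have hthree : HT B S (Cmd.assign .V (.var .len + 1 - .var .qq) ;;
      extend 0 ;; copyAcc .E0 ;; extend 1 ;; copyAcc .E1 ;; extend 2 ;; copyAcc .E2) s
      (3 * (203 * V + 102) + 1) (fun s₁ => s₁.v .V = V ∧ Clean s₁ ∧ s₁.a .G = s.a .G ∧
        Good 0 (s₁.a .E0) ∧ Good 1 (s₁.a .E1) ∧ Good 2 (s₁.a .E2)) := by
    refine HT.seq 1 (3 * (203 * V + 102)) (R := fun s₁ => s₁ = s.setVar .V V)
      (.straight (fun hw => ?_) le_rfl fun _ => ?_) ?_ (by omega)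
    · simp [Cmd.Safe, hlen, hqq]; omega
    · simp [Cmd.run, hlen, hqq, hV]
    rintro s₁ - - rfl
    apply HT.assoc
    refine HT.seq _ (2 * (203 * V + 102)) (hext 0 .E0 _ (by decide) (by decide) (by decide)
      (by decide) (by decide) (by omega) (by simp) (by rintro x (rfl | rfl | rfl | rfl) <;> simp) rfl rfl
      ⟨hc.1, hc.2, hc.3, hc.4⟩) ?_ (by omega)
    rintro s₂ - hF₂ ⟨hc₂, h0⟩
    apply HT.assoc
    refine HT.seq _ (203 * V + 102) (hext 1 .E1 _ (by decide) (by decide) (by decide)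
      (by decide) (by decide) (by omega) (by simp [hF₂.v .V (by decide)])
      (by rintro x (rfl | rfl | rfl | rfl) <;> rw [hF₂.v _ (by decide)] <;> simp) (hF₂.a _ (by decide))
      (hF₂.a _ (by decide)) hc₂) ?_ (by omega)
    rintro s₃ - hF₃ ⟨hc₃, h1⟩
    refine (hext 2 .E2 _ (by decide) (by decide) (by decide)
      (by decide) (by decide) (by omega) (by simp [hF₂.v .V (by decide), hF₃.v .V (by decide)])
      (by rintro x (rfl | rfl | rfl | rfl) <;> rw [hF₃.v _ (by decide), hF₂.v _ (by decide)] <;> simp)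
      ((hF₃.a _ (by decide)).trans (hF₂.a _ (by decide)))
      ((hF₃.a _ (by decide)).trans (hF₂.a _ (by decide))) hc₃).conseq le_rfl ?_
    rintro s₄ - hF₄ ⟨hc₄, h2⟩
    refine ⟨?_, hc₄, ?_, ?_, ?_, h2⟩
    · rw [hF₄.v _ (by decide), hF₃.v _ (by decide), hF₂.v _ (by decide)]; simp
    · rw [hF₄.a _ (by decide), hF₃.a _ (by decide), hF₂.a _ (by decide)]; rfl
    · rw [hF₄.a _ (by decide), hF₃.a _ (by decide)]; exact h0
    · rw [hF₄.a _ (by decide)]; exact h1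
  refine HT.seq _ (19 * V + 6) hthree ?_ (by omega)
  rintro s₁ hw₁ hF₁ ⟨hV₁, hc₁, hG₁, hg0, hg1, hg2⟩
  set e₀ := s₁.a .E0 with he₀
  set e₁ := s₁.a .E1 with he₁
  set e₂ := s₁.a .E2 with he₂
  -- for the residues 1 and 2, tables from the names in `E1` and `E2` to those in `E0`
  refine HT.seq (5 * V + 2) (14 * V + 4) (R := fun s₂ => Table (s₂.a .T1) e₁ e₀ V 1 ∧
    Table (s₂.a .T2) e₂ e₀ V 2) (HT.forTo (fun k s₂ => Table (s₂.a .T1) e₁ e₀ k 1 ∧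
    Table (s₂.a .T2) e₂ e₀ k 2) V 3 (by decide) (by decide) (by decide) hV₁
    (fun _ _ _ h => h) ⟨.zero hc₁.T1, .zero hc₁.T2⟩ ?_ (by omega) (fun _ _ _ h => h)) ?_ (by omega)
  · rintro k hk s₂ hw₂ hF₂ hik ⟨h1, h2⟩
    have f0 : s₂.a .E0 = e₀ := hF₂.a _ (by decide)
    have f1 : s₂.a .E1 = e₁ := hF₂.a _ (by decide)
    have f2 : s₂.a .E2 = e₂ := hF₂.a _ (by decide)
    have := hg0.1 k hk
    have := hg1.1 k hk
    have := hg2.1 k hk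
    refine .straight (fun _ => ?_) le_rfl fun _ => ?_
    · simp [Cmd.Safe, hik, f0, f1, f2]; omega
    · simp [Cmd.run, hik]
      split_ifs with h3 h4
      · simpa [f0, f1] using ⟨h1.put h3, h2.skip (by omega)⟩
      · simpa [f0, f2] using ⟨h1.skip (by omega), h2.put h4⟩
      · exact ⟨h1.skip h3, h2.skip h4⟩
  rintro s₂ hw₂ hF₂ ⟨hT₁, hT₂⟩
  have hV₂ : s₂.v .V = V := (hF₂.v _ (by decide)).trans hV₁
  have f0 : s₂.a .E0 = e₀ := hF₂.a _ (by decide)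
  have f1 : s₂.a .E1 = e₁ := hF₂.a _ (by decide)
  have f2 : s₂.a .E2 = e₂ := hF₂.a _ (by decide)
  have hmerge := merged_eq_iff hg0.1 hg0.2 hg1.2 hg2.2 hT₁ hT₂
  set M := merged V e₀ e₁ e₂ (s₂.a .T1) (s₂.a .T2) with hM
  have hTB : ∀ r, ∀ e, ∀ t : ℕ → ℕ, Table t e e₀ V r → ∀ b, t b ≤ V := by
    intro r e t ht b
    rcases Nat.eq_zero_or_pos (t b) with h | h
    · omega
    · obtain ⟨j, hj, -, -, h'⟩ := ht.some b h
      have := hg0.1 j hj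
      omega
  have hMS : ∀ i < V, M i < S := by
    intro i hi
    have h1 := hTB _ _ _ hT₁ (e₁ i)
    have h2 := hTB _ _ _ hT₂ (e₂ i)
    have h3 := hg0.1 i hi
    have h4 := hg1.1 i hi
    simp only [hM, merged]
    split_ifs <;> omega
  refine HT.seq (9 * V + 2) (4 * V + 2) (R := fun s₃ => (∀ i < V, s₃.a .G i = M i) ∧
    ∀ i, V ≤ i → s₃.a .G i = s₂.a .G i) (HT.forTo (fun k s₃ => (∀ i < k, s₃.a .G i = M i) ∧
    ∀ i, k ≤ i → s₃.a .G i = s₂.a .G i) V 6 (by decide) (by decide) (by decide) hV₂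
    (fun _ _ _ h => h) ⟨by simp, by simp⟩ ?_ (by omega) (fun _ _ _ h => h)) ?_ (by omega)
  · rintro k hk s₃ hw₃ hF₃ hik ⟨h1, h2⟩
    have k0 : s₃.a .E0 = e₀ := (hF₃.a _ (by decide)).trans f0
    have k1 : s₃.a .E1 = e₁ := (hF₃.a _ (by decide)).trans f1
    have k2 : s₃.a .E2 = e₂ := (hF₃.a _ (by decide)).trans f2
    have kT1 : s₃.a .T1 = s₂.a .T1 := hF₃.a _ (by decide)
    have kT2 : s₃.a .T2 = s₂.a .T2 := hF₃.a _ (by decide)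
    have kV : s₃.v .V = V := (hF₃.v _ (by decide)).trans hV₂
    have hstep : ∀ w, w = M k → (∀ i < k + 1, Function.update (s₃.a .G) k w i = M i) ∧
        ∀ i, k + 1 ≤ i → Function.update (s₃.a .G) k w i = s₂.a .G i := by
      rintro w rfl
      constructor
      · intro i hi
        rcases Nat.lt_succ_iff_lt_or_eq.1 hi with h | rfl
        · rw [Function.update_of_ne h.ne, h1 i h]
        · simp
      · intro i hi
        rw [Function.update_of_ne (by omega), h2 i (by omega)]
    have b1 := hTB _ _ _ hT₁ (e₁ k)
    have b2 := hTB _ _ _ hT₂ (e₂ k)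
    have b3 := hg0.1 k hk
    have b4 := hg1.1 k hk
    refine .straight (fun _ => ?_) le_rfl fun _ => ?_
    · simp only [Cmd.Safe, Cmd.run]
      simp [hik, k0, k1, k2, kT1, kT2, kV]
      omega
    · have hMk : M k = merged V e₀ e₁ e₂ (s₂.a .T1) (s₂.a .T2) k := rfl
      simp only [merged] at hMk
      simp only [Cmd.run, Cond.holds_eq, Cond.holds_lt, Expr.eval_mod, Expr.eval_var, hik,
        Expr.eval_ofNat, Expr.eval_get, k0, k1, k2, HState.setVar_v, HState.setVar_a, if_true, kT1,
        kT2, Expr.eval_add, Expr.eval_sub, reduceCtorEq, if_false, kV]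
      clear_value M
      split_ifs with a b c
      · rw [if_pos a, if_pos b] at hMk
        simpa [Nat.lt_succ_iff] using hstep _ hMk.symm
      · rw [if_pos a, if_neg b, if_pos c] at hMk
        simpa [Nat.lt_succ_iff] using hstep _ hMk.symm
      · rw [if_pos a, if_neg b, if_neg c] at hMk
        simpa [Nat.lt_succ_iff] using hstep _ hMk.symm
      · rw [if_neg a] at hMk
        simpa [Nat.lt_succ_iff] using hstep _ hMk.symm
  rintro s₃ hw₃ hF₃ ⟨hM₃, hG₃⟩
  have g1 : s₃.a .E1 = e₁ := (hF₃.a _ (by decide)).trans f1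
  have g2 : s₃.a .E2 = e₂ := (hF₃.a _ (by decide)).trans f2
  have gT1 : s₃.a .T1 = s₂.a .T1 := hF₃.a _ (by decide)
  have gT2 : s₃.a .T2 = s₂.a .T2 := hF₃.a _ (by decide)
  refine HT.forTo (fun k s₄ => (∀ b, (∀ j < V, k ≤ j → e₁ j ≠ b) → s₄.a .T1 b = 0) ∧
    ∀ b, (∀ j < V, k ≤ j → e₂ j ≠ b) → s₄.a .T2 b = 0) V 2 (by decide) (by decide) (by decide)
    ((hF₃.v _ (by decide)).trans hV₂) (fun _ _ _ h => h) ⟨?_, ?_⟩ ?_ (by omega) ?_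
  · intro b hb
    rw [gT1]
    exact hT₁.clear b fun j hj => hb j hj (Nat.zero_le _)
  · intro b hb
    rw [gT2]
    exact hT₂.clear b fun j hj => hb j hj (Nat.zero_le _)
  · rintro k hk s₄ hw₄ hF₄ hik ⟨h1, h2⟩
    have k1 : s₄.a .E1 = e₁ := (hF₄.a _ (by decide)).trans g1
    have k2 : s₄.a .E2 = e₂ := (hF₄.a _ (by decide)).trans g2
    have b1 := hg1.1 k hk
    have b2 := hg2.1 k hk
    have hstep : ∀ (t e : ℕ → ℕ), (∀ b, (∀ j < V, k ≤ j → e j ≠ b) → t b = 0) →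
        ∀ b, (∀ j < V, k + 1 ≤ j → e j ≠ b) → Function.update t (e k) 0 b = 0 := by
      intro t e ht b hb
      by_cases hbe : b = e k
      · subst hbe; simp
      · rw [Function.update_of_ne hbe]
        refine ht b fun j hj hkj => ?_
        rcases hkj.eq_or_lt with rfl | h
        · exact fun h => hbe h.symm
        · exact hb j hj h
    refine .straight (fun _ => ?_) le_rfl fun _ => ?_
    · simp [Cmd.Safe, Cmd.run, hik, k1, k2]; omega
    · simp only [Cmd.run]
      simp [hik, k1, k2]
      exact ⟨hstep _ _ h1, hstep _ _ h2⟩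
  · rintro s₄ hw₄ hF₄ ⟨h1, h2⟩
    have hG₄ : s₄.a .G = s₃.a .G := hF₄.a _ (by decide)
    refine ⟨⟨?_, ?_, fun b => h1 b (fun j _ _ => by omega), fun b => h2 b (fun j _ _ => by omega)⟩,
      ?_, ?_⟩
    · rw [hF₄.a _ (by decide), hF₃.a _ (by decide), hF₂.a _ (by decide)]; exact hc₁.head
    · rw [hF₄.a _ (by decide), hF₃.a _ (by decide), hF₂.a _ (by decide)]; exact hc₁.rep
    · intro i
      rw [hG₄]
      by_cases hi : i < V
      · rw [hM₃ i hi]; exact hMS i hi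
      · rw [hG₃ i (by omega), hF₂.a _ (by decide), hG₁]; exact hG i
    · intro i j hi hj
      rw [hG₄, hM₃ i ((hpos i).2 hi), hM₃ j ((hpos j).2 hj)]
      exact hmerge i ((hpos i).2 hi) j ((hpos j).2 hj)

/-! ### Naming grams by recursion on strings of triples -/

/-- The position in the string that belongs to index `i` of the string of triples. -/
def triplePos (m i : ℕ) : ℕ := if i < m then 3 * i + 1 else 3 * (i - m) + 2

/-- The letters of `y` are names of the triples of letters of `z` at the sampled positions. -/
def Link (z y : ℕ → ℕ) (len : ℕ) : Prop :=
  ∀ a < 2 * (len / 3), ∀ b < 2 * (len / 3),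
    triplePos (len / 3) a + 3 ≤ len → triplePos (len / 3) b + 3 ≤ len →
    (y a = y b ↔ GramEq z 3 (triplePos (len / 3) a) (triplePos (len / 3) b))

/-- Grams of length `q'` of the string of triples stand for sampled grams of length `3 * q'`. None of
these crosses the border between the two halves of the string of triples. -/
theorem Link.sampled_eq_iff {z y g : ℕ → ℕ} {len q' : ℕ} (h : Link z y len) (hq : 0 < q')
    (hg : ∀ i j, i + q' ≤ 2 * (len / 3) → j + q' ≤ 2 * (len / 3) →
      (g i = g j ↔ GramEq y q' i j))
    {p r : ℕ} (hp3 : p % 3 ≠ 0) (hr3 : r % 3 ≠ 0) (hp : p + 3 * q' ≤ len) (hr : r + 3 * q' ≤ len) :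
    sampled g (len / 3) p = sampled g (len / 3) r ↔ GramEq z (3 * q') p r := by
  have idx : ∀ p, p % 3 ≠ 0 → p + 3 * q' ≤ len → ∃ a, a + q' ≤ 2 * (len / 3) ∧
      sampled g (len / 3) p = g a ∧ ∀ t < q', triplePos (len / 3) (a + t) = p + 3 * t := by
    intro p hp3 hp
    rcases (by omega : p % 3 = 1 ∨ p % 3 = 2) with h | h
    · refine ⟨p / 3, by omega, by simp [sampled, h], fun t ht => ?_⟩
      rw [triplePos, if_pos (by omega)]; omega
    · refine ⟨len / 3 + p / 3, by omega, by simp [sampled, h], fun t ht => ?_⟩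
      rw [triplePos, if_neg (by omega)]; omega
  obtain ⟨a, ha, ea, ta⟩ := idx p hp3 hp
  obtain ⟨b, hb, eb, tb⟩ := idx r hr3 hr
  rw [ea, eb, hg a b ha hb]
  have hl : ∀ t < q', (y (a + t) = y (b + t) ↔ GramEq z 3 (p + 3 * t) (r + 3 * t)) := by
    intro t ht
    have := h (a + t) (by omega) (b + t) (by omega)
    rw [ta t ht, tb t ht] at this
    exact this (by omega) (by omega)
  constructor
  · intro h t ht
    have := (hl (t / 3) (by omega)).1 (h (t / 3) (by omega)) (t % 3) (by omega)
    rwa [show p + 3 * (t / 3) + t % 3 = p + t by omega,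
      show r + 3 * (t / 3) + t % 3 = r + t by omega] at this
  · intro h t ht
    refine (hl t ht).2 fun u hu => ?_
    have := h (3 * t + u) (by omega)
    rwa [← add_assoc, ← add_assoc] at this

/-- The length of the string on level `k` of the recursion. -/
def lvlLen (N : ℕ) : ℕ → ℕ
  | 0 => N
  | k + 1 => 2 * (lvlLen N k / 3)

/-- The position at which the string on level `k` starts. -/
def lvlOff (N : ℕ) : ℕ → ℕ
  | 0 => 0
  | k + 1 => lvlOff N k + lvlLen N k

/-- The length of the grams on level `k`: the largest `q'` with `3 * q' + 2 ≤ q`. -/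
def lvlQ (q : ℕ) : ℕ → ℕ
  | 0 => q
  | k + 1 => (lvlQ q k - 2) / 3

/-- The lengths decrease geometrically with ratio `2 / 3`. -/
theorem lvlOff_add_lvlLen (N k : ℕ) : lvlOff N k + 3 * lvlLen N k ≤ 3 * N := by
  induction k with
  | zero => simp [lvlOff, lvlLen]
  | succ k ih => simp only [lvlOff, lvlLen]; omega

theorem lvlLen_le (N k : ℕ) : lvlLen N k ≤ N := by
  induction k with
  | zero => simp [lvlLen]
  | succ k ih => simp only [lvlLen]; omega

theorem lvlQ_le (q k : ℕ) : lvlQ q k ≤ q := by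
  induction k with
  | zero => simp [lvlQ]
  | succ k ih => simp only [lvlQ]; omega

open Cmd QGram.Expr in
/-- Stores in `b` the letters with index `d` of the triples. -/
def triple (b : Arr) (d : ℕ) : Cmd :=
  forTo .i .V (
    .ite (.lt (var .i) (var .m)) (assign .p (3 * var .i + 1))
      (assign .p (3 * (var .i - var .m) + 2)) ;;
    put b (var .i) (get .ZZ (var .off + (var .p + lit d))))

theorem triple_spec {s : HState} {V m off d : ℕ} {b : Arr} (hBS : 16 * S + 64 ≤ B) (hb : b ≠ .ZZ)
    (hV : s.v .V = V) (hm : s.v .m = m) (hoff : s.v .off = off) (hVS : V ≤ S) :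
    HT B S (triple b d) s (5 * V + 2) (fun s' =>
      ∀ i < V, s'.a b i = s.a .ZZ (off + (triplePos m i + d))) := by
  refine HT.forTo (fun k s' => ∀ i < k, s'.a b i = s.a .ZZ (off + (triplePos m i + d))) V 3
    (by decide) (by simp [Cmd.vars]) (by simp [Cmd.vars]) hV (fun _ _ _ h => h) (by simp) ?_
    (by omega) (fun _ _ _ h => h)
  intro k hk s₁ hw₁ hF₁ hik h1
  have hm₁ : s₁.v .m = m := (hF₁.v _ (by simp [Cmd.vars])).trans hm
  have ho₁ : s₁.v .off = off := (hF₁.v _ (by simp [Cmd.vars])).trans hoff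
  have hZ₁ : s₁.a .ZZ = s.a .ZZ := hF₁.a _ (by simp [Cmd.arrs, hb.symm])
  have hpos : (if s₁.v .i < s₁.v .m then 3 * s₁.v .i + 1 else 3 * (s₁.v .i - s₁.v .m) + 2) =
    triplePos m k := by rw [hik, hm₁]; rfl
  refine .straight (fun _ => ?_) le_rfl fun _ => ?_
  · simp only [Cmd.Safe, Cmd.run]
    simp [hik, hm₁]
    split_ifs <;> simp [hw₁.a_lt, hik] <;> omega
  · simp only [Cmd.run, Cond.holds_lt, Expr.eval_var, hik, hm₁]
    intro i hi
    rcases Nat.lt_succ_iff_lt_or_eq.1 hi with h | rfl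
    · split_ifs <;> simp [hik, h.ne, h1 i h]
    · unfold triplePos
      split_ifs <;> simp [hik, hm₁, ho₁, hZ₁]

open Cmd QGram.Expr in
/-- Appends the string of triples of the current level, which becomes the current one. -/
def shrink : Cmd :=
  (put .OFF (var .k) (var .off) ;; put .LEN (var .k) (var .len) ;; put .QQ (var .k) (var .qq) ;;
  assign .m (var .len / 3) ;; assign .V (2 * var .m)) ;;
  triple .acc 0 ;; triple .key 1 ;; pairName ;; triple .key 2 ;; pairName ;;
  forTo .i .V (put .ZZ (var .off + var .len + var .i) (get .acc (var .i))) ;;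
  assign .off (var .off + var .len) ;; assign .len (var .V) ;; assign .qq ((var .qq - 2) / 3) ;;
  assign .k (var .k + 1)

theorem gramEq_three {z : ℕ → ℕ} {i j : ℕ} : GramEq z 3 i j ↔
    (z (i + 0) = z (j + 0) ∧ z (i + 1) = z (j + 1)) ∧ z (i + 2) = z (j + 2) := by
  constructor
  · exact fun h => ⟨⟨h 0 (by omega), h 1 (by omega)⟩, h 2 (by omega)⟩
  · rintro ⟨⟨h0, h1⟩, h2⟩ t ht
    interval_cases t
    · exact h0
    · exact h1
    · exact h2

/-- The names of two indices of the string of triples agree if and only if the triples do. -/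
theorem shrink_spec {s : HState} {len off qq k : ℕ} (hBS : 16 * S + 64 ≤ B)
    (hlen : s.v .len = len) (hoff : s.v .off = off) (hqq : s.v .qq = qq) (hk : s.v .k = k)
    (hlS : off + 2 * len ≤ S) (hkS : k < S) (hqS : qq ≤ S)
    (hc : Clean s) (hZ : ∀ i, s.a .ZZ i < S) :
    HT B S shrink s (80 * len + 40) (fun s' => Clean s' ∧ (∀ i, s'.a .ZZ i < S) ∧
      s'.v .off = off + len ∧ s'.v .len = 2 * (len / 3) ∧ s'.v .qq = (qq - 2) / 3 ∧
      s'.v .k = k + 1 ∧ s'.a .OFF = Function.update (s.a .OFF) k off ∧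
      s'.a .LEN = Function.update (s.a .LEN) k len ∧
      s'.a .QQ = Function.update (s.a .QQ) k qq ∧
      (∀ i < off + len, s'.a .ZZ i = s.a .ZZ i) ∧
      Link (fun i => s.a .ZZ (off + i)) (fun i => s'.a .ZZ (off + len + i)) len) := by
  obtain ⟨m, hm⟩ : ∃ m, m = len / 3 := ⟨_, rfl⟩
  obtain ⟨V, hV⟩ : ∃ V, V = 2 * m := ⟨_, rfl⟩
  have hVS : V ≤ S := by omega
  refine HT.seq 5 (66 * V + 24) (R := fun s₁ => s₁ = ((((s.setArr .OFF k off).setArr .LEN k len).setArr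
    .QQ k qq).setVar .m m).setVar .V V) (.straight (fun _ => ?_) le_rfl fun _ => ?_) ?_ (by omega)
  · simp [Cmd.Safe, Cmd.run, hlen, hoff, hqq, hk]; omega
  · simp [Cmd.run, hlen, hoff, hqq, hk, ← hm, hV]
  rintro s₁ - - rfl
  set s₁ := ((((s.setArr .OFF k off).setArr .LEN k len).setArr .QQ k qq).setVar .m m).setVar .V V
    with hs₁
  have v1 : ∀ x, x ≠ .m → x ≠ .V → s₁.v x = s.v x := fun x h1 h2 => by simp [hs₁, h1, h2]
  have a1 : ∀ b, b ≠ .OFF → b ≠ .LEN → b ≠ .QQ → s₁.a b = s.a b := fun x h1 h2 h3 => by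
    simp [hs₁, h1, h2, h3]
  have hoff₁ : s₁.v .off = off := (v1 _ (by decide) (by decide)).trans hoff
  have hV₁ : s₁.v .V = V := by simp [hs₁]
  have hm₁ : s₁.v .m = m := by simp [hs₁]
  have hZ₁ : s₁.a .ZZ = s.a .ZZ := a1 _ (by decide) (by decide) (by decide)
  have hc₁ : Clean s₁ := ⟨by simpa [hs₁] using hc.1, by simpa [hs₁] using hc.2,
    by simpa [hs₁] using hc.3, by simpa [hs₁] using hc.4⟩
  refine HT.seq _ (61 * V + 22) (triple_spec hBS (by decide) hV₁ hm₁ hoff₁ hVS) ?_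
    (show 5 * V + 2 + _ ≤ _ by omega)
  intro s₂ hw₂ hF₂ hacc₂
  rw [hZ₁] at hacc₂
  have hZ₂ : s₂.a .ZZ = s.a .ZZ := (hF₂.a _ (by decide)).trans hZ₁
  have hV₂ : s₂.v .V = V := (hF₂.v _ (by decide)).trans hV₁
  have hm₂ : s₂.v .m = m := (hF₂.v _ (by decide)).trans hm₁
  have hoff₂ : s₂.v .off = off := (hF₂.v _ (by decide)).trans hoff₁
  have hc₂ := hc₁.of_frame hF₂ (by decide) (by decide) (by decide) (by decide)
  refine HT.seq _ (56 * V + 20) (triple_spec hBS (by decide) hV₂ hm₂ hoff₂ hVS) ?_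
    (show 5 * V + 2 + _ ≤ _ by omega)
  intro s₃ hw₃ hF₃ hkey₃
  rw [hZ₂] at hkey₃
  have hZ₃ : s₃.a .ZZ = s.a .ZZ := (hF₃.a _ (by decide)).trans hZ₂
  have hV₃ : s₃.v .V = V := (hF₃.v _ (by decide)).trans hV₂
  have hm₃ : s₃.v .m = m := (hF₃.v _ (by decide)).trans hm₂
  have hoff₃ : s₃.v .off = off := (hF₃.v _ (by decide)).trans hoff₂
  have hc₃ := hc₂.of_frame hF₃ (by decide) (by decide) (by decide) (by decide)
  refine HT.seq _ (32 * V + 14) (pairName_spec _ _ hV₃ hVS hc₃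
    (fun i hi => by rw [hF₃.a _ (by decide)]; exact hacc₂ i hi) hkey₃ (fun _ _ => hZ _)
    (fun _ _ => hZ _) le_rfl) ?_ (by omega)
  rintro s₄ hw₄ hF₄ ⟨hc₄, hlt₄, hiff₄⟩
  have hZ₄ : s₄.a .ZZ = s.a .ZZ := (hF₄.a _ (by decide)).trans hZ₃
  have hV₄ : s₄.v .V = V := (hF₄.v _ (by decide)).trans hV₃
  have hm₄ : s₄.v .m = m := (hF₄.v _ (by decide)).trans hm₃
  have hoff₄ : s₄.v .off = off := (hF₄.v _ (by decide)).trans hoff₃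
  refine HT.seq _ (27 * V + 12) (triple_spec hBS (by decide) hV₄ hm₄ hoff₄ hVS) ?_
    (show 5 * V + 2 + _ ≤ _ by omega)
  intro s₅ hw₅ hF₅ hkey₅
  rw [hZ₄] at hkey₅
  have hZ₅ : s₅.a .ZZ = s.a .ZZ := (hF₅.a _ (by decide)).trans hZ₄
  have hV₅ : s₅.v .V = V := (hF₅.v _ (by decide)).trans hV₄
  have hc₅ := hc₄.of_frame hF₅ (by decide) (by decide) (by decide) (by decide)
  refine HT.seq _ (3 * V + 6) (pairName_spec _ _ hV₅ hVS hc₅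
    (fun i hi => by rw [hF₅.a _ (by decide)]) hkey₅ (fun i hi => (hlt₄ i hi).trans_le hVS)
    (fun _ _ => hZ _) le_rfl) ?_ (by omega)
  rintro s₆ hw₆ hF₆ ⟨hc₆, hlt₆, hiff₆⟩
  have hZ₆ : s₆.a .ZZ = s.a .ZZ := (hF₆.a _ (by decide)).trans hZ₅
  have hV₆ : s₆.v .V = V := (hF₆.v _ (by decide)).trans hV₅
  have v6 : ∀ x, x ∉ shrink.vars ∨ x = .off ∨ x = .len ∨ x = .k ∨ x = .qq → s₆.v x = s₁.v x := by
    intro x hx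
    have h : x ∉ (triple .acc 0).vars ++ pairName.vars := by
      rcases hx with hx | rfl | rfl | rfl | rfl
      · intro h
        refine hx ?_
        have : (triple .acc 0).vars ++ pairName.vars ⊆ shrink.vars := by decide
        exact this h
      all_goals decide
    rw [List.mem_append, not_or] at h
    rw [hF₆.v _ h.2, hF₅.v _ h.1, hF₄.v _ h.2, hF₃.v _ h.1, hF₂.v _ h.1]
  have hoff₆ : s₆.v .off = off := (v6 _ (by simp)).trans hoff₁
  have hlen₆ : s₆.v .len = len := by
    rw [v6 _ (by simp), v1 _ (by decide) (by decide), hlen]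
  have hk₆ : s₆.v .k = k := by rw [v6 _ (by simp), v1 _ (by decide) (by decide), hk]
  have hqq₆ : s₆.v .qq = qq := by rw [v6 _ (by simp), v1 _ (by decide) (by decide), hqq]
  refine HT.seq (3 * V + 2) 4 (R := fun s₇ => (∀ i < V, s₇.a .ZZ (off + len + i) = s₆.a .acc i) ∧
    (∀ i < off + len, s₇.a .ZZ i = s.a .ZZ i) ∧ ∀ i, s₇.a .ZZ i < S)
    (HT.forTo (fun k s₇ => (∀ i < k, s₇.a .ZZ (off + len + i) = s₆.a .acc i) ∧
    (∀ i < off + len, s₇.a .ZZ i = s.a .ZZ i) ∧ ∀ i, s₇.a .ZZ i < S) V 1 (by decide) (by decide)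
    (by decide) hV₆ (fun _ _ _ h => h) ⟨by simp, by simp [hZ₆], by simpa [hZ₆] using hZ⟩ ?_
    (by omega) (fun _ _ _ h => h)) ?_ (by omega)
  · rintro j hj s₇ hw₇ hF₇ hij ⟨h1, h2, h3⟩
    have e1 : s₇.v .off = off := (hF₇.v _ (by decide)).trans hoff₆
    have e2 : s₇.v .len = len := (hF₇.v _ (by decide)).trans hlen₆
    have e3 : s₇.a .acc = s₆.a .acc := hF₇.a _ (by decide)
    have hS := (hlt₆ j hj).trans_le hVS
    refine .straight (fun _ => ?_) le_rfl fun _ => ?_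
    · simp [Cmd.Safe, e1, e2, e3, hij, hw₆.a_lt]; omega
    · simp only [Cmd.run, Expr.eval_add, Expr.eval_var, Expr.eval_get, e1, e2, e3, hij,
        HState.setArr_a, if_true]
      refine ⟨fun i hi => ?_, fun i hi => ?_, fun i => ?_⟩
      · rcases Nat.lt_succ_iff_lt_or_eq.1 hi with h | rfl
        · rw [Function.update_of_ne (by omega), h1 i h]
        · simp
      · rw [Function.update_of_ne (by omega), h2 i hi]
      · rw [Function.update_apply]; split
        · exact hS
        · exact h3 i
  rintro s₇ hw₇ hF₇ ⟨hnew, hold, hZS⟩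
  have hoff₇ : s₇.v .off = off := (hF₇.v _ (by decide)).trans hoff₆
  have hlen₇ : s₇.v .len = len := (hF₇.v _ (by decide)).trans hlen₆
  have hk₇ : s₇.v .k = k := (hF₇.v _ (by decide)).trans hk₆
  have hqq₇ : s₇.v .qq = qq := (hF₇.v _ (by decide)).trans hqq₆
  have hV₇ : s₇.v .V = V := (hF₇.v _ (by decide)).trans hV₆
  have hc₇ := hc₆.of_frame hF₇ (by decide) (by decide) (by decide) (by decide)
  have a7 : ∀ b, b = .OFF ∨ b = .LEN ∨ b = .QQ → s₇.a b = s₁.a b := by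
    rintro b (rfl | rfl | rfl) <;>
    rw [hF₇.a _ (by decide), hF₆.a _ (by decide), hF₅.a _ (by decide), hF₄.a _ (by decide),
      hF₃.a _ (by decide), hF₂.a _ (by decide)]
  refine .straight (fun _ => ?_) le_rfl fun _ => ?_
  · simp [Cmd.Safe, Cmd.run, hoff₇, hlen₇, hk₇, hqq₇, hV₇]; omega
  · simp only [Cmd.run]
    simp [hoff₇, hlen₇, hk₇, hqq₇, hV₇, a7, hs₁, hZS, hV, hm]
    refine ⟨⟨hc₇.1, hc₇.2, hc₇.3, hc₇.4⟩, hold, fun a ha b hb _ _ => ?_⟩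
    rw [← hm, ← hV] at ha hb
    beta_reduce
    rw [hnew a ha, hnew b hb, hiff₆ a ha b hb, hiff₄ a ha b hb, gramEq_three, hm]

open Cmd QGram.Expr in
/-- Names in `G` the grams of length `qq` of the string of length `len` at `off = 0` in `ZZ`. -/
def nameGrams : Cmd :=
  .loop (.lt 4 (var .qq)) shrink ;;
  assign .q' 0 ;; process ;;
  .loop (.lt 0 (var .k)) (
    (assign .k (var .k - 1) ;; assign .q' (var .qq) ;; assign .qq (get .QQ (var .k)) ;;
    assign .off (get .OFF (var .k)) ;; assign .len (get .LEN (var .k)) ;;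
    assign .m (var .len / 3)) ;; process)

/-- The strings of the levels `0, …, k` stand one after the other in `ZZ`, and the parameters of the
levels below `k` are stored in `OFF`, `LEN` and `QQ`. -/
structure Levels (s : HState) (S N q : ℕ) (z : ℕ → ℕ) (k : ℕ) : Prop where
  clean : Clean s
  ZZ_lt : ∀ i, s.a .ZZ i < S
  G_lt : ∀ i, s.a .G i < S
  off : ∀ j < k, s.a .OFF j = lvlOff N j
  len : ∀ j < k, s.a .LEN j = lvlLen N j
  qq : ∀ j < k, s.a .QQ j = lvlQ q j
  ZZ_eq : ∀ i < N, s.a .ZZ i = z i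
  link : ∀ j < k, Link (fun i => s.a .ZZ (lvlOff N j + i)) (fun i => s.a .ZZ (lvlOff N (j + 1) + i))
    (lvlLen N j)
  five_le : ∀ j < k, 5 ≤ lvlQ q j

/-- As the gram length decreases on each level, the depth of the recursion is at most `q`. -/
theorem lvlQ_add_le {q : ℕ} : ∀ {k : ℕ}, (∀ j < k, 5 ≤ lvlQ q j) → lvlQ q k + k ≤ q
  | 0, _ => by simp [lvlQ]
  | k + 1, h => by
    have h1 := lvlQ_add_le (k := k) fun j hj => h j (by omega)
    have h2 := h k (by omega)
    simp only [lvlQ]; omega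

theorem lvlOff_mono (N : ℕ) {i j : ℕ} (h : i ≤ j) : lvlOff N i ≤ lvlOff N j :=
  monotone_nat_of_le_succ (fun k => by simp only [lvlOff]; omega) h

/-- The grams of length `q` are named in linear time, because the strings on all levels together have
length at most `3 * N`. -/
theorem nameGrams_spec {s : HState} {N q : ℕ} (hBS : 16 * S + 64 ≤ B) (hNS : 3 * N ≤ S)
    (hqS : q ≤ S) (hq0 : 0 < q)
    (hlen : s.v .len = N) (hoff : s.v .off = 0) (hqq : s.v .qq = q) (hk : s.v .k = 0)
    (hc : Clean s) (hZ : ∀ i, s.a .ZZ i < S) (hG : ∀ i, s.a .G i < S) :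
    HT B S nameGrams s (3000 * N + 1000 * q + 1000) (fun s' => (∀ i, s'.a .G i < S) ∧
      ∀ i j, i + q ≤ N → j + q ≤ N → (s'.a .G i = s'.a .G j ↔ GramEq (s.a .ZZ) q i j)) := by
  set z := s.a .ZZ with hz
  refine HT.seq (240 * N + 41 * q + 1) (2700 * N + 900 * q + 900) (R := fun s₁ =>
      ∃ k, Levels s₁ S N q z k ∧ s₁.v .k = k ∧ s₁.v .off = lvlOff N k ∧ s₁.v .len = lvlLen N k ∧
        s₁.v .qq = lvlQ q k ∧ lvlQ q k < 5 ∧ 0 < lvlQ q k)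
    (HT.loop (fun s₁ =>
      ∃ k, Levels s₁ S N q z k ∧ s₁.v .k = k ∧ s₁.v .off = lvlOff N k ∧ s₁.v .len = lvlLen N k ∧
        s₁.v .qq = lvlQ q k ∧ 0 < lvlQ q k)
      (fun s₁ => 240 * s₁.v .len + 41 * s₁.v .qq) ?_ ?_ ?_ ?_) ?_ (by omega)
  · exact ⟨0, ⟨hc, hZ, hG, by simp, by simp, by simp, by simp [hz], by simp, by simp⟩,
      hk, hoff, hlen, hqq, hq0⟩
  · rintro s₁ hw₁ hF₁ ⟨k, hL, h1, h2, h3, h4, h5⟩ hb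
    have hb' : 4 < lvlQ q k := by simpa [h4] using hb
    have hol := lvlOff_add_lvlLen N k
    have := lvlQ_add_le hL.five_le
    refine ⟨_, (shrink_spec hBS h3 h2 h4 h1 (by omega) (by omega) (by omega) hL.clean
      hL.ZZ_lt).conseq le_rfl ?_⟩
    rintro s₂ hw₂ hF₂ ⟨hc₂, hZ₂, o₂, l₂, q₂, k₂, oo₂, ll₂, qq₂, hold, hlink⟩
    refine ⟨⟨k + 1, ⟨hc₂, hZ₂, ?_, ?_, ?_, ?_, ?_, ?_, ?_⟩, k₂, o₂, l₂, q₂, ?_⟩, ?_⟩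
    · rw [hF₂.a _ (by decide)]; exact hL.G_lt
    · intro j hj
      rw [oo₂]
      rcases Nat.lt_succ_iff_lt_or_eq.1 hj with h | rfl
      · rw [Function.update_of_ne h.ne, hL.off j h]
      · simp
    · intro j hj
      rw [ll₂]
      rcases Nat.lt_succ_iff_lt_or_eq.1 hj with h | rfl
      · rw [Function.update_of_ne h.ne, hL.len j h]
      · simp
    · intro j hj
      rw [qq₂]
      rcases Nat.lt_succ_iff_lt_or_eq.1 hj with h | rfl
      · rw [Function.update_of_ne h.ne, hL.qq j h]
      · simp
    · intro i hi
      rw [hold, hL.ZZ_eq i hi]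
      have := lvlOff_mono N (show 1 ≤ k + 1 by omega)
      simp only [lvlOff, lvlLen] at this
      omega
    · intro j hj
      rcases Nat.lt_succ_iff_lt_or_eq.1 hj with h | rfl
      · intro a ha b hb hpa hpb
        have ho : lvlOff N (j + 1) + lvlLen N (j + 1) ≤ lvlOff N k + lvlLen N k :=
          lvlOff_mono N (show j + 2 ≤ k + 1 by omega)
        have e1 : lvlOff N (j + 1) = lvlOff N j + lvlLen N j := rfl
        have e2 : lvlLen N (j + 1) = 2 * (lvlLen N j / 3) := rfl
        have hh := hL.link j h a ha b hb hpa hpb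
        simp only
        rw [hold _ (by omega), hold _ (by omega), hh]
        refine forall₂_congr fun t ht => ?_
        beta_reduce
        rw [hold _ (by omega), hold _ (by omega)]
      · intro a ha b hb hpa hpb
        have hh := hlink a ha b hb hpa hpb
        simp only [lvlOff] at hh ⊢
        rw [hh]
        refine forall₂_congr fun t ht => ?_
        beta_reduce
        rw [hold _ (by omega), hold _ (by omega)]
    · intro j hj
      rcases Nat.lt_succ_iff_lt_or_eq.1 hj with h | rfl
      · exact hL.five_le j h
      · exact hb'
    · simp only [lvlQ]; omega
    · rw [l₂, q₂, h3, h4]; omega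
  · rw [hlen, hqq]
  · rintro s₁ hw₁ hF₁ ⟨k, hL, h1, h2, h3, h4, h5⟩ hb
    exact ⟨k, hL, h1, h2, h3, h4, by simpa [h4, Nat.lt_succ_iff] using hb, h5⟩
  rintro s₁ hw₁ hF₁ ⟨k, hL, h1, h2, h3, h4, h5, h6⟩
  refine HT.seq 1 (2700 * N + 900 * q + 899) (R := fun s₂ => s₂ = s₁.setVar .q' 0)
    (.straight (fun _ => by simp [Cmd.Safe]; omega) le_rfl fun _ => by simp [Cmd.run]) ?_ (by omega)
  rintro s₂ hw₂ - rfl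
  have hol := lvlOff_add_lvlLen N k
  have hNl := lvlLen_le N k
  have := lvlQ_add_le hL.five_le
  refine HT.seq (640 * N + 400) (2060 * N + 900 * q + 499)
    ((process_spec (s := s₁.setVar .q' 0) (q' := 0) hBS (len := lvlLen N k) (off := lvlOff N k) (qq := lvlQ q k)
      (by simp [h3]) (by simp [h2]) (by simp [h4]) (by simp) rfl (by omega) h6 (by omega)
      ⟨hL.clean.1, hL.clean.2, hL.clean.3, hL.clean.4⟩ hL.ZZ_lt hL.G_lt (by omega)
      (by simp) (by simp)).conseq (by omega) fun _ _ _ h => h) ?_ (by omega)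
  rintro s₃ hw₃ hF₃ ⟨hc₃, hG₃, hiff₃⟩
  have hk3 : k < q := by omega
  -- on the way back from the innermost level, `G` holds names of the grams of the current level
  refine HT.loop (fun s₄ => ∃ k, Levels s₄ S N q z k ∧ s₄.v .k = k ∧ s₄.v .qq = lvlQ q k ∧
      0 < lvlQ q k ∧
      ∀ i j, i + lvlQ q k ≤ lvlLen N k → j + lvlQ q k ≤ lvlLen N k →
        (s₄.a .G i = s₄.a .G j ↔ GramEq (fun i => s₄.a .ZZ (lvlOff N k + i)) (lvlQ q k) i j))
    (fun s₄ => 640 * lvlOff N (s₄.v .k) + 407 * s₄.v .k) ?_ ?_ ?_ ?_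
  · have e : ∀ b, b ∉ process.arrs → s₃.a b = s₁.a b := fun b hb => by rw [hF₃.a b hb]; rfl
    have hZ₃ : s₃.a .ZZ = s₁.a .ZZ := e _ (by decide)
    refine ⟨k, ⟨hc₃, by rw [hZ₃]; exact hL.ZZ_lt, hG₃, ?_, ?_, ?_, ?_, ?_, hL.five_le⟩,
      ?_, ?_, h6, ?_⟩
    · rw [e _ (by decide)]; exact hL.off
    · rw [e _ (by decide)]; exact hL.len
    · rw [e _ (by decide)]; exact hL.qq
    · rw [hZ₃]; exact hL.ZZ_eq
    · rw [hZ₃]; exact hL.link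
    · rw [hF₃.v _ (by decide)]; simp [h1]
    · rw [hF₃.v _ (by decide)]; simp [h4]
    · rw [hZ₃]; exact hiff₃
  · rintro s₄ hw₄ hF₄ ⟨k, hL, h1, h4, h6, hiff⟩ hb
    have hk0 : 0 < k := by simpa [h1] using hb
    obtain ⟨k, rfl⟩ : ∃ l, k = l + 1 := ⟨k - 1, by omega⟩
    have hadd := lvlQ_add_le hL.five_le
    have h5 := hL.five_le k (by omega)
    have hoL := lvlOff_add_lvlLen N k
    have hNL := lvlLen_le N k
    have hQ : lvlQ q (k + 1) = (lvlQ q k - 2) / 3 := rfl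
    have hQle := lvlQ_le q k
    have hQe := hL.qq k (by omega)
    have hOe := hL.off k (by omega)
    have hLe := hL.len k (by omega)
    refine ⟨640 * lvlLen N k + 406, HT.seq 6 (640 * lvlLen N k + 400) (R := fun s₅ =>
      s₅ = (((((s₄.setVar .k k).setVar .q' (lvlQ q (k + 1))).setVar .qq (lvlQ q k)).setVar .off
        (lvlOff N k)).setVar .len (lvlLen N k)).setVar .m (lvlLen N k / 3))
      (.straight (fun _ => ?_) le_rfl fun _ => ?_) ?_ (by omega)⟩
    · simp [Cmd.Safe, Cmd.run, h1, h4, hQe, hOe, hLe]; omega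
    · simp [Cmd.run, h1, h4, hQe, hOe, hLe]
    rintro s₅ hw₅ - rfl
    refine (process_spec (s := (((((s₄.setVar .k k).setVar .q' (lvlQ q (k + 1))).setVar .qq
      (lvlQ q k)).setVar .off (lvlOff N k)).setVar .len (lvlLen N k)).setVar .m (lvlLen N k / 3))
      hBS (len := lvlLen N k) (off := lvlOff N k) (qq := lvlQ q k) (q' := lvlQ q (k + 1)) (m := lvlLen N k / 3)
      (by simp) (by simp) (by simp) (by simp) (by simp) (by omega) (by omega) (by omega)
      ⟨hL.clean.1, hL.clean.2, hL.clean.3, hL.clean.4⟩ hL.ZZ_lt hL.G_lt (by omega)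
      (by omega) ?_).conseq le_rfl ?_
    · intro _ p r hp3 hr3 hp hr
      exact (hL.link k (by omega)).sampled_eq_iff h6 hiff hp3 hr3 hp hr
    · rintro s₆ hw₆ hF₆ ⟨hc₆, hG₆, hiff₆⟩
      have e : ∀ b, b ∉ process.arrs → s₆.a b = s₄.a b := fun b hb => by rw [hF₆.a b hb]; rfl
      have hZ₆ : s₆.a .ZZ = s₄.a .ZZ := e _ (by decide)
      have hk₆ : s₆.v .k = k := by rw [hF₆.v _ (by decide)]; simp
      refine ⟨⟨k, ⟨hc₆, by rw [hZ₆]; exact hL.ZZ_lt, hG₆, ?_, ?_, ?_, ?_, ?_, ?_⟩,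
        hk₆, ?_, by omega, ?_⟩, ?_⟩
      · rw [e _ (by decide)]; exact fun j hj => hL.off j (by omega)
      · rw [e _ (by decide)]; exact fun j hj => hL.len j (by omega)
      · rw [e _ (by decide)]; exact fun j hj => hL.qq j (by omega)
      · rw [hZ₆]; exact hL.ZZ_eq
      · rw [hZ₆]; exact fun j hj => hL.link j (by omega)
      · exact fun j hj => hL.five_le j (by omega)
      · rw [hF₆.v _ (by decide)]; simp
      · rw [hZ₆]; exact hiff₆
      · rw [hk₆, h1]; simp only [lvlOff]; omega
  · have : s₃.v .k = k := by rw [hF₃.v _ (by decide)]; simp [h1]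
    rw [this]; omega
  · rintro s₄ hw₄ hF₄ ⟨k, hL, h1, h4, h6, hiff⟩ hb
    obtain rfl : k = 0 := by simpa [h1] using hb
    refine ⟨hL.G_lt, fun i j hi hj => (hiff i j hi hj).trans ?_⟩
    refine forall₂_congr fun t ht => ?_
    simp only [lvlOff, zero_add, lvlQ] at ht ⊢
    rw [hL.ZZ_eq _ (by omega), hL.ZZ_eq _ (by omega)]

/-! ### Naming the letters -/

open Cmd QGram.Expr in
/-- Names in `ZZ` the letters of the string of length `N` in `Z`, digit by digit in base `N + 1`. -/
def nameLetters : Cmd :=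
  (assign .mx 0 ;; assign .V (var .N) ;; assign .bnd (var .N + 1) ;; assign .pw 1) ;;
  forTo .i .V (.ite (.lt (var .mx) (get .Z (var .i))) (assign .mx (get .Z (var .i))) .skip) ;;
  forTo .i .V (put .acc (var .i) 0) ;;
  .loop (.lt (var .pw) (var .mx + 1)) (
    forTo .i .V (put .key (var .i) (get .Z (var .i) / var .pw % var .bnd)) ;;
    pairName ;;
    assign .pw (var .pw * var .bnd)) ;;
  forTo .i .V (put .ZZ (var .i) (get .acc (var .i)))

theorem mod_mul_eq_iff {a b p k : ℕ} (hp : 0 < p) :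
    a % (p * k) = b % (p * k) ↔ a % p = b % p ∧ a / p % k = b / p % k := by
  rw [Nat.mod_mul, Nat.mod_mul]
  constructor
  · intro h
    have h1 := congrArg (· % p) h
    have h2 := congrArg (· / p) h
    simp only [Nat.add_mul_mod_self_left, Nat.mod_mod, Nat.add_mul_div_left _ _ hp,
      Nat.div_eq_of_lt (Nat.mod_lt _ hp), zero_add] at h1 h2
    exact ⟨h1, h2⟩
  · rintro ⟨h1, h2⟩
    rw [h1, h2]

/-- As `σ ≤ (N + 1) ^ R`, the letters have at most `R` digits, each of which fits into an array index.
The names after `r` rounds distinguish the letters modulo `(N + 1) ^ r`. -/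
theorem nameLetters_spec {s : HState} {N σ R : ℕ} (hBS : 16 * S + 64 ≤ B) (hN : s.v .N = N)
    (hN0 : 0 < N) (hNS : N + 1 ≤ S) (hσB : σ * (N + 1) ≤ B) (hσR : σ ≤ (N + 1) ^ R)
    (hc : Clean s) (hσ : ∀ i, s.a .Z i < σ) (hZZ : ∀ i, s.a .ZZ i < S) :
    HT B S nameLetters s ((27 * N + 10) * R + 12 * N + 20) (fun s' => Clean s' ∧
      (∀ i, s'.a .ZZ i < S) ∧ ∀ i < N, ∀ j < N, (s'.a .ZZ i = s'.a .ZZ j ↔ s.a .Z i = s.a .Z j)) := by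
  have hσ0 : 0 < σ := (Nat.zero_le _).trans_lt (hσ 0)
  set z := s.a .Z with hz
  refine HT.seq 4 ((27 * N + 10) * R + 12 * N + 16)
    (R := fun s₁ => s₁ = (((s.setVar .mx 0).setVar .V N).setVar .bnd (N + 1)).setVar .pw 1)
    (.straight (fun _ => ?_) le_rfl fun _ => ?_) ?_ (by omega)
  · simp [Cmd.Safe, Cmd.run, hN]; omega
  · simp [Cmd.run, hN]
  rintro s₁ hw₁ - rfl
  set s₁ := (((s.setVar .mx 0).setVar .V N).setVar .bnd (N + 1)).setVar .pw 1 with hs₁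
  have hV₁ : s₁.v .V = N := by simp [hs₁]
  refine HT.seq (4 * N + 2) ((27 * N + 10) * R + 8 * N + 14)
    (R := fun s₂ => (∀ i < N, z i ≤ s₂.v .mx) ∧ s₂.v .mx < σ)
    (HT.forTo (fun k s₂ => (∀ i < k, z i ≤ s₂.v .mx) ∧ s₂.v .mx < σ) N 2 (by decide) (by decide)
      (by decide) hV₁ (fun _ _ _ h => by simpa using h) ⟨by simp, by simpa [hs₁] using hσ0⟩ ?_
      (by omega) (fun _ _ _ h => h)) ?_ (by omega)
  · rintro k hk s₂ hw₂ hF₂ hik ⟨h1, h2⟩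
    have hZ₂ : s₂.a .Z = z := hF₂.a _ (by decide)
    refine .straight (fun _ => ?_) le_rfl fun _ => ?_
    · simp [Cmd.Safe, hw₂.a_lt]
    · simp only [Cmd.run, Cond.holds_lt, Expr.eval_var, Expr.eval_get, hik, hZ₂]
      split_ifs with h
      · refine ⟨fun i hi => ?_, by simpa using hσ k⟩
        simp only [HState.setVar_v, if_true]
        rcases Nat.lt_succ_iff_lt_or_eq.1 hi with h' | rfl
        · exact (h1 i h').trans h.le
        · exact le_rfl
      · refine ⟨fun i hi => ?_, h2⟩
        rcases Nat.lt_succ_iff_lt_or_eq.1 hi with h' | rfl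
        · exact h1 i h'
        · exact not_lt.1 h
  rintro s₂ hw₂ hF₂ ⟨hmx, hmxσ⟩
  have hV₂ : s₂.v .V = N := (hF₂.v _ (by decide)).trans hV₁
  have hb₂ : s₂.v .bnd = N + 1 := (hF₂.v _ (by decide)).trans (by simp [hs₁])
  have hp₂ : s₂.v .pw = 1 := (hF₂.v _ (by decide)).trans (by simp [hs₁])
  have hZ₂ : s₂.a .Z = z := hF₂.a _ (by decide)
  have hc₁ : Clean s₁ := ⟨hc.1, hc.2, hc.3, hc.4⟩
  have hc₂ := hc₁.of_frame hF₂ (by decide) (by decide) (by decide) (by decide)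
  refine HT.seq (3 * N + 2) ((27 * N + 10) * R + 5 * N + 12)
    (R := fun s₃ => ∀ i < N, s₃.a .acc i = 0)
    (HT.fill N (fun _ => 0) (by decide) hV₂ (fun k hk s₃ hw₃ hF₃ hik _ _ => ⟨by simp, by omega⟩)
      (by omega) (by omega) (fun _ _ _ h _ => h)) ?_ (by omega)
  rintro s₃ hw₃ hF₃ hacc₃
  have hV₃ : s₃.v .V = N := (hF₃.v _ (by decide)).trans hV₂
  have hb₃ : s₃.v .bnd = N + 1 := (hF₃.v _ (by decide)).trans hb₂
  have hp₃ : s₃.v .pw = 1 := (hF₃.v _ (by decide)).trans hp₂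
  have hm₃ : s₃.v .mx = s₂.v .mx := hF₃.v _ (by decide)
  have hZ₃ : s₃.a .Z = z := (hF₃.a _ (by decide)).trans hZ₂
  have hc₃ := hc₂.of_frame hF₃ (by decide) (by decide) (by decide) (by decide)
  have h1N : 1 < N + 1 := by omega
  -- after `r` rounds `pw` is `(N + 1) ^ r`, so that `R - log pw` bounds the number of further rounds
  refine HT.seq ((27 * N + 10) * R + 1) (3 * N + 2)
    (R := fun s₄ => Clean s₄ ∧ (∀ i < N, s₄.a .acc i < S) ∧
      ∀ i < N, ∀ j < N, (s₄.a .acc i = s₄.a .acc j ↔ z i = z j))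
    (HT.loop (fun s₄ => Clean s₄ ∧ (∀ i < N, s₄.a .acc i < S) ∧ (∃ r ≤ R, s₄.v .pw = (N + 1) ^ r) ∧
      ∀ i < N, ∀ j < N, (s₄.a .acc i = s₄.a .acc j ↔ z i % s₄.v .pw = z j % s₄.v .pw))
      (fun s₄ => (27 * N + 10) * (R - Nat.log (N + 1) (s₄.v .pw))) ?_ ?_ ?_ ?_) ?_ (by omega)
  · refine ⟨hc₃, fun i hi => by rw [hacc₃ i hi]; omega, ⟨0, by omega, by simp [hp₃]⟩, ?_⟩
    intro i hi j hj
    rw [hacc₃ i hi, hacc₃ j hj, hp₃]; simp [Nat.mod_one]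
  · rintro s₄ hw₄ hF₄ ⟨hc₄, hS₄, ⟨r, hr, hpw⟩, hiff⟩ hb
    have hm₄ : s₄.v .mx = s₂.v .mx := (hF₄.v _ (by decide)).trans hm₃
    have hV₄ : s₄.v .V = N := (hF₄.v _ (by decide)).trans hV₃
    have hb₄ : s₄.v .bnd = N + 1 := (hF₄.v _ (by decide)).trans hb₃
    have hZ₄ : s₄.a .Z = z := (hF₄.a _ (by decide)).trans hZ₃
    have hle : (N + 1) ^ r < σ := by
      have : s₄.v .pw < s₄.v .mx + 1 := hb
      omega
    have hrR : r < R := by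
      by_contra h
      obtain rfl : r = R := by omega
      omega
    refine ⟨27 * N + 9, HT.seq (3 * N + 2) (24 * N + 7)
      (R := fun s₅ => ∀ i < N, s₅.a .key i = z i / (N + 1) ^ r % (N + 1))
      (HT.fill N (fun i => z i / (N + 1) ^ r % (N + 1)) (by decide) hV₄ ?_ (by omega) (by omega)
        (fun _ _ _ h _ => h)) ?_ (by omega)⟩
    · intro k hk s₅ hw₅ hF₅ hik _ _
      have h1 : s₅.v .pw = (N + 1) ^ r := (hF₅.v _ (by decide)).trans hpw
      have h2 : s₅.v .bnd = N + 1 := (hF₅.v _ (by decide)).trans hb₄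
      have h3 : s₅.a .Z = z := (hF₅.a _ (by decide)).trans hZ₄
      have := Nat.mod_lt (z k / (N + 1) ^ r) (show 0 < N + 1 by omega)
      exact ⟨by simp [hik, h1, h2, h3], by omega⟩
    · intro s₅ hw₅ hF₅ hkey₅
      have hc₅ := hc₄.of_frame hF₅ (by decide) (by decide) (by decide) (by decide)
      have ha₅ : s₅.a .acc = s₄.a .acc := hF₅.a _ (by decide)
      refine HT.seq (24 * N + 6) 1 (pairName_spec (s₄.a .acc) _ ((hF₅.v _ (by decide)).trans hV₄)
        (by omega) hc₅ (fun i _ => by rw [ha₅]) hkey₅ hS₄ (fun i _ => ?_) le_rfl) ?_ (by omega)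
      · have := Nat.mod_lt (z i / (N + 1) ^ r) (show 0 < N + 1 by omega)
        omega
      · rintro s₆ hw₆ hF₆ ⟨hc₆, hlt₆, hiff₆⟩
        have h1 : s₆.v .pw = (N + 1) ^ r := by
          rw [hF₆.v _ (by decide), hF₅.v _ (by decide), hpw]
        have h2 : s₆.v .bnd = N + 1 := by
          rw [hF₆.v _ (by decide), hF₅.v _ (by decide), hb₄]
        refine .straight (fun _ => ?_) le_rfl fun _ => ?_
        · simp only [Cmd.Safe, Expr.eval_mul, Expr.eval_var, h1, h2]
          calc (N + 1) ^ r * (N + 1) < σ * (N + 1) := Nat.mul_lt_mul_of_pos_right hle (by omega)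
            _ ≤ B := hσB
        · simp only [Cmd.run, Expr.eval_mul, Expr.eval_var, h1, h2, HState.setVar_v, if_true,
            HState.setVar_a, ← pow_succ]
          refine ⟨⟨⟨hc₆.1, hc₆.2, hc₆.3, hc₆.4⟩, fun i hi => (hlt₆ i hi).trans_le (by omega),
            ⟨r + 1, hrR, rfl⟩, fun i hi j hj => ?_⟩, ?_⟩
          · rw [hiff₆ i hi j hj, hiff i hi j hj, hpw, pow_succ,
              mod_mul_eq_iff (Nat.pow_pos (by omega))]
          · rw [hpw, Nat.log_pow h1N, Nat.log_pow h1N]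
            have : R - r = (R - (r + 1)) + 1 := by omega
            rw [this, Nat.mul_add]; omega
  · rw [hp₃]; simp
  · rintro s₄ hw₄ hF₄ ⟨hc₄, hS₄, ⟨r, hr, hpw⟩, hiff⟩ hb
    have hm₄ : s₄.v .mx = s₂.v .mx := (hF₄.v _ (by decide)).trans hm₃
    have hb' : s₄.v .mx < s₄.v .pw := by simpa using hb
    refine ⟨hc₄, hS₄, fun i hi j hj => ?_⟩
    have := hmx i hi
    have := hmx j hj
    rw [hiff i hi j hj, Nat.mod_eq_of_lt (by omega), Nat.mod_eq_of_lt (by omega)]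
  rintro s₄ hw₄ hF₄ ⟨hc₄, hS₄, hiff⟩
  have hZZ₄ : s₄.a .ZZ = s.a .ZZ := by
    rw [hF₄.a _ (by decide), hF₃.a _ (by decide), hF₂.a _ (by decide)]; rfl
  refine HT.fill N (s₄.a .acc) (by decide) ((hF₄.v _ (by decide)).trans hV₃)
    (fun k hk s₅ hw₅ hF₅ hik _ _ => ⟨by simp [hik, hF₅.a .acc (by decide)], hw₄.a_lt _ _⟩)
    (by omega) (by omega) fun s₅ hw₅ hF₅ h1 h2 => ⟨hc₄.of_frame hF₅ (by decide) (by decide)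
      (by decide) (by decide), fun i => ?_, fun i hi j hj => ?_⟩
  · by_cases hi : i < N
    · rw [h1 i hi]; exact hS₄ i hi
    · rw [h2 i (by omega), hZZ₄]; exact hZZ i
  · rw [h1 i hi, h1 j hj]; exact hiff i hi j hj

/-! ### Occurrences -/

theorem mem_occ {T P : List ℕ} (hP : 0 < P.length) {k : ℕ} :
    k ∈ occ T P ↔ ∀ t < P.length, T[k + t]? = P[t]? := by
  simp only [occ, Finset.mem_filter, Finset.mem_range, List.prefix_iff_getElem?, List.getElem?_drop]
  constructor
  · rintro ⟨-, h⟩ t ht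
    rw [h t ht, List.getElem?_eq_getElem ht]
  · intro h
    refine ⟨?_, fun t ht => by rw [h t ht, List.getElem?_eq_getElem ht]⟩
    have := h 0 hP
    rw [List.getElem?_eq_getElem hP, add_zero] at this
    exact (List.getElem?_eq_some_iff.1 this).1

theorem occ_add_le {T P : List ℕ} (hP : 0 < P.length) {k : ℕ} (h : k ∈ occ T P) :
    k + P.length ≤ T.length := by
  have := (mem_occ hP).1 h (P.length - 1) (by omega)
  rw [List.getElem?_eq_getElem (show P.length - 1 < P.length by omega)] at this
  have := (List.getElem?_eq_some_iff.1 this).1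
  omega

theorem window_getElem? {u v : List ℕ} {m k t : ℕ} (h1 : u.length - m ≤ k) (h2 : k < u.length)
    (ht : t ≤ m) : (u.drop (u.length - m) ++ v.take m)[k - (u.length - m) + t]? =
      (u ++ v)[k + t]? := by
  have hl : (u.drop (u.length - m)).length = u.length - (u.length - m) := List.length_drop
  rcases lt_or_ge (k + t) u.length with h | h
  · rw [List.getElem?_append_left h, List.getElem?_append_left (by omega), List.getElem?_drop]
    congr 1; omega
  · rw [List.getElem?_append_right h, List.getElem?_append_right (by omega), List.getElem?_take,
      if_pos (by omega)]
    congr 1; omega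

/-- An occurrence of `P` in `u ++ v` lies in `u`, or in `v`, or in the window around the
boundary. -/
theorem card_occ_append {u v P : List ℕ} (hP : 0 < P.length) :
    (occ (u ++ v) P).card = (occ u P).card + (occ v P).card +
      (occ (u.drop (u.length - (P.length - 1)) ++ v.take (P.length - 1)) P).card := by
  set w := u.drop (u.length - (P.length - 1)) ++ v.take (P.length - 1) with hw
  have hwl : w.length ≤ (u.length - (u.length - (P.length - 1))) + (P.length - 1) := by
    rw [hw, List.length_append, List.length_drop, List.length_take]; omega
  have hmem : ∀ k, u.length - (P.length - 1) ≤ k → k < u.length →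
      (k ∈ occ (u ++ v) P ↔ k - (u.length - (P.length - 1)) ∈ occ w P) := by
    intro k h1 h2
    rw [mem_occ hP, mem_occ hP]
    exact forall₂_congr fun t ht => by rw [hw, window_getElem? h1 h2 (by omega)]
  have hu : ∀ k ∈ occ u P, k + P.length ≤ u.length := fun k => occ_add_le hP
  have hwm : ∀ k ∈ occ w P, k + P.length ≤ w.length := fun k => occ_add_le hP
  have heq : occ (u ++ v) P = (occ u P ∪ (occ v P).image (· + u.length)) ∪
      (occ w P).image (· + (u.length - (P.length - 1))) := by
    ext k
    simp only [Finset.mem_union, Finset.mem_image]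
    constructor
    · intro hk
      rcases le_or_gt (k + P.length) u.length with h | h
      · refine .inl (.inl ((mem_occ hP).2 fun t ht => ?_))
        rw [← (mem_occ hP).1 hk t ht, List.getElem?_append_left (by omega)]
      rcases le_or_gt u.length k with h' | h'
      · refine .inl (.inr ⟨k - u.length, (mem_occ hP).2 fun t ht => ?_, by omega⟩)
        rw [← (mem_occ hP).1 hk t ht, List.getElem?_append_right (by omega)]
        congr 1; omega
      · exact .inr ⟨_, (hmem k (by omega) h').1 hk, by omega⟩
    · rintro ((hk | ⟨j, hj, rfl⟩) | ⟨j, hj, rfl⟩)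
      · have := hu k hk
        refine (mem_occ hP).2 fun t ht => ?_
        rw [← (mem_occ hP).1 hk t ht, List.getElem?_append_left (by omega)]
      · refine (mem_occ hP).2 fun t ht => ?_
        rw [← (mem_occ hP).1 hj t ht, List.getElem?_append_right (by omega)]
        congr 1; omega
      · have := hwm j hj
        refine (hmem _ (by omega) (by omega)).2 ?_
        rwa [Nat.add_sub_cancel]
  rw [heq, Finset.card_union_of_disjoint, Finset.card_union_of_disjoint,
    Finset.card_image_of_injective _ (add_left_injective _),
    Finset.card_image_of_injective _ (add_left_injective _)]
  · rw [Finset.disjoint_left]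
    intro k hk hk'
    obtain ⟨j, -, rfl⟩ := Finset.mem_image.1 hk'
    have := hu _ hk
    omega
  · rw [Finset.disjoint_left]
    intro k hk hk'
    obtain ⟨j, hj, rfl⟩ := Finset.mem_image.1 hk'
    have := hwm j hj
    rcases Finset.mem_union.1 hk with h | h
    · have := hu _ h
      omega
    · obtain ⟨i, -, e⟩ := Finset.mem_image.1 h
      omega

/-! ### The passes over the straight line program -/

/-- The words of the input describe, for `i < n`, an assignment for a variable that derives `T i`. -/
structure Input (inp : ℕ → ℕ) (n σ : ℕ) (T : ℕ → List ℕ) : Prop where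
  spec : ∀ i < n, (inp (2 + 3 * i) = 0 ∧ inp (3 + 3 * i) < σ ∧ T i = [inp (3 + 3 * i)]) ∨
    (inp (2 + 3 * i) = 1 ∧ inp (3 + 3 * i) < i ∧ inp (4 + 3 * i) < i ∧
      T i = T (inp (3 + 3 * i)) ++ T (inp (4 + 3 * i)))

theorem Input.length_pos {inp : ℕ → ℕ} {n σ : ℕ} {T : ℕ → List ℕ} (h : Input inp n σ T) (i : ℕ)
    (hi : i < n) : 0 < (T i).length := by
  induction i using Nat.strong_induction_on with
  | _ i ih =>
    rcases h.spec i hi with ⟨-, -, e⟩ | ⟨-, hl, -, e⟩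
    · simp [e]
    · have := ih _ hl (hl.trans hi)
      rw [e, List.length_append]; omega

/-- The function `f` on the variables satisfies the recursion with local contribution `c`. -/
def Additive (inp : ℕ → ℕ) (n : ℕ) (f c : ℕ → ℕ) : Prop :=
  ∀ i < n, if inp (2 + 3 * i) = 0 then f i = c i
    else f i = f (inp (3 + 3 * i)) + f (inp (4 + 3 * i)) + c i

open Cmd QGram.Expr in
/-- Computes in `OCC` how often each variable occurs in the derivation tree of the last one, from the
last variable to the first. -/
def countVars : Cmd :=
  put .OCC (var .n - 1) 1 ;;
  forTo .i .n (
    assign .j (var .n - 1 - var .i) ;;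
    .ite (.eq (inp (2 + 3 * var .j)) 0) .skip (
      assign .l (inp (3 + 3 * var .j)) ;;
      assign .r (inp (4 + 3 * var .j)) ;;
      put .OCC (var .l) (get .OCC (var .l) + get .OCC (var .j)) ;;
      put .OCC (var .r) (get .OCC (var .r) + get .OCC (var .j))))

theorem sum_update_add (g f : ℕ → ℕ) {m l : ℕ} (hl : l < m) (d : ℕ) :
    ∑ x ∈ Finset.range m, Function.update g l (g l + d) x * f x =
      ∑ x ∈ Finset.range m, g x * f x + d * f l := by
  have h : ∀ x ∈ Finset.range m, Function.update g l (g l + d) x * f x =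
      g x * f x + if x = l then d * f l else 0 := by
    intro x _
    by_cases e : x = l
    · subst e; simp; ring
    · simp [e]
  rw [Finset.sum_congr rfl h, Finset.sum_add_distrib, Finset.sum_ite_eq' (Finset.range m) l,
    if_pos (Finset.mem_range.2 hl)]

/-- A function that is additive up to local contributions is the sum of these over the derivation
tree. -/
theorem countVars_spec {s : HState} {n σ L : ℕ} {T : ℕ → List ℕ} (hBS : 16 * S + 64 ≤ B)
    (hn : s.v .n = n) (hn0 : 0 < n) (hnS : n ≤ S) (hI : Input s.inp n σ T)
    (hL : L = (T (n - 1)).length) (hLB : 2 * L + 2 ≤ B) (h0 : ∀ i, s.a .OCC i = 0) :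
    HT B S countVars s (8 * n + 3) (fun s' => (∀ x, s'.a .OCC x ≤ L) ∧
      ∀ f c, Additive s.inp n f c → f (n - 1) = ∑ x ∈ Finset.range n, s'.a .OCC x * c x) := by
  refine HT.of_wf fun hw => ?_
  have hnB : n < B := hn ▸ hw.v_lt .n
  refine HT.seq 1 (8 * n + 2) (R := fun s₁ => s₁ = s.setArr .OCC (n - 1) 1)
    (.straight (fun _ => by simp [Cmd.Safe, hn]; omega) le_rfl fun _ => by simp [Cmd.run, hn]) ?_
    (by omega)
  rintro s₁ hw₁ - rfl
  set s₁ := s.setArr .OCC (n - 1) 1 with hs₁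
  have hOcc₁ : s₁.a .OCC = Function.update (s.a .OCC) (n - 1) 1 := by simp [hs₁]
  -- the length of the derived string is additive, which bounds the counters
  have hlen : Additive s.inp n (fun i => (T i).length)
      (fun i => if s.inp (2 + 3 * i) = 0 then 1 else 0) := by
    intro i hi
    rcases hI.spec i hi with ⟨e, -, e'⟩ | ⟨e, -, -, e'⟩
    · simp [e, e']
    · simp [e, e']
  have hbd : ∀ (m : ℕ) (g : ℕ → ℕ), m ≤ n → (∀ f c, Additive s.inp n f c → f (n - 1) =
      ∑ x ∈ Finset.range m, g x * f x + ∑ x ∈ Finset.Ico m n, g x * c x) → ∀ x < m, g x ≤ L := by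
    intro m g hm h x hx
    have h1 := h _ _ hlen
    have h2 : g x * (T x).length ≤ ∑ x ∈ Finset.range m, g x * (T x).length :=
      Finset.single_le_sum (f := fun x => g x * (T x).length) (fun _ _ => Nat.zero_le _)
        (Finset.mem_range.2 hx)
    have h3 : g x ≤ g x * (T x).length :=
      Nat.le_mul_of_pos_right _ (hI.length_pos x (by omega))
    rw [hL, h1]
    omega
  have hL0 : 0 < L := hL ▸ hI.length_pos _ (by omega)
  refine HT.forTo (fun k s₂ => (∀ x, s₂.a .OCC x ≤ L) ∧ ∀ f c, Additive s.inp n f c → f (n - 1) =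
      ∑ x ∈ Finset.range (n - k), s₂.a .OCC x * f x +
        ∑ x ∈ Finset.Ico (n - k) n, s₂.a .OCC x * c x) n 6 (by decide) (by decide)
    (by decide) hn (fun _ _ _ h => h) ⟨?_, ?_⟩ ?_ (by omega) ?_
  · intro x
    rw [hOcc₁, Function.update_apply, h0]
    split <;> omega
  · intro f c _
    simp only [Nat.sub_zero, Finset.Ico_self, Finset.sum_empty, add_zero]
    rw [Finset.sum_eq_single (n - 1)]
    · simp [hOcc₁]
    · intro b _ hb; rw [hOcc₁, Function.update_of_ne hb, h0, zero_mul]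
    · intro h; exact absurd (Finset.mem_range.2 (by omega)) h
  · rintro k hk s₂ hw₂ hF₂ hik ⟨hle, hinv⟩
    obtain ⟨j, hj⟩ : ∃ j, j = n - 1 - k := ⟨_, rfl⟩
    have hnk : n - k = j + 1 := by omega
    have hnk' : n - (k + 1) = j := by omega
    have hjn : j < n := by omega
    have hn₂ : s₂.v .n = n := (hF₂.v _ (by decide)).trans hn
    have hinp : s₂.inp = s.inp := hF₂.inp
    have hIj := hI.spec j hjn
    have hib := hw.inp_lt
    rw [hnk] at hinv
    have hv : ∀ x, s₂.a .OCC x ≤ L := hle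
    simp only [hnk']
    have hnew : ∀ g : ℕ → ℕ, (∀ x, j ≤ x → g x = s₂.a .OCC x) →
        (∀ f c, Additive s.inp n f c → f (n - 1) =
          ∑ x ∈ Finset.range j, g x * f x + ∑ x ∈ Finset.Ico j n, g x * c x) →
        (∀ x, g x ≤ L) := by
      intro g hg h x
      rcases lt_or_ge x j with hx | hx
      · exact hbd j g (by omega) h x hx
      · rw [hg x hx]; exact hle x
    rcases hIj with ⟨e, -, -⟩ | ⟨e, hl, hr, -⟩
    · refine .straight (fun _ => ?_) le_rfl fun _ => ?_
      · simp [Cmd.Safe, Cmd.run, hn₂, hik, ← hj, hinp, e]; omega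
      · simp [Cmd.run, hn₂, hik, ← hj, hinp, e]
        refine ⟨hle, fun f c hfc => ?_⟩
        rw [hinv f c hfc, Finset.sum_range_succ, Finset.sum_eq_sum_Ico_succ_bot hjn]
        have := hfc j hjn
        rw [if_pos e] at this
        rw [this]; ring
    · have hj0 := hle j
      have hL2 : ∀ x, s₂.a .OCC x ≤ L := hle
      set l := s.inp (3 + 3 * j) with hl'
      set r := s.inp (4 + 3 * j) with hr'
      set g := Function.update (s₂.a .OCC) l (s₂.a .OCC l + s₂.a .OCC j) with hg
      have hgj : g j = s₂.a .OCC j := Function.update_of_ne (by omega) _ _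
      set g' := Function.update g r (g r + s₂.a .OCC j) with hg'
      have hge : ∀ x, j ≤ x → g' x = s₂.a .OCC x := fun x hx => by
        rw [hg', Function.update_of_ne (by omega), hg, Function.update_of_ne (by omega)]
      have hinv' : ∀ f c, Additive s.inp n f c → f (n - 1) =
          ∑ x ∈ Finset.range j, g' x * f x + ∑ x ∈ Finset.Ico j n, g' x * c x := by
        intro f c hfc
        have h1 : ∑ x ∈ Finset.Ico j n, g' x * c x =
            ∑ x ∈ Finset.Ico j n, s₂.a .OCC x * c x :=
          Finset.sum_congr rfl fun x hx => by rw [hge x (Finset.mem_Ico.1 hx).1]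
        rw [h1, hg', sum_update_add _ _ hr, hg, sum_update_add _ _ hl, hinv f c hfc,
          Finset.sum_range_succ, Finset.sum_eq_sum_Ico_succ_bot hjn]
        have := hfc j hjn
        rw [if_neg (by omega), ← hl', ← hr'] at this
        rw [this]; ring
      have hle' := hnew g' hge hinv'
      have hgl : g r ≤ L := by
        refine le_trans ?_ (hle' r)
        rw [hg', Function.update_self]; omega
      refine .straight (fun _ => ?_) le_rfl fun _ => ?_
      · simp only [Cmd.Safe, Cmd.run]
        simp [hn₂, hik, ← hj, hinp, e, ← hl', ← hr', ← hg, hgj]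
        have := hle l
        omega
      · simp only [Cmd.run]
        simp [hn₂, hik, ← hj, hinp, e, ← hl', ← hr', ← hg, hgj, ← hg']
        exact ⟨hle', hinv'⟩
  · rintro s₂ hw₂ hF₂ ⟨hle, hinv⟩
    refine ⟨hle, fun f c hfc => ?_⟩
    rw [hinv f c hfc, Nat.sub_self]
    simp

open Cmd QGram.Expr in
/-- Computes the first and, in reverse order, the last `q - 1` letters of the strings derived from
the variables. -/
def borders : Cmd :=
  forTo .i .n (
    .ite (.eq (inp (2 + 3 * var .i)) 0)
      (.ite (.lt 1 (var .q))
        (put .PL (var .i) 1 ;; put .PRE (var .i * var .q) (inp (3 + 3 * var .i)) ;;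
          put .SUF (var .i * var .q) (inp (3 + 3 * var .i)))
        (put .PL (var .i) 0))
      ((assign .l (inp (3 + 3 * var .i)) ;; assign .r (inp (4 + 3 * var .i)) ;;
        assign .ll (get .PL (var .l)) ;; assign .lr (get .PL (var .r)) ;;
        assign .w (var .ll + var .lr) ;;
        .ite (.lt (var .q - 1) (var .w)) (assign .w (var .q - 1)) .skip ;;
        put .PL (var .i) (var .w)) ;;
      forTo .o .w (
        .ite (.lt (var .o) (var .ll))
          (put .PRE (var .i * var .q + var .o) (get .PRE (var .l * var .q + var .o)))
          (put .PRE (var .i * var .q + var .o)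
            (get .PRE (var .r * var .q + (var .o - var .ll)))) ;;
        .ite (.lt (var .o) (var .lr))
          (put .SUF (var .i * var .q + var .o) (get .SUF (var .r * var .q + var .o)))
          (put .SUF (var .i * var .q + var .o)
            (get .SUF (var .l * var .q + (var .o - var .lr)))))))

/-- The first `min q' |u|` letters of `u` stand in `p` from address `a` on. -/
def Prefix (q' : ℕ) (u : List ℕ) (p : ℕ → ℕ) (a : ℕ) : Prop :=
  ∀ o < min q' u.length, u[o]? = some (p (a + o))

/-- The first letters of `u ++ v` are obtained from those of `u` and `v`. -/
theorem Prefix.append {q' : ℕ} {u v : List ℕ} {p p' : ℕ → ℕ} {a b c : ℕ} (hu : Prefix q' u p a)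
    (hv : Prefix q' v p b)
    (h : ∀ o < min q' (min q' u.length + min q' v.length), p' (c + o) =
      if o < min q' u.length then p (a + o) else p (b + (o - min q' u.length))) :
    Prefix q' (u ++ v) p' c := by
  intro o ho
  rw [List.length_append] at ho
  rw [h o (by omega)]
  split_ifs with h1
  · rw [List.getElem?_append_left (by omega), hu o h1]
  · rw [List.getElem?_append_right (by omega), show min q' u.length = u.length by omega,
      hv _ (by omega)]

theorem Prefix.congr {q' : ℕ} {u : List ℕ} {p p' : ℕ → ℕ} {a : ℕ} (hu : Prefix q' u p a)
    (h : ∀ o < q', p' (a + o) = p (a + o)) : Prefix q' u p' a := fun o ho => by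
  rw [hu o ho, h o (by omega)]

theorem block_lt {i k q o : ℕ} (hik : i < k) (ho : o < q) : i * q + o < k * q := by
  have := Nat.mul_le_mul_right q (Nat.succ_le_of_lt hik)
  rw [Nat.succ_mul] at this
  omega

theorem borders_spec {s : HState} {n q σ : ℕ} {T : ℕ → List ℕ} (hBS : 16 * S + 64 ≤ B)
    (hn : s.v .n = n) (hq : s.v .q = q) (hq0 : 0 < q) (hnS : n ≤ S) (hqS : 2 * q ≤ S)
    (hnq : n * q ≤ S) (hI : Input s.inp n σ T) (hσ0 : 0 < σ)
    (h1 : ∀ i, s.a .PRE i = 0) (h2 : ∀ i, s.a .SUF i = 0) :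
    HT B S borders s (6 * (n * q) + 20 * n + 10) (fun s' =>
      (∀ i < n, s'.a .PL i = min (q - 1) (T i).length) ∧
      (∀ i, s'.a .PRE i < σ) ∧ (∀ i, s'.a .SUF i < σ) ∧
      (∀ i < n, Prefix (q - 1) (T i) (s'.a .PRE) (i * q)) ∧
      ∀ i < n, Prefix (q - 1) (T i).reverse (s'.a .SUF) (i * q)) := by
  refine HT.of_wf fun hw => ?_
  refine HT.forTo (fun k s' => (∀ i < k, s'.a .PL i = min (q - 1) (T i).length) ∧
      (∀ i, s'.a .PRE i < σ) ∧ (∀ i, s'.a .SUF i < σ) ∧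
      (∀ i < k, Prefix (q - 1) (T i) (s'.a .PRE) (i * q)) ∧
      ∀ i < k, Prefix (q - 1) (T i).reverse (s'.a .SUF) (i * q)) n (6 * q + 12) (by decide)
    (by decide) (by decide) hn (fun _ _ _ h => h)
    ⟨by simp, by simpa [h1] using hσ0, by simpa [h2] using hσ0, by simp, by simp⟩ ?_ ?_
    (fun _ _ _ h => h)
  · rintro k hk s₁ hw₁ hF₁ hik ⟨hPL, hPσ, hSσ, hP, hS⟩
    have hq₁ : s₁.v .q = q := (hF₁.v _ (by decide)).trans hq
    have hinp : s₁.inp = s.inp := hF₁.inp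
    have hib := hw.inp_lt
    have hkq : ∀ o < q, k * q + o < S := fun o ho => (block_lt hk ho).trans_le hnq
    rcases hI.spec k hk with ⟨e, hlσ, eT⟩ | ⟨e, hl, hr, eT⟩
    · refine HT.ite (T₁ := 6 * q + 11) (fun _ => ?_) (fun h => absurd (by simp [hik, hinp, e]) h)
        (by omega)
      have hnew : ∀ f : ℕ → ℕ, (∀ i, f i < σ) →
          ∀ i, Function.update f (k * q) (s.inp (3 + 3 * k)) i < σ := fun f hf i => by
        rw [Function.update_apply]; split_ifs <;> simp [hf, hlσ]
      have hlen : (T k).length = 1 := by simp [eT]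
      rcases Nat.lt_or_ge 1 q with h | h
      · refine .straight (fun hw => ?_) (by simp [Cmd.cost]) fun _ => ?_
        · simp [Cmd.Safe, Cmd.run, hik, hinp, hq₁, h, hib]
          have := hkq 0 hq0
          omega
        · simp only [Cmd.run]
          simp [hik, hinp, hq₁, h]
          have hother : ∀ f : ℕ → ℕ, ∀ i < k, ∀ o < q - 1,
              Function.update f (k * q) (s.inp (3 + 3 * k)) (i * q + o) = f (i * q + o) :=
            fun f i hi o ho => Function.update_of_ne
              (block_lt (q := q) (o := o) hi (by omega)).ne _ _
          refine ⟨fun i hi => ?_, hnew _ hPσ, hnew _ hSσ, fun i hi => ?_, fun i hi => ?_⟩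
          all_goals rcases (show i < k ∨ i = k by omega) with hi | rfl
          · rw [Function.update_of_ne hi.ne, hPL i hi]
          · simp [hlen]; omega
          · exact (hP i hi).congr (hother _ i hi)
          · intro o ho
            obtain rfl : o = 0 := by omega
            simp [eT]
          · exact (hS i hi).congr (hother _ i hi)
          · intro o ho
            rw [List.length_reverse] at ho
            obtain rfl : o = 0 := by omega
            simp [eT]
      · obtain rfl : q = 1 := by omega
        refine .straight (fun hw => ?_) (by simp [Cmd.cost]) fun _ => ?_
        · simp [Cmd.Safe, Cmd.run, hik, hq₁]
          omega
        · simp only [Cmd.run]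
          simp [hik, hq₁]
          refine ⟨fun i hi => ?_, hPσ, hSσ, fun i hi => ?_, fun i hi => ?_⟩
          · rcases (show i < k ∨ i = k by omega) with hi | rfl
            · rw [Function.update_of_ne hi.ne, hPL i hi]; simp
            · simp
          all_goals exact fun o ho => absurd ho (by simp)
    · refine HT.ite (T₁ := 6 * q + 11) (fun h => absurd h (by simp [hik, hinp, e])) (fun _ => ?_)
        (by omega)
      set l := s.inp (3 + 3 * k) with hl'
      set r := s.inp (4 + 3 * k) with hr'
      obtain ⟨w, hw'⟩ : ∃ w, w = min (q - 1) (min (q - 1) (T l).length + min (q - 1) (T r).length) :=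
        ⟨_, rfl⟩
      have hwk : w = min (q - 1) (T k).length := by rw [eT, List.length_append]; omega
      have hqB : q < B := by omega
      refine HT.seq 8 (6 * q + 3) (R := fun s₂ => s₂.v .l = l ∧ s₂.v .r = r ∧
        s₂.v .ll = min (q - 1) (T l).length ∧ s₂.v .lr = min (q - 1) (T r).length ∧
        s₂.v .w = w ∧ s₂.a .PL = Function.update (s₁.a .PL) k w)
        (.straight (fun _ => ?_) (by simp [Cmd.cost]) fun _ => ?_) ?_ (by omega)
      · have := hib (3 + 3 * k)
        have := hib (4 + 3 * k)
        simp only [Cmd.Safe, Cmd.run]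
        by_cases c1 : q - 1 < min (q - 1) (T l).length + min (q - 1) (T r).length <;>
          simp [hik, hinp, hq₁, ← hl', ← hr', hPL l hl, hPL r hr, c1] <;> omega
      · simp only [Cmd.run]
        by_cases c1 : q - 1 < min (q - 1) (T l).length + min (q - 1) (T r).length <;>
          simp [hik, hinp, hq₁, ← hl', ← hr', hPL l hl, hPL r hr, c1]
        · obtain rfl : w = q - 1 := by omega
          simp
        · obtain rfl : w = min (q - 1) (T l).length + min (q - 1) (T r).length := by omega
          simp
      rintro s₂ hw₂ hF₂ ⟨el, er, ell, elr, ew, ePL⟩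
      have hi₂ : s₂.v .i = k := (hF₂.v _ (by decide)).trans hik
      have hq₂ : s₂.v .q = q := (hF₂.v _ (by decide)).trans hq₁
      have hP₂ : s₂.a .PRE = s₁.a .PRE := hF₂.a _ (by decide)
      have hS₂ : s₂.a .SUF = s₁.a .SUF := hF₂.a _ (by decide)
      set lu := min (q - 1) (T l).length with hlu
      set lv := min (q - 1) (T r).length with hlv
      -- the state of an output array before the letter with index `m` is written
      let J (p p' : ℕ → ℕ) (a b c m : ℕ) : Prop := (∀ i, p' i < σ) ∧ (∀ i < k * q, p' i = p i) ∧
        ∀ o < m, p' (k * q + o) = if o < c then p (a * q + o) else p (b * q + (o - c))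
      have hJ : ∀ (p p' : ℕ → ℕ) (a b c m v : ℕ), J p p' a b c m → v < σ →
          v = (if m < c then p (a * q + m) else p (b * q + (m - c))) →
          J p (Function.update p' (k * q + m) v) a b c (m + 1) := by
        rintro p p' a b c m v ⟨h1, h2, h3⟩ hv ev
        refine ⟨fun i => ?_, fun i hi => ?_, fun o ho => ?_⟩
        · rw [Function.update_apply]; split_ifs <;> simp [h1, hv]
        · rw [Function.update_of_ne (by omega), h2 i hi]
        · rcases Nat.lt_succ_iff_lt_or_eq.1 ho with h | rfl
          · rw [Function.update_of_ne (by omega), h3 o h]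
          · rw [Function.update_self, ev]
      refine HT.forTo (fun m s₃ => J (s₁.a .PRE) (s₃.a .PRE) l r lu m ∧
        J (s₁.a .SUF) (s₃.a .SUF) r l lv m) w 4 (by decide) (by decide) (by decide) ew
        (fun _ _ _ h => h) ⟨⟨?_, ?_, ?_⟩, ?_, ?_, ?_⟩ ?_ (by omega) ?_
      · rw [hP₂]; exact hPσ
      · rw [hP₂]; exact fun _ _ => rfl
      · simp
      · rw [hS₂]; exact hSσ
      · rw [hS₂]; exact fun _ _ => rfl
      · simp
      · rintro m hm s₃ hw₃ hF₃ hom ⟨hJP, hJS⟩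
        have hi₃ : s₃.v .i = k := (hF₃.v _ (by decide)).trans hi₂
        have hq₃ : s₃.v .q = q := (hF₃.v _ (by decide)).trans hq₂
        have hl₃ : s₃.v .l = l := (hF₃.v _ (by decide)).trans el
        have hr₃ : s₃.v .r = r := (hF₃.v _ (by decide)).trans er
        have hll₃ : s₃.v .ll = lu := (hF₃.v _ (by decide)).trans ell
        have hlr₃ : s₃.v .lr = lv := (hF₃.v _ (by decide)).trans elr
        have hmS := hkq m (by omega)
        have hab := hw₃.a_lt
        have hlm : ∀ o < q, l * q + o < k * q := fun o ho => block_lt hl ho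
        have hrm : ∀ o < q, r * q + o < k * q := fun o ho => block_lt hr ho
        refine .straight (fun _ => ?_) (by simp [Cmd.cost]) fun _ => ?_
        · simp only [Cmd.Safe, Cmd.run]
          by_cases c1 : m < lu <;> by_cases c2 : m < lv <;>
            simp [hi₃, hq₃, hom, hl₃, hr₃, hll₃, hlr₃, hmS, hab, c1, c2]
        · have hPe := hJP.2.1
          have hSe := hJS.2.1
          have h1 := hJ _ _ _ _ _ _ (v :=  if m < lu then s₃.a .PRE (l * q + m) else
            s₃.a .PRE (r * q + (m - lu))) hJP (by split_ifs <;> exact hJP.1 _)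
            (by rw [hPe _ (hlm m (by omega)), hPe _ (hrm _ (by omega))])
          have h2 := hJ _ _ _ _ _ _ (v :=  if m < lv then s₃.a .SUF (r * q + m) else
            s₃.a .SUF (l * q + (m - lv))) hJS (by split_ifs <;> exact hJS.1 _)
            (by rw [hSe _ (hrm m (by omega)), hSe _ (hlm _ (by omega))])
          simp only [Cmd.run]
          by_cases c1 : m < lu <;> by_cases c2 : m < lv <;>
            simp [hi₃, hq₃, hom, hl₃, hr₃, hll₃, hlr₃, c1, c2] <;>
            simp only [c1, c2, if_true, if_false] at h1 h2 <;> exact ⟨h1, h2⟩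
      · rintro s₃ hw₃ hF₃ ⟨⟨hP1, hP2, hP3⟩, hS1, hS2, hS3⟩
        have ePL₃ : s₃.a .PL = Function.update (s₁.a .PL) k w :=
          (hF₃.a _ (by decide)).trans ePL
        refine ⟨fun i hi => ?_, hP1, hS1, fun i hi => ?_, fun i hi => ?_⟩
        all_goals rcases (show i < k ∨ i = k by omega) with hi | rfl
        · rw [ePL₃, Function.update_of_ne hi.ne, hPL i hi]
        · rw [ePL₃, Function.update_self, hwk]
        · exact (hP i hi).congr fun o ho => hP2 _ (block_lt hi (by omega))
        · rw [eT]
          exact (hP l hl).append (hP r hr) fun o ho => hP3 o (by omega)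
        · exact (hS i hi).congr fun o ho => hS2 _ (block_lt hi (by omega))
        · rw [eT, List.reverse_append]
          refine (hS r hr).append (hS l hl) fun o ho => ?_
          rw [List.length_reverse, List.length_reverse] at ho
          rw [List.length_reverse]
          exact hS3 o (by omega)
  · have : n * (6 * q + 12 + 2) = 6 * (n * q) + 14 * n := by ring
    omega

open Cmd QGram.Expr in
/-- Writes the window of the variable `i` into the array `Z`, around position `q - 1` of the block
that starts at `p`; the window then extends from position `st` to position `en` of the block. -/
def placeWindow : Cmd :=
  .ite (.eq (inp (2 + 3 * var .i)) 0)
    (put .Z (var .p + (var .q - 1)) (inp (3 + 3 * var .i)) ;;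
      assign .st (var .q - 1) ;; assign .en (var .q))
    ((assign .l (inp (3 + 3 * var .i)) ;; assign .r (inp (4 + 3 * var .i)) ;;
        assign .ll (get .PL (var .l)) ;; assign .lr (get .PL (var .r)) ;;
        assign .st (var .q - 1 - var .ll) ;; assign .en (var .q - 1 + var .lr)) ;;
      forTo .o .ll (put .Z (var .p + (var .q - 1 - (var .o + 1)))
        (get .SUF (var .l * var .q + var .o))) ;;
      forTo .o .lr (put .Z (var .p + (var .q - 1 + var .o))
        (get .PRE (var .r * var .q + var .o))))

open Cmd QGram.Expr in
/-- Writes the windows of all variables into the array `Z`, one block of length `2 * q` for each,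
and gives every position of `Z` as weight the number of occurrences of the variable in the
derivation tree, provided that the `q`-gram at this position lies in the window. -/
def windows : Cmd :=
  forTo .i .n (
    assign .p (var .i * (2 * var .q)) ;;
    placeWindow ;;
    assign .w (2 * var .q) ;;
    forTo .o .w (
      .ite (.lt (var .o) (var .st)) .skip
        (.ite (.lt (var .en) (var .o + var .q)) .skip
          (put .WT (var .p + var .o) (get .OCC (var .i))))))

/-- The part of the string derived from the variable `i` that contains the `q`-grams which cross
the boundary between its two factors; for a letter, the string itself. -/
def window (inp : ℕ → ℕ) (T : ℕ → List ℕ) (q i : ℕ) : List ℕ :=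
  if inp (2 + 3 * i) = 0 then T i else
    (T (inp (3 + 3 * i))).drop ((T (inp (3 + 3 * i))).length - (q - 1)) ++
      (T (inp (4 + 3 * i))).take (q - 1)

theorem getElem?_last_reverse {u v : List ℕ} {m o : ℕ} (ho : o < min m u.length) :
    (u.drop (u.length - m) ++ v)[o]? = u.reverse[min m u.length - 1 - o]? := by
  rw [List.getElem?_append_left (by rw [List.length_drop]; omega), List.getElem?_drop,
    List.getElem?_reverse (by omega)]
  congr 1; omega

theorem getElem?_last_append_take {u v : List ℕ} {m o : ℕ} (ho : o < min m v.length) :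
    (u.drop (u.length - m) ++ v.take m)[min m u.length + o]? = v[o]? := by
  have : (u.drop (u.length - m)).length = min m u.length := by rw [List.length_drop]; omega
  rw [List.getElem?_append_right (by omega), this, List.getElem?_take, if_pos (by omega)]
  congr 1; omega

theorem placeWindow_spec {s : HState} {n q σ k : ℕ} {T : ℕ → List ℕ} (hBS : 16 * S + 64 ≤ B)
    (hk : k < n) (hi : s.v .i = k) (hq : s.v .q = q) (hp : s.v .p = k * (2 * q)) (hq0 : 0 < q)
    (hqS : 2 * q ≤ S) (hnq : n * (2 * q) ≤ S) (hI : Input s.inp n σ T)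
    (hPL : ∀ i < n, s.a .PL i = min (q - 1) (T i).length)
    (hPσ : ∀ i, s.a .PRE i < σ) (hSσ : ∀ i, s.a .SUF i < σ)
    (hP : ∀ i < n, Prefix (q - 1) (T i) (s.a .PRE) (i * q))
    (hS : ∀ i < n, Prefix (q - 1) (T i).reverse (s.a .SUF) (i * q))
    (hZ : ∀ i, s.a .Z i < σ) :
    HT B S placeWindow s (6 * q + 11) (fun s' => (∀ i, s'.a .Z i < σ) ∧
      (∀ i < k * (2 * q), s'.a .Z i = s.a .Z i) ∧
      s'.v .st + (window s.inp T q k).length = s'.v .en ∧ s'.v .en ≤ 2 * q ∧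
      ∀ o < (window s.inp T q k).length,
        (window s.inp T q k)[o]? = some (s'.a .Z (k * (2 * q) + (s'.v .st + o)))) := by
  refine HT.of_wf fun hw => ?_
  have hib := hw.inp_lt
  have hqB : 2 * q < B := by omega
  have hkq : ∀ o < 2 * q, k * (2 * q) + o < S := fun o ho => (block_lt hk ho).trans_le hnq
  rcases hI.spec k hk with ⟨e, hlσ, eT⟩ | ⟨e, hl, hr, eT⟩
  · have ew : window s.inp T q k = [s.inp (3 + 3 * k)] := by rw [window, if_pos e, eT]
    refine HT.ite (T₁ := 6 * q + 10) (fun _ => ?_) (fun h => absurd (by simp [hi, e]) h) (by omega)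
    refine .straight (fun hw => ?_) (by simp [Cmd.cost]) fun _ => ?_
    · have := hkq (q - 1) (by omega)
      have := hib (3 + 3 * k)
      simp [Cmd.Safe, Cmd.run, hi, hq, hp]
      omega
    · simp only [Cmd.run]
      simp [hi, hq, hp, ew]
      refine ⟨fun i => ?_, fun i hi => ?_, by omega, by omega⟩
      · rw [Function.update_apply]; split_ifs <;> simp [hZ, hlσ]
      · rw [Function.update_of_ne (by omega)]
  · refine HT.ite (T₁ := 6 * q + 10) (fun h => absurd h (by simp [hi, e])) (fun _ => ?_) (by omega)
    set l := s.inp (3 + 3 * k) with hl'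
    set r := s.inp (4 + 3 * k) with hr'
    have ew : window s.inp T q k = (T l).drop ((T l).length - (q - 1)) ++ (T r).take (q - 1) := by
      rw [window, if_neg (by omega)]
    have hPLl := hPL l (by omega)
    have hPLr := hPL r (by omega)
    have hlen : (window s.inp T q k).length = min (q - 1) (T l).length + min (q - 1) (T r).length := by
      rw [ew, List.length_append, List.length_drop, List.length_take]; omega
    have hget1 : ∀ o < min (q - 1) (T l).length, (window s.inp T q k)[o]? =
        some (s.a .SUF (l * q + (min (q - 1) (T l).length - 1 - o))) := fun o ho => by
      rw [ew, getElem?_last_reverse ho]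
      exact hS l (by omega) _ (by rw [List.length_reverse]; omega)
    have hget2 : ∀ o < min (q - 1) (T r).length, (window s.inp T q k)[min (q - 1) (T l).length + o]? =
        some (s.a .PRE (r * q + o)) := fun o ho => by
      rw [ew, getElem?_last_append_take ho]
      exact hP r (by omega) o ho
    generalize window s.inp T q k = win at *
    set lu := min (q - 1) (T l).length with hlu
    set lv := min (q - 1) (T r).length with hlv
    refine HT.seq 6 (6 * q + 4) (R := fun s₁ => s₁.v .l = l ∧ s₁.v .r = r ∧ s₁.v .ll = lu ∧
      s₁.v .lr = lv ∧ s₁.v .st = q - 1 - lu ∧ s₁.v .en = q - 1 + lv)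
      (.straight (fun _ => ?_) (by simp [Cmd.cost]) fun _ => ?_) ?_ (by omega)
    · have := hib (3 + 3 * k)
      have := hib (4 + 3 * k)
      simp [Cmd.Safe, Cmd.run, hi, hq, ← hl', ← hr', hPLl, hPLr]
      omega
    · simp [Cmd.run, hi, hq, ← hl', ← hr', hPLl, hPLr]
    rintro s₁ hw₁ hF₁ ⟨el, er, ell, elr, est, een⟩
    have hq₁ : s₁.v .q = q := (hF₁.v _ (by decide)).trans hq
    have hp₁ : s₁.v .p = k * (2 * q) := (hF₁.v _ (by decide)).trans hp
    have eZ₁ : s₁.a .Z = s.a .Z := hF₁.a _ (by decide)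
    have eS₁ : s₁.a .SUF = s.a .SUF := hF₁.a _ (by decide)
    have eP₁ : s₁.a .PRE = s.a .PRE := hF₁.a _ (by decide)
    refine HT.seq (3 * lu + 2) (3 * lv + 2) (R := fun s₂ => (∀ i, s₂.a .Z i < σ) ∧
      (∀ i < k * (2 * q), s₂.a .Z i = s.a .Z i) ∧ ∀ o < lu,
        s₂.a .Z (k * (2 * q) + (q - 1 - (o + 1))) = s.a .SUF (l * q + o)) ?_ ?_ (by omega)
    · refine HT.forTo (fun m s₂ => (∀ i, s₂.a .Z i < σ) ∧
        (∀ i < k * (2 * q), s₂.a .Z i = s.a .Z i) ∧ ∀ o < m,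
          s₂.a .Z (k * (2 * q) + (q - 1 - (o + 1))) = s.a .SUF (l * q + o)) lu 1 (by decide)
        (by decide) (by decide) ell (fun _ _ _ h => h)
        ⟨by simpa [eZ₁] using hZ, by simp [eZ₁], by simp⟩ ?_ (by omega) (fun _ _ _ h => h)
      rintro m hm s₂ hw₂ hF₂ hom ⟨h1, h2, h3⟩
      have hq₂ : s₂.v .q = q := (hF₂.v _ (by decide)).trans hq₁
      have hp₂ : s₂.v .p = k * (2 * q) := (hF₂.v _ (by decide)).trans hp₁
      have hl₂ : s₂.v .l = l := (hF₂.v _ (by decide)).trans el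
      have eS₂ : s₂.a .SUF = s.a .SUF := (hF₂.a _ (by decide)).trans eS₁
      refine .straight (fun hw => ?_) le_rfl fun _ => ?_
      · simp [Cmd.Safe, hq₂, hp₂, hl₂, hom, hw₂.a_lt]
        exact hkq _ (by omega)
      · simp [Cmd.run, hq₂, hp₂, hl₂, hom, eS₂]
        refine ⟨fun i => ?_, fun i hi => ?_, fun o ho => ?_⟩
        · rw [Function.update_apply]; split_ifs <;> simp [h1, hSσ]
        · rw [Function.update_of_ne (by omega), h2 i hi]
        · rcases (show o < m ∨ o = m by omega) with h | rfl
          · rw [Function.update_of_ne (by omega), h3 o h]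
          · rw [Function.update_self]
    rintro s₂ hw₂ hF₂ ⟨h1, h2, h3⟩
    have hq₂ : s₂.v .q = q := (hF₂.v _ (by decide)).trans hq₁
    have hp₂ : s₂.v .p = k * (2 * q) := (hF₂.v _ (by decide)).trans hp₁
    have hr₂ : s₂.v .r = r := (hF₂.v _ (by decide)).trans er
    have hlr₂ : s₂.v .lr = lv := (hF₂.v _ (by decide)).trans elr
    have est₂ : s₂.v .st = q - 1 - lu := (hF₂.v _ (by decide)).trans est
    have een₂ : s₂.v .en = q - 1 + lv := (hF₂.v _ (by decide)).trans een
    have eP₂ : s₂.a .PRE = s.a .PRE := (hF₂.a _ (by decide)).trans eP₁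
    refine HT.forTo (fun m s₃ => (∀ i, s₃.a .Z i < σ) ∧
        (∀ i < k * (2 * q) + (q - 1), s₃.a .Z i = s₂.a .Z i) ∧ ∀ o < m,
          s₃.a .Z (k * (2 * q) + (q - 1 + o)) = s.a .PRE (r * q + o)) lv 1 (by decide)
        (by decide) (by decide) hlr₂ (fun _ _ _ h => h) ⟨h1, by simp, by simp⟩ ?_ (by omega) ?_
    · rintro m hm s₃ hw₃ hF₃ hom ⟨h1, h2, h3⟩
      have hq₃ : s₃.v .q = q := (hF₃.v _ (by decide)).trans hq₂
      have hp₃ : s₃.v .p = k * (2 * q) := (hF₃.v _ (by decide)).trans hp₂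
      have hr₃ : s₃.v .r = r := (hF₃.v _ (by decide)).trans hr₂
      have eP₃ : s₃.a .PRE = s.a .PRE := (hF₃.a _ (by decide)).trans eP₂
      refine .straight (fun hw => ?_) le_rfl fun _ => ?_
      · simp [Cmd.Safe, hq₃, hp₃, hr₃, hom, hw₃.a_lt]
        exact hkq _ (by omega)
      · simp [Cmd.run, hq₃, hp₃, hr₃, hom, eP₃]
        refine ⟨fun i => ?_, fun i hi => ?_, fun o ho => ?_⟩
        · rw [Function.update_apply]; split_ifs <;> simp [h1, hPσ]
        · rw [Function.update_of_ne (by omega), h2 i hi]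
        · rcases (show o < m ∨ o = m by omega) with h | rfl
          · rw [Function.update_of_ne (by omega), h3 o h]
          · rw [Function.update_self]
    · rintro s₃ hw₃ hF₃ ⟨g1, g2, g3⟩
      have est₃ : s₃.v .st = q - 1 - lu := (hF₃.v _ (by decide)).trans est₂
      have een₃ : s₃.v .en = q - 1 + lv := (hF₃.v _ (by decide)).trans een₂
      rw [est₃, een₃, hlen]
      refine ⟨g1, fun i hi => (g2 i (by omega)).trans (h2 i hi), by omega, by omega, fun o ho => ?_⟩
      rcases Nat.lt_or_ge o lu with h | h
      · rw [hget1 o h, g2 _ (by omega), ← h3 _ (by omega)]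
        congr 3; omega
      · obtain ⟨o', rfl⟩ := Nat.exists_eq_add_of_le h
        rw [hget2 o' (by omega), ← g3 o' (by omega)]
        congr 3; omega

theorem windows_spec {s : HState} {n q σ : ℕ} {T : ℕ → List ℕ} (hBS : 16 * S + 64 ≤ B)
    (hn : s.v .n = n) (hq : s.v .q = q) (hq0 : 0 < q)
    (hqS : 2 * q ≤ S) (hnq : n * (2 * q) ≤ S) (hI : Input s.inp n σ T) (hσ0 : 0 < σ)
    (hPL : ∀ i < n, s.a .PL i = min (q - 1) (T i).length)
    (hPσ : ∀ i, s.a .PRE i < σ) (hSσ : ∀ i, s.a .SUF i < σ)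
    (hP : ∀ i < n, Prefix (q - 1) (T i) (s.a .PRE) (i * q))
    (hS : ∀ i < n, Prefix (q - 1) (T i).reverse (s.a .SUF) (i * q))
    (hZ : ∀ i, s.a .Z i = 0) (hW : ∀ i, s.a .WT i = 0) :
    HT B S windows s (16 * (n * q) + 20 * n + 2) (fun s' => (∀ i, s'.a .Z i < σ) ∧
      ∀ i < n, ∃ st en, st + (window s.inp T q i).length = en ∧ en ≤ 2 * q ∧
        (∀ o < (window s.inp T q i).length,
          (window s.inp T q i)[o]? = some (s'.a .Z (i * (2 * q) + (st + o)))) ∧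
        ∀ o < 2 * q, s'.a .WT (i * (2 * q) + o) =
          if st ≤ o ∧ o + q ≤ en then s.a .OCC i else 0) := by
  refine HT.forTo (fun k s' => (∀ i, s'.a .Z i < σ) ∧ (∀ i, k * (2 * q) ≤ i → s'.a .WT i = 0) ∧
      ∀ i < k, ∃ st en, st + (window s.inp T q i).length = en ∧ en ≤ 2 * q ∧
        (∀ o < (window s.inp T q i).length,
          (window s.inp T q i)[o]? = some (s'.a .Z (i * (2 * q) + (st + o)))) ∧
        ∀ o < 2 * q, s'.a .WT (i * (2 * q) + o) =
          if st ≤ o ∧ o + q ≤ en then s.a .OCC i else 0) n (16 * q + 18) (by decide)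
    (by decide) (by decide) hn (fun _ _ _ h => h) ⟨by simpa [hZ] using hσ0, by simp [hW], by simp⟩
    ?_ ?_ (fun _ _ _ h => ⟨h.1, h.2.2⟩)
  · rintro k hk s₁ hw₁ hF₁ hik ⟨hZ₁, hW₁, hB₁⟩
    have hq₁ : s₁.v .q = q := (hF₁.v _ (by decide)).trans hq
    have hinp : s₁.inp = s.inp := hF₁.inp
    have hkS : ∀ o < 2 * q, k * (2 * q) + o < S := fun o ho => (block_lt hk ho).trans_le hnq
    have hk0 := hkS 0 (by omega)
    refine HT.seq 1 (16 * q + 17) (R := fun s₂ => s₂ = s₁.setVar .p (k * (2 * q)))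
      (.straight (fun _ => by simp [Cmd.Safe, hik, hq₁]; omega) le_rfl
        fun _ => by simp [Cmd.run, hik, hq₁]) ?_ (by omega)
    rintro s₂ hw₂ hF₂ es₂
    have hi₂ : s₂.v .i = k := (hF₂.v _ (by decide)).trans hik
    have hq₂ : s₂.v .q = q := (hF₂.v _ (by decide)).trans hq₁
    have hp₂ : s₂.v .p = k * (2 * q) := by simp [es₂]
    have ha : ∀ b, b ≠ Arr.Z → b ≠ .WT → s₂.a b = s.a b := fun b h1 h2 =>
      (hF₂.a b (by simp [Cmd.arrs])).trans
        (hF₁.a b (by simp [Cmd.arrs, Cmd.forTo, placeWindow]; tauto))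
    have eZ₂ : s₂.a .Z = s₁.a .Z := by simp [es₂]
    have eW₂ : s₂.a .WT = s₁.a .WT := by simp [es₂]
    have hinp₂ : s₂.inp = s.inp := hF₂.inp.trans hinp
    refine HT.seq _ (10 * q + 6) (placeWindow_spec (n := n) (σ := σ) (T := T) hBS hk hi₂ hq₂ hp₂ hq0 hqS hnq
      (by rwa [hinp₂]) (by rwa [ha _ (by decide) (by decide)])
      (by rwa [ha _ (by decide) (by decide)]) (by rwa [ha _ (by decide) (by decide)])
      (by rwa [ha _ (by decide) (by decide)]) (by rwa [ha _ (by decide) (by decide)])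
      (by rwa [eZ₂])) ?_ (by omega)
    rw [hinp₂]
    rintro s₃ hw₃ hF₃ ⟨hZ₃, hZ₃', hlen, hen, hget⟩
    generalize hst : s₃.v .st = st at *
    generalize hen' : s₃.v .en = en at *
    refine HT.seq 1 (10 * q + 5) (R := fun s₄ => s₄ = s₃.setVar .w (2 * q))
      (.straight (fun _ => ?_) le_rfl fun _ => ?_) ?_ (by omega)
    · have : s₃.v .q = q := (hF₃.v _ (by decide)).trans hq₂
      simp [Cmd.Safe, this]; omega
    · have : s₃.v .q = q := (hF₃.v _ (by decide)).trans hq₂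
      simp [Cmd.run, this]
    rintro s₄ hw₄ hF₄ es₄
    have hi₄ : s₄.v .i = k := ((hF₄.v _ (by decide)).trans (hF₃.v _ (by decide))).trans hi₂
    have hq₄ : s₄.v .q = q := ((hF₄.v _ (by decide)).trans (hF₃.v _ (by decide))).trans hq₂
    have hp₄ : s₄.v .p = k * (2 * q) := ((hF₄.v _ (by decide)).trans (hF₃.v _ (by decide))).trans hp₂
    have hst₄ : s₄.v .st = st := (hF₄.v _ (by decide)).trans hst
    have hen₄ : s₄.v .en = en := (hF₄.v _ (by decide)).trans hen'
    have hO₄ : s₄.a .OCC = s.a .OCC := ((hF₄.a _ (by decide)).trans (hF₃.a _ (by decide))).trans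
      (ha _ (by decide) (by decide))
    have hW₄ : s₄.a .WT = s₁.a .WT := ((hF₄.a _ (by decide)).trans (hF₃.a _ (by decide))).trans eW₂
    have hZ₄ : s₄.a .Z = s₃.a .Z := hF₄.a _ (by decide)
    refine HT.forTo (fun m s₅ => (∀ i < k * (2 * q), s₅.a .WT i = s₁.a .WT i) ∧
        (∀ i, k * (2 * q) + m ≤ i → s₅.a .WT i = 0) ∧ ∀ o < m, s₅.a .WT (k * (2 * q) + o) =
          if st ≤ o ∧ o + q ≤ en then s.a .OCC k else 0) (2 * q) 3 (by decide) (by decide)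
      (by decide) (by simp [es₄]) (fun _ _ _ h => h) ⟨by simp [hW₄], ?_, by simp⟩ ?_ (by omega) ?_
    · intro i hi; rw [hW₄, hW₁ i (by omega)]
    · rintro m hm s₅ hw₅ hF₅ hom ⟨h1, h2, h3⟩
      have hi₅ : s₅.v .i = k := (hF₅.v _ (by decide)).trans hi₄
      have hq₅ : s₅.v .q = q := (hF₅.v _ (by decide)).trans hq₄
      have hp₅ : s₅.v .p = k * (2 * q) := (hF₅.v _ (by decide)).trans hp₄
      have hst₅ : s₅.v .st = st := (hF₅.v _ (by decide)).trans hst₄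
      have hen₅ : s₅.v .en = en := (hF₅.v _ (by decide)).trans hen₄
      have hO₅ : s₅.a .OCC = s.a .OCC := (hF₅.a _ (by decide)).trans hO₄
      have hkm := hkS m hm
      -- the position `m` of the block keeps its weight `0` unless its `q`-gram lies in the window
      have hstep : ∀ f : ℕ → ℕ, f (k * (2 * q) + m) = (if st ≤ m ∧ m + q ≤ en then s.a .OCC k else 0) →
          (∀ i, i ≠ k * (2 * q) + m → f i = s₅.a .WT i) →
          (∀ i < k * (2 * q), f i = s₁.a .WT i) ∧ (∀ i, k * (2 * q) + (m + 1) ≤ i → f i = 0) ∧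
          ∀ o ≤ m, f (k * (2 * q) + o) = if st ≤ o ∧ o + q ≤ en then s.a .OCC k else 0 := by
        intro f hf hne
        refine ⟨fun i hi => ?_, fun i hi => ?_, fun o ho => ?_⟩
        · rw [hne i (by omega), h1 i hi]
        · rw [hne i (by omega), h2 i (by omega)]
        · rcases (show o < m ∨ o = m by omega) with h | rfl
          · rw [hne _ (by omega), h3 o h]
          · exact hf
      refine .straight (fun hw => ?_) (by simp [Cmd.cost]) fun _ => ?_
      · simp [Cmd.Safe, hi₅, hp₅, hst₅, hen₅, hom, hw₅.a_lt, hkm]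
      · by_cases c1 : m < st
        · simp only [Cmd.run]
          simp [hst₅, hom, c1]
          exact hstep _ (by rw [h2 _ (by omega), if_neg (by omega)]) (fun _ _ => rfl)
        by_cases c2 : en < m + q
        · simp only [Cmd.run]
          simp [hst₅, hen₅, hq₅, hom, c1, c2]
          exact hstep _ (by rw [h2 _ (by omega), if_neg (by omega)]) (fun _ _ => rfl)
        · simp only [Cmd.run]
          simp [hst₅, hen₅, hq₅, hi₅, hp₅, hO₅, hom, c1, c2]
          refine hstep _ ?_ fun i hi => Function.update_of_ne hi _ _
          rw [Function.update_self, if_pos (by omega)]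
    · rintro s₅ hw₅ hF₅ ⟨h1, h2, h3⟩
      have hZ₅ : s₅.a .Z = s₃.a .Z := (hF₅.a _ (by decide)).trans hZ₄
      rw [hZ₅]
      refine ⟨hZ₃, fun i hi => h2 i (by rw [Nat.succ_mul] at hi; omega), fun i hi => ?_⟩
      rcases (show i < k ∨ i = k by omega) with h | rfl
      · obtain ⟨st', en', e1, e2, e3, e4⟩ := hB₁ i h
        refine ⟨st', en', e1, e2, fun o ho => ?_, fun o ho => ?_⟩
        · rw [e3 o ho, hZ₃' _ (block_lt h (by omega)), eZ₂]
        · rw [h1 _ (block_lt h ho), e4 o ho]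
      · exact ⟨st, en, hlen, hen, hget, h3⟩
  · have : n * (16 * q + 18 + 2) = 16 * (n * q) + 20 * n := by ring
    omega

/-! ### Frequencies as sums of weights -/

/-- The `q`-gram of the array `z` at position `i`. -/
def gram (z : ℕ → ℕ) (q i : ℕ) : List ℕ := (List.range q).map fun t => z (i + t)

theorem gram_eq_iff {z : ℕ → ℕ} {q i : ℕ} {P : List ℕ} (hP : P.length = q) :
    gram z q i = P ↔ ∀ t < q, P[t]? = some (z (i + t)) := by
  subst hP
  constructor
  · intro h t ht
    conv_lhs => rw [← h]
    simp [gram, ht]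
  · intro h
    refine List.ext_getElem? fun t => ?_
    rcases lt_or_ge t P.length with ht | ht
    · rw [h t ht]; simp [gram, ht]
    · rw [List.getElem?_eq_none ht, List.getElem?_eq_none]; simpa [gram] using ht

theorem gram_eq_gram_iff {z : ℕ → ℕ} {q i j : ℕ} : gram z q i = gram z q j ↔ GramEq z q i j := by
  simp [gram, GramEq]

theorem drop_take_eq_gram {z : ℕ → ℕ} {q i N : ℕ} (h : i + q ≤ N) :
    (((List.range N).map z).drop i).take q = gram z q i := by
  refine List.ext_getElem? fun t => ?_
  rw [List.getElem?_take]
  split_ifs with ht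
  · simp [gram, ht, show i + t < N by omega]
  · rw [List.getElem?_eq_none]; simpa [gram] using ht

theorem sum_blocks (f : ℕ → ℕ) (n m : ℕ) : ∑ p ∈ Finset.range (n * m), f p =
    ∑ i ∈ Finset.range n, ∑ o ∈ Finset.range m, f (i * m + o) := by
  induction n with
  | zero => simp
  | succ n ih => rw [Nat.succ_mul, Finset.sum_range_add, ih, Finset.sum_range_succ]

/-- In the block of one window, the grams equal to `P` contribute `c` for each occurrence of `P` in the
window. -/
theorem sum_block_eq {z w : ℕ → ℕ} {win P : List ℕ} {q b st en m c : ℕ} (hq0 : 0 < q)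
    (hP : P.length = q) (hlen : st + win.length = en) (hen : en ≤ m)
    (hget : ∀ o < win.length, win[o]? = some (z (b + (st + o))))
    (hw : ∀ o < m, w (b + o) = if st ≤ o ∧ o + q ≤ en then c else 0) :
    ∑ o ∈ Finset.range m, (if gram z q (b + o) = P then w (b + o) else 0) =
      c * (occ win P).card := by
  have hmem : ∀ k, k ∈ occ win P ↔ k + q ≤ win.length ∧ gram z q (b + (st + k)) = P := by
    intro k
    constructor
    · intro h
      have h1 := occ_add_le (by omega) h
      refine ⟨by omega, (gram_eq_iff hP).2 fun t ht => ?_⟩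
      rw [← (mem_occ (by omega)).1 h t (by omega), hget _ (by omega)]
      congr 2; omega
    · rintro ⟨h1, h2⟩
      refine (mem_occ (by omega)).2 fun t ht => ?_
      rw [(gram_eq_iff hP).1 h2 t (by omega), hget _ (by omega)]
      congr 2; omega
  have himg : (Finset.range m).filter (fun o => (st ≤ o ∧ o + q ≤ en) ∧ gram z q (b + o) = P) =
      (occ win P).image (st + ·) := by
    ext o
    simp only [Finset.mem_filter, Finset.mem_range, Finset.mem_image, hmem]
    constructor
    · rintro ⟨h1, ⟨h2, h3⟩, h4⟩
      refine ⟨o - st, ⟨by omega, ?_⟩, by omega⟩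
      rwa [Nat.add_sub_cancel' h2]
    · rintro ⟨k, ⟨h1, h2⟩, rfl⟩
      exact ⟨by omega, ⟨by omega, by omega⟩, h2⟩
  rw [← Finset.card_image_of_injective (occ win P) (add_right_injective st), ← himg, mul_comm,
    ← smul_eq_mul, ← Finset.sum_const, Finset.sum_filter]
  refine Finset.sum_congr rfl fun o ho => ?_
  rw [hw o (Finset.mem_range.1 ho)]
  split_ifs <;> tauto

/-- The number of occurrences of `P` is additive up to the occurrences in the windows. -/
theorem Input.additive_card_occ {inp : ℕ → ℕ} {n σ : ℕ} {T : ℕ → List ℕ} (hI : Input inp n σ T)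
    {P : List ℕ} (hP : 0 < P.length) : Additive inp n (fun i => (occ (T i) P).card)
      (fun i => (occ (window inp T P.length i) P).card) := by
  intro i hi
  rcases hI.spec i hi with ⟨e, -, -⟩ | ⟨e, -, -, eT⟩
  · simp [window, e]
  · simp only [window, e, one_ne_zero, if_false]
    rw [eT, card_occ_append hP]

/-! ### Reporting the classes -/

open Cmd QGram.Expr in
/-- Adds up the weights of each class of positions and reports, for every class of positive weight,
its first position and its weight. -/
def report : Cmd :=
  assign .V (var .N + 1 - var .q) ;;
  forTo .i .V (assign .g (get .G (var .i)) ;;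
    put .FR (var .g) (get .FR (var .g) + get .WT (var .i))) ;;
  assign .cnt 0 ;;
  forTo .i .V (assign .g (get .G (var .i)) ;; assign .f (get .FR (var .g)) ;;
    .ite (.lt 0 (var .f))
      (put .OUT (2 * var .cnt) (var .i) ;; put .OUT (2 * var .cnt + 1) (var .f) ;;
        put .FR (var .g) 0 ;; assign .cnt (var .cnt + 1))
      .skip)

/-- The sum of the weights `w` over the first `V` positions that belong to the class `g`. -/
def classWeight (G w : ℕ → ℕ) (V g : ℕ) : ℕ := ∑ p ∈ Finset.range V, if G p = g then w p else 0

/-- The first positions of the classes of positive weight `tot`, among the positions below `k`. -/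
def leaders (G tot : ℕ → ℕ) (k : ℕ) : List ℕ :=
  (List.range k).filter fun i => (∀ j < i, G j ≠ G i) ∧ 0 < tot (G i)

theorem leaders_succ (G tot : ℕ → ℕ) (k : ℕ) : leaders G tot (k + 1) =
    leaders G tot k ++ if (∀ j < k, G j ≠ G k) ∧ 0 < tot (G k) then [k] else [] := by
  rw [leaders, List.range_succ, List.filter_append, ← leaders, List.filter_singleton]
  congr 1
  simp

theorem report_spec {s : HState} {N q L : ℕ} (hBS : 16 * S + 64 ≤ B) (hN : s.v .N = N)
    (hq : s.v .q = q) (hNS : 2 * N + 2 ≤ S) (hq0 : 0 < q) (hqN : q ≤ N)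
    (hG : ∀ i, s.a .G i < S) (hL : ∀ i < N, s.a .WT i ≤ L) (hLB : N * L < B)
    (hFR : ∀ i, s.a .FR i = 0) :
    HT B S report s (13 * N + 10) (fun s' => s'.v .cnt ≤ N ∧
      (List.range (s'.v .cnt)).map (fun m => (s'.a .OUT (2 * m), s'.a .OUT (2 * m + 1))) =
        (leaders (s.a .G) (classWeight (s.a .G) (s.a .WT) (N + 1 - q)) (N + 1 - q)).map
          fun i => (i, classWeight (s.a .G) (s.a .WT) (N + 1 - q) (s.a .G i))) := by
  obtain ⟨V, hV⟩ : ∃ V, V = N + 1 - q := ⟨_, rfl⟩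
  obtain ⟨G, hG'⟩ : ∃ G, G = s.a .G := ⟨_, rfl⟩
  obtain ⟨w, hw'⟩ : ∃ w, w = s.a .WT := ⟨_, rfl⟩
  rw [← hG', ← hw', ← hV]
  rw [← hG'] at hG
  rw [← hw'] at hL
  have hbd : ∀ k ≤ V, ∀ g, classWeight G w k g < B := by
    intro k hk g
    refine lt_of_le_of_lt ?_ hLB
    calc classWeight G w k g ≤ ∑ p ∈ Finset.range k, L := Finset.sum_le_sum fun p hp => by
            have := hL p (by have := Finset.mem_range.1 hp; omega)
            split_ifs <;> omega
      _ ≤ N * L := by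
            rw [Finset.sum_const, Finset.card_range, smul_eq_mul]
            exact Nat.mul_le_mul_right _ (by omega)
  refine HT.seq 1 (13 * N + 9) (R := fun s₁ => s₁ = s.setVar .V V)
    (.straight (fun _ => by simp [Cmd.Safe, hN, hq]; omega) le_rfl
      fun _ => by simp [Cmd.run, hN, hq, hV]) ?_ (by omega)
  rintro s₁ - - rfl
  refine HT.seq (4 * V + 2) (9 * V + 3) (R := fun s₂ => ∀ g, s₂.a .FR g = classWeight G w V g)
    ?_ ?_ (by omega)
  · refine HT.forTo (fun k s₂ => ∀ g, s₂.a .FR g = classWeight G w k g) V 2 (by decide)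
      (by decide) (by decide) (by simp) (fun _ _ _ h => h) (by simp [classWeight, hFR]) ?_ (by omega)
      (fun _ _ _ h => h)
    intro k hk s₂ hw₂ hF₂ hik hinv
    have hG₂ : s₂.a .G = G := (hF₂.a _ (by decide)).trans hG'.symm
    have hW₂ : s₂.a .WT = w := (hF₂.a _ (by decide)).trans hw'.symm
    have hsucc : ∀ g, classWeight G w (k + 1) g = classWeight G w k g + if G k = g then w k else 0 :=
      fun g => by rw [classWeight, Finset.sum_range_succ, ← classWeight]
    refine .straight (fun _ => ?_) le_rfl fun _ => ?_
    · have h1 := hbd (k + 1) hk (G k)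
      rw [hsucc, if_pos rfl] at h1
      have := hG k
      simp [Cmd.Safe, Cmd.run, hik, hG₂, hW₂, hinv, h1, this]
      omega
    · simp [Cmd.run, hik, hG₂, hW₂]
      intro g
      rw [hsucc, Function.update_apply, hinv, hinv]
      by_cases h : g = G k
      · subst h; simp
      · rw [if_neg h, if_neg (Ne.symm h), add_zero]
  rintro s₂ hw₂ hF₂ hinv
  have hV₂ : s₂.v .V = V := (hF₂.v _ (by decide)).trans (by simp)
  have hG₂ : s₂.a .G = G := (hF₂.a _ (by decide)).trans hG'.symm
  refine HT.seq 1 (9 * V + 2) (R := fun s₃ => s₃ = s₂.setVar .cnt 0)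
    (.straight (fun _ => by simp [Cmd.Safe]; omega) le_rfl fun _ => by simp [Cmd.run]) ?_ (by omega)
  rintro s₃ - - rfl
  set tot := classWeight G w V with htot
  refine HT.forTo (fun k s₄ => s₄.v .cnt ≤ k ∧
    (∀ g, s₄.a .FR g = if ∀ j < k, G j ≠ g then tot g else 0) ∧
    (List.range (s₄.v .cnt)).map (fun m => (s₄.a .OUT (2 * m), s₄.a .OUT (2 * m + 1))) =
      (leaders G tot k).map fun i => (i, tot (G i))) V 7 (by decide)
    (by decide) (by decide) (by simp [hV₂]) (fun _ _ _ h => by simpa using h)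
    ⟨by simp, by simp [hinv], by simp [leaders]⟩ ?_ (by omega)
    (fun _ _ _ h => ⟨by omega, h.2.2⟩)
  rintro k hk s₄ hw₄ hF₄ hik ⟨hcnt, hFR₄, hout⟩
  have hG₄ : s₄.a .G = G := (hF₄.a _ (by decide)).trans hG₂
  have hGk := hG k
  have hf := hw₄.a_lt .FR (G k)
  rw [leaders_succ]
  -- the entry `G k` of the counters is nonzero if and only if `k` is reported
  have hpos : 0 < s₄.a .FR (G k) ↔ (∀ j < k, G j ≠ G k) ∧ 0 < tot (G k) := by
    rw [hFR₄]
    split_ifs with h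
    · exact (and_iff_right h).symm
    · exact iff_of_false (lt_irrefl 0) fun h' => h h'.1
  refine .straight (fun _ => ?_) le_rfl fun _ => ?_
  · simp [Cmd.Safe, Cmd.run, hik, hG₄, hf]
    omega
  · by_cases hp : 0 < s₄.a .FR (G k)
    · have hfk : s₄.a .FR (G k) = tot (G k) := by rw [hFR₄, if_pos (hpos.1 hp).1]
      rw [if_pos (hpos.1 hp)]
      rw [hfk] at hp
      simp only [Cmd.run]
      simp [hik, hG₄, hp, hfk]
      refine ⟨hcnt, fun g => ?_, ?_⟩
      · rw [Function.update_apply]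
        by_cases h : g = G k
        · subst h
          rw [if_pos rfl, if_neg]
          intro h; exact h k le_rfl rfl
        · rw [if_neg h, hFR₄]
          congr 1
          refine propext ⟨fun h1 j hj => ?_, fun h1 j hj => h1 j hj.le⟩
          rcases hj.lt_or_eq with h2 | rfl
          · exact h1 j h2
          · exact Ne.symm h
      · rw [List.range_succ, List.map_append, ← hout]
        congr 1
        · refine List.map_congr_left fun m hm => ?_
          have := List.mem_range.1 hm
          rw [Function.update_of_ne (by omega), Function.update_of_ne (by omega),
            Function.update_of_ne (by omega), Function.update_of_ne (by omega)]
        · simp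
    · rw [if_neg fun h => hp (hpos.2 h)]
      simp only [Cmd.run]
      simp [hik, hG₄, hp]
      refine ⟨by omega, fun g => ?_, hout⟩
      rw [hFR₄]
      by_cases h : g = G k
      · subst h
        rw [hFR₄] at hp
        rw [if_neg (c := ∀ j ≤ k, G j ≠ G k) fun h => h k le_rfl rfl]
        omega
      · congr 1
        refine propext ⟨fun h1 j hj => ?_, fun h1 j hj => h1 j hj.le⟩
        rcases hj.lt_or_eq with h2 | rfl
        · exact h1 j h2
        · exact Ne.symm h

theorem representsFreqs_leaders {z G w : ℕ → ℕ} {q N : ℕ} {T : List ℕ} (hqN : q ≤ N)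
    (hG : ∀ i j, i + q ≤ N → j + q ≤ N → (G i = G j ↔ gram z q i = gram z q j))
    (hw : ∀ P : List ℕ, P.length = q → ∑ p ∈ Finset.range (N + 1 - q),
      (if gram z q p = P then w p else 0) = (occ T P).card) :
    RepresentsFreqs q T ((List.range N).map z)
      ((leaders G (classWeight G w (N + 1 - q)) (N + 1 - q)).map
        fun i => (i, classWeight G w (N + 1 - q) (G i))) := by
  have hgl : ∀ i, (gram z q i).length = q := fun i => by simp [gram]
  have htot : ∀ i, i + q ≤ N → classWeight G w (N + 1 - q) (G i) = (occ T (gram z q i)).card := by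
    intro i hi
    rw [← hw _ (hgl i)]
    refine Finset.sum_congr rfl fun p hp => ?_
    have := Finset.mem_range.1 hp
    simp only [hG p i (by omega) hi]
  have hmem : ∀ i, i ∈ leaders G (classWeight G w (N + 1 - q)) (N + 1 - q) ↔
      i + q ≤ N ∧ (∀ j < i, G j ≠ G i) ∧ 0 < (occ T (gram z q i)).card := by
    intro i
    simp only [leaders, List.mem_filter, List.mem_range, decide_eq_true_eq]
    constructor
    · rintro ⟨h1, h2, h3⟩
      rw [htot i (by omega)] at h3
      exact ⟨by omega, h2, h3⟩
    · rintro ⟨h1, h2, h3⟩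
      rw [htot i h1]
      exact ⟨by omega, h2, h3⟩
  constructor
  · rw [List.map_map]
    refine List.Nodup.map_on ?_ (List.nodup_range.filter _)
    intro i hi j hj h
    have hi := (hmem i).1 hi
    have hj := (hmem j).1 hj
    simp only [Function.comp, drop_take_eq_gram hi.1, drop_take_eq_gram hj.1] at h
    have hij := (hG i j hi.1 hj.1).2 h
    rcases lt_trichotomy i j with h1 | h1 | h1
    · exact absurd hij (hj.2.1 i h1)
    · exact h1
    · exact absurd hij.symm (hi.2.1 j h1)
  · intro P f
    simp only [List.map_map, List.mem_map, Function.comp, Prod.mk.injEq, hmem]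
    constructor
    · rintro ⟨i, ⟨h1, h2, h3⟩, rfl, rfl⟩
      rw [drop_take_eq_gram h1, htot i h1]
      exact ⟨hgl i, Finset.card_pos.1 h3, rfl⟩
    · rintro ⟨h1, h2, rfl⟩
      have h3 := Finset.card_pos.2 h2
      rw [← hw P h1] at h3
      obtain ⟨p, hp, hne⟩ := Finset.exists_ne_zero_of_sum_ne_zero h3.ne'
      have hp' := Finset.mem_range.1 hp
      have hgp : gram z q p = P := by
        by_contra h; simp [h] at hne
      have hex : ∃ j, G j = G p := ⟨p, rfl⟩
      have hfle := Nat.find_min' hex rfl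
      have hfs := Nat.find_spec hex
      have hgf : gram z q (Nat.find hex) = P := by
        rw [← hgp]; exact (hG _ _ (by omega) (by omega)).1 hfs
      refine ⟨Nat.find hex, ⟨by omega, fun j hj h => Nat.find_min hex hj (h.trans hfs), ?_⟩, ?_, ?_⟩
      · rw [hgf]; exact Finset.card_pos.2 h2
      · rw [drop_take_eq_gram (by omega), hgf]
      · rw [htot _ (by omega), hgf]

/-! ### The algorithm -/

open Cmd QGram.Expr in
/-- Computes the `q`-gram frequencies of the string represented by the input. -/
def main : Cmd :=
  (assign .q (inp 0) ;; assign .n (inp 1) ;; assign .N (var .n * (2 * var .q)) ;;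
    assign .len (var .N) ;; assign .off 0 ;; assign .qq (var .q) ;; assign .k 0) ;;
  countVars ;; borders ;; windows ;; nameLetters ;; nameGrams ;; report

theorem main_spec {s : HState} {n q σ L R : ℕ} {T : ℕ → List ℕ} (hq0 : 0 < q) (hn0 : 0 < n)
    (hBS : 16 * S + 64 ≤ B) (hS : S = 16 * (n * q)) (hq : s.inp 0 = q) (hn : s.inp 1 = n)
    (hI : Input s.inp n σ T) (hσ0 : 0 < σ) (hσB : σ * (n * (2 * q) + 1) ≤ B)
    (hσR : σ ≤ (n * (2 * q) + 1) ^ R) (hL : L = (T (n - 1)).length) (hLB : 2 * L + 2 ≤ B)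
    (hNL : n * (2 * q) * L < B) (h0 : ∀ b i, s.a b i = 0) :
    HT B S main s ((64 * R + 12000) * (n * q)) (fun s' => s'.v .N = n * (2 * q) ∧
      s'.v .cnt ≤ n * (2 * q) ∧
      RepresentsFreqs q (T (n - 1)) ((List.range (n * (2 * q))).map (s'.a .Z))
        ((List.range (s'.v .cnt)).map fun m => (s'.a .OUT (2 * m), s'.a .OUT (2 * m + 1)))) := by
  obtain ⟨N, hN⟩ : ∃ N, N = n * (2 * q) := ⟨_, rfl⟩
  rw [← hN] at hσB hσR hNL ⊢
  have hN2 : N = 2 * (n * q) := by rw [hN]; ring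
  have hqN : q ≤ n * q := Nat.le_mul_of_pos_left _ hn0
  have hnN : n ≤ n * q := Nat.le_mul_of_pos_right _ hq0
  have hR : (27 * N + 10) * R ≤ 64 * R * (n * q) := by
    rw [show 64 * R * (n * q) = (64 * (n * q)) * R by ring]
    exact Nat.mul_le_mul_right _ (by omega)
  have hsum : (64 * R + 12000) * (n * q) = 64 * R * (n * q) + 12000 * (n * q) := by ring
  refine HT.seq 7 ((64 * R + 12000) * (n * q) - 7) (R := fun s₁ => s₁.v .q = q ∧ s₁.v .n = n ∧
    s₁.v .N = N ∧ s₁.v .len = N ∧ s₁.v .off = 0 ∧ s₁.v .qq = q ∧ s₁.v .k = 0)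
    (.straight (fun _ => ?_) le_rfl fun _ => ?_) ?_ (by omega)
  · simp [Cmd.Safe, Cmd.run, hq, hn, ← hN]; omega
  · simp [Cmd.run, hq, hn, ← hN]
  rintro s₁ hw₁ hF₁ ⟨hq₁, hn₁, hN₁, hlen₁, hoff₁, hqq₁, hk₁⟩
  have h0₁ : ∀ b i, s₁.a b i = 0 := fun b i => by rw [hF₁.a b (by simp [Cmd.arrs])]; exact h0 b i
  have hI₁ : Input s₁.inp n σ T := by rw [hF₁.inp]; exact hI
  refine HT.seq _ ((64 * R + 12000) * (n * q) - 7 - (8 * n + 3))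
    (countVars_spec hBS hn₁ hn0 (by omega) hI₁ hL hLB (h0₁ _)) ?_ (by omega)
  rw [hF₁.inp]
  rintro s₂ hw₂ hF₂ ⟨hocc, hadd⟩
  have h0₂ : ∀ b, b ≠ Arr.OCC → ∀ i, s₂.a b i = 0 := fun b hb i => by
    rw [hF₂.a b (by simp [Cmd.arrs, countVars, Cmd.forTo]; exact hb)]; exact h0₁ b i
  have hI₂ : Input s₂.inp n σ T := by rw [hF₂.inp]; exact hI₁
  have hq₂ : s₂.v .q = q := (hF₂.v _ (by decide)).trans hq₁
  have hn₂ : s₂.v .n = n := (hF₂.v _ (by decide)).trans hn₁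
  refine HT.seq _ (64 * R * (n * q) + 11000 * (n * q))
    (borders_spec hBS hn₂ hq₂ hq0 (by omega) (by omega) (by omega) hI₂ hσ0 (h0₂ _ (by decide))
      (h0₂ _ (by decide))) ?_ (by omega)
  rintro s₃ hw₃ hF₃ ⟨hPL, hPσ, hSσ, hP, hSu⟩
  have hI₃ : Input s₃.inp n σ T := by rw [hF₃.inp]; exact hI₂
  have hq₃ : s₃.v .q = q := (hF₃.v _ (by decide)).trans hq₂
  have hn₃ : s₃.v .n = n := (hF₃.v _ (by decide)).trans hn₂
  have h0₃ : ∀ b, b ≠ Arr.OCC → b ≠ .PL → b ≠ .PRE → b ≠ .SUF → ∀ i, s₃.a b i = 0 :=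
    fun b h1 h2 h3 h4 i => by
      rw [hF₃.a b (by simp [Cmd.arrs, borders, Cmd.forTo]; tauto)]; exact h0₂ b h1 i
  have hO₃ : s₃.a .OCC = s₂.a .OCC := hF₃.a _ (by decide)
  refine HT.seq _ (64 * R * (n * q) + 10000 * (n * q))
    (windows_spec hBS hn₃ hq₃ hq0 (by omega) (by omega) hI₃ hσ0 hPL hPσ hSσ hP hSu
      (h0₃ _ (by decide) (by decide) (by decide) (by decide))
      (h0₃ _ (by decide) (by decide) (by decide) (by decide))) ?_ (by omega)
  rw [hO₃, hF₃.inp, hF₂.inp, hF₁.inp]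
  rintro s₄ hw₄ hF₄ ⟨hZσ, hwin⟩
  have h0₄ : ∀ b, b ≠ Arr.OCC → b ≠ .PL → b ≠ .PRE → b ≠ .SUF → b ≠ .Z → b ≠ .WT →
      ∀ i, s₄.a b i = 0 := fun b h1 h2 h3 h4 h5 h6 i => by
    rw [hF₄.a b (by simp [Cmd.arrs, windows, placeWindow, Cmd.forTo]; tauto)]
    exact h0₃ b h1 h2 h3 h4 i
  have hv₄ : ∀ x, x ∉ countVars.vars → x ∉ borders.vars → x ∉ windows.vars → s₄.v x = s₁.v x :=
    fun x h1 h2 h3 => (hF₄.v x h3).trans ((hF₃.v x h2).trans (hF₂.v x h1))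
  have hN₄ : s₄.v .N = N := (hv₄ _ (by decide) (by decide) (by decide)).trans hN₁
  have hc₄ : Clean s₄ := by constructor <;> apply h0₄ <;> decide
  -- the weighted grams of the windows count the occurrences in the whole string
  have hsumocc : ∀ P : List ℕ, P.length = q → ∑ p ∈ Finset.range N,
      (if gram (s₄.a .Z) q p = P then s₄.a .WT p else 0) = (occ (T (n - 1)) P).card := by
    intro P hPq
    rw [hadd _ _ (hI.additive_card_occ (P := P) (by omega)), hN, sum_blocks, hPq]
    refine Finset.sum_congr rfl fun i hi => ?_
    obtain ⟨st, en, h1, h2, h3, h4⟩ := hwin i (Finset.mem_range.1 hi)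
    exact sum_block_eq hq0 hPq h1 h2 h3 h4
  -- positions at which no `q`-gram fits have weight `0`, hence do not need a name
  have hWT : ∀ p < N, s₄.a .WT p ≤ L ∧ (N < p + q → s₄.a .WT p = 0) := by
    intro p hp
    rw [hN] at hp
    have hi : p / (2 * q) < n := (Nat.div_lt_iff_lt_mul (by omega)).2 hp
    obtain ⟨st, en, h1, h2, h3, h4⟩ := hwin _ hi
    have ho := Nat.mod_lt p (show 0 < 2 * q by omega)
    have h5 := h4 _ ho
    rw [Nat.mul_comm (p / (2 * q)), Nat.div_add_mod] at h5
    rw [h5]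
    refine ⟨?_, fun hNp => if_neg fun hh => ?_⟩
    · split_ifs
      · exact hocc _
      · omega
    · have h6 := Nat.mul_le_mul_right (2 * q) (Nat.succ_le_of_lt hi)
      have h7 := Nat.div_add_mod p (2 * q)
      rw [Nat.succ_mul, ← hN, Nat.mul_comm (p / (2 * q))] at h6
      omega
  refine HT.seq _ (9000 * (n * q)) (nameLetters_spec (σ := σ) (R := R) hBS hN₄ (by omega) (by omega)
    hσB hσR hc₄ hZσ ?_) ?_ (by omega)
  · intro i
    rw [h0₄ .ZZ (by decide) (by decide) (by decide) (by decide) (by decide) (by decide)]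
    omega
  rintro s₅ hw₅ hF₅ ⟨hc₅, hZZ₅, hiff₅⟩
  have hvd : ∀ x, (x ∉ countVars.vars ∧ x ∉ borders.vars ∧ x ∉ windows.vars ∧
      x ∉ nameLetters.vars) → s₅.v x = s₁.v x :=
    fun x h => (hF₅.v x h.2.2.2).trans (hv₄ x h.1 h.2.1 h.2.2.1)
  refine HT.seq _ (27 * N + 10) (nameGrams_spec (N := N) (q := q) hBS (by omega) (by omega) hq0
    ((hvd _ (by decide)).trans hlen₁) ((hvd _ (by decide)).trans hoff₁)
    ((hvd _ (by decide)).trans hqq₁) ((hvd _ (by decide)).trans hk₁) hc₅ hZZ₅ ?_) ?_ (by omega)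
  · intro i
    rw [hF₅.a .G (by decide),
      h0₄ .G (by decide) (by decide) (by decide) (by decide) (by decide) (by decide)]
    omega
  rintro s₆ hw₆ hF₆ ⟨hG₆, hiff₆⟩
  have hN₆ : s₆.v .N = N := ((hF₆.v _ (by decide)).trans (hvd _ (by decide))).trans hN₁
  have hq₆ : s₆.v .q = q := ((hF₆.v _ (by decide)).trans (hvd _ (by decide))).trans hq₁
  have hWT₆ : s₆.a .WT = s₄.a .WT := (hF₆.a _ (by decide)).trans (hF₅.a _ (by decide))
  have hZ₆ : s₆.a .Z = s₄.a .Z := (hF₆.a _ (by decide)).trans (hF₅.a _ (by decide))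
  have hFR₆ : s₆.a .FR = s₄.a .FR := (hF₆.a _ (by decide)).trans (hF₅.a _ (by decide))
  refine HT.conseq (report_spec (N := N) (q := q) (L := L) hBS hN₆ hq₆ (by omega) hq0 (by omega)
    hG₆ (fun i hi => by rw [hWT₆]; exact (hWT i hi).1) hNL (fun i => by
      rw [hFR₆]
      exact h0₄ .FR (by decide) (by decide) (by decide) (by decide) (by decide) (by decide) i))
    (by omega) ?_
  rintro s₇ hw₇ hF₇ ⟨hcnt, hout⟩
  refine ⟨(hF₇.v _ (by decide)).trans hN₆, hcnt, ?_⟩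
  rw [hout, hF₇.a .Z (by decide), hZ₆, hWT₆]
  refine representsFreqs_leaders (by omega) (fun i j hi hj => ?_) fun P hPq => ?_
  · rw [hiff₆ i j hi hj, gram_eq_gram_iff]
    exact forall₂_congr fun t ht => hiff₅ _ (by omega) _ (by omega)
  · rw [← hsumocc P hPq]
    refine Finset.sum_subset (fun x hx => ?_) fun p hp hp' => ?_
    · rw [Finset.mem_range] at hx ⊢; omega
    · rw [Finset.mem_range] at hp hp'
      rw [(hWT p hp).2 (by omega), ite_self]

/-! ### The machine program -/

theorem getElem?_flatMap_three {α β : Type*} {f : α → List β} (hf : ∀ a, (f a).length = 3)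
    (l : List α) (i j : ℕ) (hj : j < 3) : (l.flatMap f)[3 * i + j]? = l[i]?.bind fun a => (f a)[j]? := by
  induction l generalizing i with
  | nil => simp
  | cons a l ih =>
    rw [List.flatMap_cons]
    cases i with
    | zero => rw [List.getElem?_append_left (by rw [hf]; omega)]; simp
    | succ i =>
      rw [List.getElem?_append_right (by rw [hf]; omega), hf,
        show 3 * (i + 1) + j - 3 = 3 * i + j by omega, ih]
      simp

theorem length_encode_expr {σ i : ℕ} (e : SLPExpr (Fin σ) i) : e.encode.length = 3 := by
  cases e <;> rfl

/-- The words of the input, continued by zeros. -/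
def inputWord {σ : ℕ} (P : SLP (Fin σ)) (q i : ℕ) : ℕ := (P.encode q).getD i 0

theorem inputWord_expr {σ : ℕ} (P : SLP (Fin σ)) (q : ℕ) (i : Fin P.size) (j : ℕ) (hj : j < 3) :
    inputWord P q (2 + j + 3 * i) = (P.expr i).encode.getD j 0 := by
  have h : (List.finRange P.size)[(i : ℕ)]? = some i := by simp
  rw [inputWord, SLP.encode, show 2 + j + 3 * (i : ℕ) = (3 * i + j) + 1 + 1 by omega,
    List.getD_cons_succ, List.getD_cons_succ, List.getD_eq_getElem?_getD,
    getElem?_flatMap_three (fun _ => length_encode_expr _) _ _ _ hj, h, List.getD_eq_getElem?_getD]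
  rfl

theorem length_encode {σ : ℕ} (P : SLP (Fin σ)) (q : ℕ) :
    (P.encode q).length = 2 + 3 * P.size := by
  simp [SLP.encode, List.length_flatMap, length_encode_expr]
  omega

theorem inputWord_eq_zero {σ : ℕ} (P : SLP (Fin σ)) (q i : ℕ) (hi : 2 + 3 * P.size ≤ i) :
    inputWord P q i = 0 :=
  List.getD_eq_default _ _ (by rw [length_encode]; exact hi)

theorem inputWord_le {σ : ℕ} (P : SLP (Fin σ)) (q i : ℕ) : inputWord P q i ≤ q + P.size + σ := by
  have h : ∀ y ∈ P.encode q, y ≤ q + P.size + σ := by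
    intro y hy
    have hs := P.size_pos
    simp only [SLP.encode, List.mem_cons, List.mem_flatMap] at hy
    rcases hy with rfl | rfl | ⟨k, -, hk⟩
    · omega
    · omega
    · have := k.isLt
      generalize P.expr k = e at hk
      cases e with
      | letter a =>
        have := a.isLt
        simp only [SLPExpr.encode, List.mem_cons, List.not_mem_nil, or_false] at hk
        omega
      | pair l r =>
        have := l.isLt
        have := r.isLt
        simp only [SLPExpr.encode, List.mem_cons, List.not_mem_nil, or_false] at hk
        omega
  rw [inputWord, List.getD_eq_getElem?_getD]
  cases e : (P.encode q)[i]? with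
  | none => simp
  | some y => exact h y (List.mem_of_getElem? e)

/-- The strings derived from the variables, as lists of numbers. -/
def derived {σ : ℕ} (P : SLP (Fin σ)) (i : ℕ) : List ℕ :=
  if h : i < P.size then (P.val ⟨i, h⟩).map Fin.val else []

theorem input_derived {σ : ℕ} (P : SLP (Fin σ)) (q : ℕ) :
    Input (inputWord P q) P.size σ (derived P) := by
  constructor
  intro i hi
  have h0 := inputWord_expr P q ⟨i, hi⟩ 0 (by omega)
  have h1 := inputWord_expr P q ⟨i, hi⟩ 1 (by omega)
  have h2 := inputWord_expr P q ⟨i, hi⟩ 2 (by omega)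
  simp only [add_zero, Nat.reduceAdd] at h0 h1 h2
  rw [h0, h1, h2]
  cases e : P.expr ⟨i, hi⟩ with
  | letter a =>
    refine .inl ⟨rfl, a.isLt, ?_⟩
    rw [derived, dif_pos hi, SLP.val, e]
    rfl
  | pair l r =>
    refine .inr ⟨rfl, l.isLt, r.isLt, ?_⟩
    have hl : (l : ℕ) < P.size := l.isLt.trans hi
    have hr : (r : ℕ) < P.size := r.isLt.trans hi
    simp only [SLPExpr.encode, List.getD_cons_succ, List.getD_cons_zero]
    rw [derived, dif_pos hi, SLP.val, e, derived, dif_pos hl, derived, dif_pos hr]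
    exact List.map_append

/-- Computes the address and the length of the arrays from `q` and the size of the straight line
program. -/
def prologue : Prog :=
  .seq (.load 103 102) (.seq (.const 102 1) (.seq (.load 104 102) (.seq (.const 105 3)
    (.seq (.arith .mul 100 104 105) (.seq (.const 105 2) (.seq (.arith .add 100 100 105)
      (.seq (.arith .mul 101 104 103) (.seq (.const 105 16) (.arith .mul 101 101 105)))))))))

/-- Stores the addresses of the arrays `Z` and `OUT`. -/
def epilogue : Prog :=
  .seq (.const 102 0) (.seq (.arith .add 0 100 102) (.arith .add 2 100 101))

theorem prologue_exec {M W : ℕ} (hMW : M < W) {m : ℕ → ℕ}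
    (h : 2 + 3 * m 1 + 24 * (16 * (m 1 * m 0)) ≤ M) (hm : 16 < M) :
    ∃ r', Exec M W prologue ⟨fun _ => 0, m⟩ 10 r' ∧ r'.mem = m ∧ r'.reg 100 = 2 + 3 * m 1 ∧
      r'.reg 101 = 16 * (m 1 * m 0) ∧ ∀ x < 100, r'.reg x = 0 := by
  have e16 : m 1 * m 0 * 16 = 16 * (m 1 * m 0) := Nat.mul_comm _ _
  refine ⟨_, .seq _ _ _ _ _ 1 9 (.load _ _ _ ?_) (.seq _ _ _ _ _ 1 8 (.const _ _ _ ?_)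
    (.seq _ _ _ _ _ 1 7 (.load _ _ _ ?_) (.seq _ _ _ _ _ 1 6 (.const _ _ _ ?_)
    (.seq _ _ _ _ _ 1 5 (.arith _ _ _ _ _ ?_) (.seq _ _ _ _ _ 1 4 (.const _ _ _ ?_)
    (.seq _ _ _ _ _ 1 3 (.arith _ _ _ _ _ ?_) (.seq _ _ _ _ _ 1 2 (.arith _ _ _ _ _ ?_)
    (.seq _ _ _ _ _ 1 1 (.const _ _ _ ?_) (.arith _ _ _ _ _ ?_))))))))), rfl, ?_, ?_, ?_⟩
  · simp; omega
  · omega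
  · simp [State.setReg]; omega
  · omega
  · simp [State.setReg, BinOp.eval]; omega
  · omega
  · simp [State.setReg, BinOp.eval]; omega
  · simp [State.setReg, BinOp.eval]; omega
  · omega
  · simp [State.setReg, BinOp.eval]; omega
  · simp [State.setReg, BinOp.eval]; omega
  · simp [State.setReg, BinOp.eval]; omega
  · intro x hx
    simp [State.setReg, Function.update_apply]
    split_ifs <;> omega

theorem pow_seven_bounds {x : ℕ} (hx : 3 ≤ x) : 256 * x + 64 ≤ x ^ 7 ∧ x * (2 * x + 1) ≤ x ^ 7 := by
  have h1 : 3 ^ 6 ≤ x ^ 6 := Nat.pow_le_pow_left hx 6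
  have h2 : 3 ^ 5 ≤ x ^ 5 := Nat.pow_le_pow_left hx 5
  constructor
  · calc 256 * x + 64 ≤ 3 ^ 6 * x := by omega
      _ ≤ x ^ 6 * x := Nat.mul_le_mul_right _ h1
      _ = x ^ 7 := by ring
  · calc x * (2 * x + 1) ≤ x * (3 ^ 5 * x) := Nat.mul_le_mul_left _ (by omega)
      _ ≤ x * (x ^ 5 * x) := Nat.mul_le_mul_left _ (Nat.mul_le_mul_right _ h2)
      _ = x ^ 7 := by ring

/-- With `C * y` memory cells, every address fits into a word. -/
theorem mul_lt_pow {C x y : ℕ} (hC : 2 ≤ C) (hx : 3 ≤ x) (hy : y ≤ x) : C * y < x ^ C := by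
  obtain ⟨D, rfl⟩ : ∃ D, C = D + 1 := ⟨C - 1, by omega⟩
  have h1 : D < 2 ^ D := Nat.lt_two_pow_self
  have h2 : 2 ^ D < 3 ^ D := Nat.pow_lt_pow_left (by norm_num) (by omega)
  have h3 : 3 ^ D ≤ x ^ D := Nat.pow_le_pow_left hx D
  calc (D + 1) * y ≤ (D + 1) * x := Nat.mul_le_mul_left _ hy
    _ < x ^ D * x := Nat.mul_lt_mul_of_pos_right (by omega) (by omega)
    _ = x ^ (D + 1) := by ring

/-- The program consists of the compiled algorithm, surrounded by the computation of the addresses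
of its arrays. -/
theorem exec_program {σ q R C : ℕ} (P : SLP (Fin σ)) (hq0 : 0 < q)
    (hσR : σ ≤ (P.size * (2 * q) + 1) ^ R) (hC1 : 7 * main.size ≤ C)
    (hC2 : (8 * main.size + 10) * (64 * R + 12000) + 13 ≤ C) :
    ∃ t s, Exec (C * (q * P.size)) ((P.string.length + q * P.size + σ) ^ C)
      (.seq prologue (.seq main.compile epilogue)) (State.ofInput (P.encode q)) t s ∧
      t ≤ C * (q * P.size) ∧
      s.ReportsFreqs (C * (q * P.size)) q (P.string.map Fin.val) := by
  have hn0 := P.size_pos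
  obtain ⟨n, hn⟩ : ∃ n, n = P.size := ⟨_, rfl⟩
  have hI := input_derived P q
  have hstr : derived P (n - 1) = P.string.map Fin.val := by
    rw [derived, dif_pos (by omega), SLP.string]
    subst hn; rfl
  have hL : (derived P (n - 1)).length = P.string.length := by rw [hstr, List.length_map]
  obtain ⟨L, hL'⟩ : ∃ L, L = (derived P (n - 1)).length := ⟨_, rfl⟩
  have hL0 : 0 < L := hL' ▸ hI.length_pos _ (by omega)
  rw [← hL, ← hL', ← hstr, ← hn]
  rw [← hn] at hσR hn0 hI
  have hσ0 : 0 < σ := by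
    rcases hI.spec 0 hn0 with ⟨-, h, -⟩ | ⟨-, h, -⟩ <;> omega
  obtain ⟨y, hy⟩ : ∃ y, y = n * q := ⟨_, rfl⟩
  have hqn : q * n = y := by rw [hy, Nat.mul_comm]
  have hqy : q ≤ y := hy ▸ Nat.le_mul_of_pos_left _ hn0
  have hny : n ≤ y := hy ▸ Nat.le_mul_of_pos_right _ hq0
  have hN : n * (2 * q) = 2 * y := by rw [hy]; ring
  rw [hqn]
  obtain ⟨x, hx⟩ : ∃ x, x = L + y + σ := ⟨_, rfl⟩
  rw [← hx]
  have hx3 : 3 ≤ x := by omega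
  obtain ⟨hB1, hB2⟩ := pow_seven_bounds hx3
  -- `x ^ 7` bounds the numbers in the arrays, because of `pow_seven_bounds`
  set B := x ^ 7 with hB
  set S := 16 * y with hS
  set W := x ^ C with hW
  have hC : 12000 ≤ C := by
    have : 1 * 12000 ≤ (8 * main.size + 10) * (64 * R + 12000) :=
      Nat.mul_le_mul (by omega) (by omega)
    omega
  have hMW : C * y < W := mul_lt_pow (by omega) hx3 (by omega)
  have hCy : 12000 * y ≤ C * y := Nat.mul_le_mul_right _ hC
  have hBW : B ^ main.size ≤ W := by
    rw [hB, hW, ← pow_mul]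
    exact Nat.pow_le_pow_right (by omega) hC1
  have hi0 : inputWord P q 0 = q := rfl
  have hi1 : inputWord P q 1 = n := hn.symm
  obtain ⟨r₀, he₀, hm₀, hb₀, hs₀, hv₀⟩ := prologue_exec hMW (m := inputWord P q)
    (by rw [hi0, hi1, ← hy]; omega) (by omega)
  rw [hi1] at hb₀
  rw [hi0, hi1, ← hy, ← hS] at hs₀
  let s₀ : HState := ⟨fun _ => 0, fun _ _ => 0, inputWord P q⟩
  have hbase : ∀ i, 2 + 3 * n ≤ i → inputWord P q i = 0 := fun i hi =>
    inputWord_eq_zero P q i (hn ▸ hi)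
  have hR₀ : Rel (C * y) B S (2 + 3 * n) s₀ r₀ :=
    { wf := ⟨fun _ => by show 0 < B; omega, fun _ _ => by show 0 < B; omega, fun _ _ _ => rfl,
        fun i => by
          have h := inputWord_le P q i
          rw [← hn] at h
          show inputWord P q i < B
          omega⟩
      reg := fun z => hv₀ _ z.reg_lt
      reg_base := hb₀
      reg_stride := hs₀
      mem := fun b i _ => by rw [hm₀]; exact hbase _ (by omega)
      inp := fun i _ => by rw [hm₀]
      inp_out := hbase
      fits := by omega }
  obtain ⟨t, s₁, hex, ht, hN₁, hcnt, hrep⟩ := main_spec (s := s₀) (R := R) (n := n) (L := L) hq0 hn0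
    (by omega) (by omega) hi0 hi1 hI hσ0
    (by
      rw [hN]
      exact (Nat.mul_le_mul (by omega) (by omega)).trans hB2)
    hσR hL' (by omega)
    (by
      rw [hN]
      refine lt_of_lt_of_le ?_ hB2
      rw [Nat.mul_comm x]
      exact Nat.mul_lt_mul_of_lt_of_le (by omega) (by omega) (by omega))
    (fun _ _ => rfl) hR₀.wf
  obtain ⟨t', r₁, he₁, ht', hR₁⟩ := Cmd.compile_exec (by omega) hMW hex le_rfl hBW r₀ hR₀
  have hb₁ := hR₁.reg_base
  have hs₁ := hR₁.reg_stride
  have hreg1 := hR₁.reg .N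
  have hreg3 := hR₁.reg .cnt
  rw [hN₁, hN] at hreg1
  rw [hN] at hcnt hrep
  refine ⟨_, _, .seq _ _ _ _ _ 10 (t' + 3) he₀ (.seq _ _ _ _ _ t' 3 he₁
    (.seq _ _ _ _ _ 1 2 (.const _ _ _ ?_) (.seq _ _ _ _ _ 1 1 (.arith _ _ _ _ _ ?_)
      (.arith _ _ _ _ _ ?_)))), ?_, ?_⟩
  · omega
  · simp [State.setReg, BinOp.eval, hb₁]; omega
  · simp [State.setReg, BinOp.eval, hb₁, hs₁]; omega
  · have h1 : (8 * main.size + 10) * t ≤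
        (8 * main.size + 10) * ((64 * R + 12000) * (n * q)) := Nat.mul_le_mul_left _ ht
    have h2 := Nat.mul_le_mul_right y hC2
    rw [← hy, ← Nat.mul_assoc] at h1
    rw [Nat.add_mul _ 13] at h2
    omega
  · have h1 : Var.N.reg = 1 := rfl
    have h3 : Var.cnt.reg = 3 := rfl
    rw [h1] at hreg1
    rw [h3] at hreg3
    simp only [State.ReportsFreqs, State.block, State.pairs, State.setReg, BinOp.eval]
    simp [hb₁, hs₁, hreg1, hreg3]
    refine ⟨by omega, by omega, ?_⟩
    convert hrep using 1
    · refine List.map_congr_left fun k hk => ?_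
      have hk := List.mem_range.1 hk
      have := hR₁.mem .Z k (by omega)
      have hZ : Arr.num .Z = 0 := rfl
      rw [hZ, zero_mul, add_zero] at this
      exact this
    · refine List.map_congr_left fun k hk => ?_
      have hk := List.mem_range.1 hk
      have e1 := hR₁.mem .OUT (2 * k) (by omega)
      have e2 := hR₁.mem .OUT (2 * k + 1) (by omega)
      have hO : Arr.num .OUT = 1 := rfl
      rw [hO, one_mul] at e1 e2
      rw [← e1, ← e2]
      rfl

end QGram

theorem mainTheorem1 :
    ∃ prog : RAM.Prog, ∀ c : ℕ, ∃ C : ℕ,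
      ∀ (σ : ℕ) (S : SLP (Fin σ)) (q : ℕ), 0 < q → σ ≤ c * (q * S.size) ^ c →
        ∃ (t : ℕ) (s : RAM.State),
          RAM.Exec (C * (q * S.size)) ((S.string.length + q * S.size + σ) ^ C) prog
            (RAM.State.ofInput (S.encode q)) t s ∧
          t ≤ C * (q * S.size) ∧
          s.ReportsFreqs (C * (q * S.size)) q (S.string.map Fin.val) := by
  refine ⟨.seq QGram.prologue (.seq QGram.main.compile QGram.epilogue), fun c =>
    ⟨7 * QGram.main.size + ((8 * QGram.main.size + 10) * (64 * (2 * c) + 12000) + 13),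
      fun σ S q hq hσ => QGram.exec_program S hq (R := 2 * c) (hσ.trans ?_) (by omega) (by omega)⟩⟩
  have hs := S.size_pos
  have hN : 1 < S.size * (2 * q) + 1 := by
    have := Nat.mul_pos hs (show 0 < 2 * q by omega)
    omega
  -- `c ≤ 2 ^ c ≤ (2 * q * n + 1) ^ c`
  rw [two_mul c, pow_add]
  refine Nat.mul_le_mul (Nat.lt_pow_self hN).le (Nat.pow_le_pow_left ?_ c)
  have : S.size * (2 * q) = 2 * (q * S.size) := by ring
  omega
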